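/- **Notation.** All vector spaces are real. For a finite-dimensional vector space $V$ put $\lambda(V)=\Lambda^{\dim V}V$ and $\lambda^*(V)=\mathrm{Hom}(\lambda(V),\mathbb R)$; for $0\neq a\in\lambda(V)$ let $a^*\in\lambda^*(V)$ be the element with $a^*(a)=1$. A linear isomorphism $\phi\colon V\to W$ induces an isomorphism $\lambda(\phi)\colon\lambda(V)\to\lambda(W)$. For an exact sequence $0\to V'\overset{i}{\to}V\overset{j}{\to}V''\to0$ write $x\wedge u\in\lambda(V)$ for the image of $x\otimes u$ under the isomorphism $\lambda(V')\otimes\lambda(V'')\to\lambda(V)$, $$(v_1'\wedge\dots\wedge v_k')\otimes(j(v_1)\wedge\dots\wedge j(v_l))\mapsto i(v_1')\wedge\dots\wedge i(v_k')\wedge v_1\wedge\dots\wedge v_l .$$ For Banach spaces $X,Y$ let $\mathcal F(X,Y)$ be the space of bounded Fredholm operators $X\to Y$, with the norm topology, and let $\mathcal F^*(X,Y)$ be the subspace of surjective ones. For $D\in\mathcal F(X,Y)$ let $\kappa(D)=\ker D$, $\mathfrak c(D)=Y/\mathrm{Im}\,D$, $\mathrm{ind}\,D=\dim\kappa(D)-\dim\mathfrak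 c(D)$, $\lambda(D)=\lambda(\kappa(D))\otimes\lambda^*(\mathfrak c(D))$, and let $\det_{X,Y}=\bigsqcup_{D\in\mathcal F(X,Y)}\lambda(D)$. **Exact triples.** For Banach spaces $X,Y,X',Y',X'',Y''$ let $\mathcal T(X,Y;X',Y';X'',Y'')$ be the space of tuples $t=(D,D',D'',i_X,j_X,i_Y,j_Y)$, where $D\colon X\to Y$, $D'\colon X'\to Y'$, $D''\colon X''\to Y''$ are Fredholm operators and $0\to X'\overset{i_X}{\to}X\overset{j_X}{\to}X''\to0$ and $0\to Y'\overset{i_Y}{\to}Y\overset{j_Y}{\to}Y''\to0$ are exact sequences of bounded linear maps with $Di_X=i_YD'$ and $D''j_X=j_YD$. It carries the topology induced by the operator norms. Let $\pi_C(t)=D$, $\pi_L(t)=D'$, $\pi_R(t)=D''$. The snake lemma gives the exact sequence $$0\to\kappa(D')\overset{i_X}{\to}\kappa(D)\overset{j_X}{\to}\kappa(D'')\overset{\delta}{\to}\mathfrak c(D')\overset{i_Y}{\to}\mathfrak c(D)\overset{j_Y}{\to}\mathfrak c(D'')\to0,$$ with $\delta(j_X(x))=[y']$ whenever $i_Y(y')=Dx$.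 There is a unique isomorphism $\Psi_t\colon\lambda(D')\otimes\lambda(D'')\to\lambda(D)$ such that $$\Psi_t\Big(x\otimes(\delta(v)\wedge w)^*\otimes(j_X(u)\wedge v)\otimes(j_Y(y))^*\Big)=(-1)^{\epsilon_t}\,(x\wedge u)\otimes(i_Y(w)\wedge y)^*,$$ $$\epsilon_t=(\mathrm{ind}\,D'')\dim\mathfrak c(D')+\dim\mathfrak c(D)\cdot\dim\mathrm{Im}\,\delta,$$ for all nonzero $x\in\lambda(\kappa(D'))$, $u\in\lambda(\kappa(D)/i_X\kappa(D'))$, $v\in\lambda(\kappa(D'')/j_X\kappa(D))$, $w\in\lambda(\mathfrak c(D')/\mathrm{Im}\,\delta)$, $y\in\lambda(\mathfrak c(D)/i_Y\mathfrak c(D'))$; here the maps induced by $i_X,j_X,\delta,i_Y,j_Y$ on quotients and on top exterior powers are denoted by the same letters. **Topology on $\det_{X,Y}$.** If $D\in\mathcal F^*(X,Y)$ and $T\colon Y\to X$ is a bounded right inverse of $D$, let $\Phi_E\colon\kappa(E)\to\kappa(D)$, $x\mapsto x-TDx$, for $E\in\mathcal F^*(X,Y)$. The restriction of $\det_{X,Y}$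 to $\mathcal F^*(X,Y)$ has the topology glued from the trivializations $$\{E\in\mathcal F^*(X,Y)\mid\Phi_E\text{ is an isomorphism}\}\times\lambda(D)\to\det\nolimits_{X,Y},\qquad(E,x\otimes1^*)\mapsto\lambda(\Phi_E)^{-1}(x)\otimes1^*.$$ For $\Theta\in\mathrm{Hom}(\mathbb R^N,Y)$ and $D\in\mathcal F(X,Y)$ let $D_\Theta\colon X\oplus\mathbb R^N\to Y$, $D_\Theta(x,u)=Dx+\Theta u$. The exact triple given by $0\to X\to X\oplus\mathbb R^N\to\mathbb R^N\to0$ and $0\to Y\overset{\mathrm{id}}{\to}Y\to0\to0$, with Fredholm operators $D,\ D_\Theta,\ 0$, yields an isomorphism $\hat{\mathcal I}_{\Theta;D}\colon\lambda(D)\to\lambda(D_\Theta)$, $\sigma\mapsto\Psi(\sigma\otimes(\Omega_N\otimes1^*))$, where $\Omega_N=e_1\wedge\dots\wedge e_N$. The topology of $\det_{X,Y}$ is glued from the restrictions of $\det_{X,Y}$ to the sets $U_\Theta=\{D\in\mathcal F(X,Y)\mid D_\Theta\text{ is surjective}\}$ (for all $N\ge0$ and all $\Theta$), where the topology over $U_\Theta$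 is such that $\hat{\mathcal I}_{\Theta;D}$, $D\in U_\Theta$, identify $\det_{X,Y}|_{U_\Theta}$ with the pullback of $\det_{X\oplus\mathbb R^N,Y}|_{\mathcal F^*(X\oplus\mathbb R^N,Y)}$ by $D\mapsto D_\Theta$. **Theorem.** Let $X,Y,X',Y',X'',Y''$ be real Banach spaces. Then $\det_{X,Y}\to\mathcal F(X,Y)$, $\det_{X',Y'}\to\mathcal F(X',Y')$ and $\det_{X'',Y''}\to\mathcal F(X'',Y'')$ are (locally trivial) real line bundles, and the family of isomorphisms $\Psi_t$ is a continuous isomorphism of line bundles $$\Psi\colon\pi_L^*\det\nolimits_{X',Y'}\otimes\pi_R^*\det\nolimits_{X'',Y''}\to\pi_C^*\det\nolimits_{X,Y}$$ over the whole space $\mathcal T(X,Y;X',Y';X'',Y'')$, i.e. $\Psi$ is a homeomorphism of the total spaces that covers the identity and is linear on the fibers. -/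

import Mathlib

open Module Bundle Topology
open scoped TensorProduct

namespace DetBundle

noncomputable section

section Algebra

variable {V V' V'' W : Type*}
  [AddCommGroup V] [Module ℝ V] [AddCommGroup V'] [Module ℝ V']
  [AddCommGroup V''] [Module ℝ V''] [AddCommGroup W] [Module ℝ W]

/-- The top exterior power `λ(V)` of a finite-dimensional real vector space. -/
abbrev TopExt (V : Type*) [AddCommGroup V] [Module ℝ V] : Type _ := ⋀[ℝ]^(finrank ℝ V) V

theorem finrank_topExt [FiniteDimensional ℝ V] : finrank ℝ (TopExt V) = 1 := by
  rw [exteriorPower.finrank_eq, Nat.choose_self]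

/-- The isomorphism `λ(e)` induced by a linear isomorphism `e`, i.e.
`v₁ ∧ … ∧ vₖ ↦ e v₁ ∧ … ∧ e vₖ`. -/
def TopExt.congr (e : V ≃ₗ[ℝ] W) : TopExt V ≃ₗ[ℝ] TopExt W :=
  have h₁ : exteriorPower.map (finrank ℝ V) (e : V →ₗ[ℝ] W) ∘ₗ
      exteriorPower.map (finrank ℝ V) (e.symm : W →ₗ[ℝ] V) = LinearMap.id := by
    rw [← exteriorPower.map_comp]; simp
  have h₂ : exteriorPower.map (finrank ℝ V) (e.symm : W →ₗ[ℝ] V) ∘ₗ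
      exteriorPower.map (finrank ℝ V) (e : V →ₗ[ℝ] W) = LinearMap.id := by
    rw [← exteriorPower.map_comp]; simp
  let e₁ : ⋀[ℝ]^(finrank ℝ V) V ≃ₗ[ℝ] ⋀[ℝ]^(finrank ℝ V) W := LinearEquiv.ofLinearMap _ _ h₁ h₂
  e₁ ≪≫ₗ LinearEquiv.ofEq _ _ (by rw [e.finrank_eq])

/-- A short exact sequence `0 → V' → V → V'' → 0`. -/
structure IsSES (i : V' →ₗ[ℝ] V) (j : V →ₗ[ℝ] V'') : Prop where
  inj : Function.Injective i
  exact : Function.Exact i j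
  surj : Function.Surjective j

namespace IsSES

variable {i : V' →ₗ[ℝ] V} {j : V →ₗ[ℝ] V''} (h : IsSES i j)

/-- A linear section of the surjection in a short exact sequence. -/
def sec : V'' →ₗ[ℝ] V :=
  (j.exists_rightInverse_of_surjective (LinearMap.range_eq_top.2 h.surj)).choose

theorem j_sec (x : V'') : j (h.sec x) = x :=
  LinearMap.congr_fun
    (j.exists_rightInverse_of_surjective (LinearMap.range_eq_top.2 h.surj)).choose_spec x

/-- The splitting of a short exact sequence. -/
def split : (V' × V'') ≃ₗ[ℝ] V :=
  LinearEquiv.ofBijective (i.coprod h.sec) (by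
    have hji : ∀ x, j (i x) = 0 := fun x => (h.exact _).2 ⟨x, rfl⟩
    constructor
    · rw [injective_iff_map_eq_zero]
      rintro ⟨x, y⟩ hxy
      simp only [LinearMap.coprod_apply] at hxy
      have hy : y = 0 := by
        have := congrArg j hxy
        simpa [hji, h.j_sec] using this
      subst hy
      have hx : i x = 0 := by simpa using hxy
      simp [(injective_iff_map_eq_zero i).1 h.inj x hx]
    · intro v
      obtain ⟨x, hx⟩ := (h.exact (v - h.sec (j v))).1 (by simp [h.j_sec])
      exact ⟨(x, j v), by simp [hx]⟩)

theorem split_apply (p : V' × V'') : h.split p = i p.1 + h.sec p.2 := rfl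

theorem finrank_add (h : IsSES i j) [FiniteDimensional ℝ V'] [FiniteDimensional ℝ V''] :
    finrank ℝ V' + finrank ℝ V'' = finrank ℝ V := by
  rw [← finrank_prod, h.split.finrank_eq]

/-- The wedge map `λ(V') × λ(V'') → λ(V)` of a short exact sequence; on decomposable
vectors it is `wedge_ιMulti` below. -/
def wedge [FiniteDimensional ℝ V'] [FiniteDimensional ℝ V''] :
    TopExt V' →ₗ[ℝ] TopExt V'' →ₗ[ℝ] TopExt V :=
  LinearMap.mk₂ ℝ
    (fun a b => ⟨(exteriorPower.map _ i a : ExteriorAlgebra ℝ V) * exteriorPower.map _ h.sec b, by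
      rw [← h.finrank_add, ExteriorAlgebra.exteriorPower, pow_add]
      exact Submodule.mul_mem_mul (Subtype.property _) (Subtype.property _)⟩)
    (fun a a' b => by ext; simp [add_mul]) (fun c a b => by ext; simp)
    (fun a b b' => by ext; simp [mul_add]) (fun c a b => by ext; simp)

theorem wedge_smul_smul [FiniteDimensional ℝ V'] [FiniteDimensional ℝ V''] (c d : ℝ)
    (a : TopExt V') (b : TopExt V'') : h.wedge (c • a) (d • b) = (c * d) • h.wedge a b := by
  rw [LinearMap.map_smul₂, map_smul, smul_smul]

end IsSES

theorem wedge_aux {n : ℕ} {i : V' →ₗ[ℝ] V} (v w : Fin n → V)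
    (hvw : ∀ k, v k - w k ∈ LinearMap.range i) (A : ExteriorAlgebra ℝ V)
    (hA : ∀ z ∈ LinearMap.range i, A * ExteriorAlgebra.ι ℝ z = 0) :
    A * ExteriorAlgebra.ιMulti ℝ n v = A * ExteriorAlgebra.ιMulti ℝ n w := by
  induction n generalizing A with
  | zero => simp
  | succ n ih =>
    have h0 : A * ExteriorAlgebra.ι ℝ (v 0) = A * ExteriorAlgebra.ι ℝ (w 0) := by
      have := hA _ (hvw 0)
      rwa [map_sub, mul_sub, sub_eq_zero] at this
    rw [ExteriorAlgebra.ιMulti_succ_apply, ExteriorAlgebra.ιMulti_succ_apply, ← mul_assoc,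
      ← mul_assoc, h0]
    refine ih _ _ (fun k => hvw k.succ) _ fun z hz => ?_
    rw [mul_assoc, eq_neg_of_add_eq_zero_left (ExteriorAlgebra.ι_add_mul_swap (w 0) z),
      mul_neg, ← mul_assoc, hA z hz, zero_mul, neg_zero]

/-- The defining property of the wedge map: for all `v'₁, …, v'ₖ ∈ V'` and `v₁, …, vₗ ∈ V`,
`(v'₁ ∧ … ∧ v'ₖ) ⊗ (j v₁ ∧ … ∧ j vₗ) ↦ i v'₁ ∧ … ∧ i v'ₖ ∧ v₁ ∧ … ∧ vₗ`. -/
theorem IsSES.wedge_ιMulti [FiniteDimensional ℝ V'] [FiniteDimensional ℝ V'']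
    {i : V' →ₗ[ℝ] V} {j : V →ₗ[ℝ] V''} (h : IsSES i j)
    (v' : Fin (finrank ℝ V') → V') (v : Fin (finrank ℝ V'') → V) :
    (h.wedge (exteriorPower.ιMulti ℝ _ v') (exteriorPower.ιMulti ℝ _ (j ∘ v)) :
        ExteriorAlgebra ℝ V) =
      ExteriorAlgebra.ιMulti ℝ _ (i ∘ v') * ExteriorAlgebra.ιMulti ℝ _ v := by
  simp only [IsSES.wedge, LinearMap.mk₂_apply, exteriorPower.map_apply_ιMulti,
    exteriorPower.ιMulti_apply_coe]
  refine wedge_aux (i := i) _ _ (fun k => ?_) _ ?_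
  · refine (h.exact _).1 ?_
    simp [h.j_sec]
  · rintro _ ⟨x, rfl⟩
    have h1 : ExteriorAlgebra.ι ℝ (i x) = ExteriorAlgebra.ιMulti ℝ 1 (fun _ => i x) := by
      simp
    rw [h1, ExteriorAlgebra.ιMulti_mul_ιMulti]
    refine AlternatingMap.map_linearDependent _ _ fun hli => ?_
    have h2 : Fin.append (i ∘ v') (fun _ : Fin 1 => i x) = i ∘ Fin.append v' (fun _ => x) := by
      ext k
      refine Fin.addCases (fun k => ?_) (fun k => ?_) k <;> simp
    rw [h2] at hli
    have := (LinearIndependent.of_comp i hli).fintype_card_le_finrank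
    simp at this

theorem ιMulti_basis_ne_zero {n : ℕ} (b : Basis (Fin n) ℝ V) :
    ExteriorAlgebra.ιMulti ℝ n b ≠ 0 := by
  intro h0
  have h1 : exteriorPower.ιMulti ℝ n b = 0 := by
    ext; simpa using h0
  have h2 := exteriorPower.alternatingMapLinearEquiv_apply_ιMulti b.det b
  rw [h1, map_zero, b.det_self] at h2
  exact zero_ne_one h2

/-- Every element of a line is a multiple of a given nonzero one. -/
theorem exists_smul_line (hV : finrank ℝ V = 1) {v : V} (hv : v ≠ 0) (w : V) :
    ∃ c : ℝ, c • v = w :=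
  (finrank_eq_one_iff_of_nonzero' v hv).1 hV w

theorem IsSES.wedge_ne_zero [FiniteDimensional ℝ V'] [FiniteDimensional ℝ V'']
    {i : V' →ₗ[ℝ] V} {j : V →ₗ[ℝ] V''} (h : IsSES i j) {a : TopExt V'} {b : TopExt V''}
    (ha : a ≠ 0) (hb : b ≠ 0) : h.wedge a b ≠ 0 := by
  let b' := finBasis ℝ V'
  let b'' := finBasis ℝ V''
  have key : h.wedge (exteriorPower.ιMulti ℝ _ b') (exteriorPower.ιMulti ℝ _ b'') ≠ 0 := by
    intro h0
    have h1 := h.wedge_ιMulti b' (h.sec ∘ b'')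
    have h2 : j ∘ h.sec ∘ b'' = b'' := by ext; simp [h.j_sec]
    rw [h2, h0, ExteriorAlgebra.ιMulti_mul_ιMulti] at h1
    have h3 : Fin.append (i ∘ b') (h.sec ∘ b'') =
        ((b'.prod b'').map h.split).reindex finSumFinEquiv := by
      ext k
      refine Fin.addCases (fun k => ?_) (fun k => ?_) k <;> simp [IsSES.split_apply]
    rw [h3] at h1
    exact ιMulti_basis_ne_zero _ h1.symm
  have hb' : exteriorPower.ιMulti ℝ _ b' ≠ 0 := fun h0 => key (by rw [h0]; simp)
  have hb'' : exteriorPower.ιMulti ℝ _ b'' ≠ 0 := fun h0 => key (by rw [h0]; simp)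
  obtain ⟨c, rfl⟩ := exists_smul_line finrank_topExt hb' a
  obtain ⟨d, rfl⟩ := exists_smul_line finrank_topExt hb'' b
  have hc : c ≠ 0 := by rintro rfl; simp at ha
  have hd : d ≠ 0 := by rintro rfl; simp at hb
  simp [hc, hd, key]

/-- A nonzero vector of a line identifies the line with `ℝ`. -/
def lineEquiv (hV : finrank ℝ V = 1) (v : V) (hv : v ≠ 0) : ℝ ≃ₗ[ℝ] V :=
  LinearEquiv.ofBijective (LinearMap.toSpanSingleton ℝ V v)
    ⟨smul_left_injective ℝ hv, fun w => exists_smul_line hV hv w⟩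

theorem lineEquiv_apply (hV : finrank ℝ V = 1) (v : V) (hv : v ≠ 0) (r : ℝ) :
    lineEquiv hV v hv r = r • v := rfl

end Algebra

/-! ### Determinant lines -/

section DetLine

/-- The line `λ(A) ⊗ λ*(C)`. -/
def DetLine (A C : Type*) [AddCommGroup A] [Module ℝ A] [AddCommGroup C] [Module ℝ C] : Type _ :=
  TopExt A ⊗[ℝ] Dual ℝ (TopExt C)

variable {A A' C C' : Type*} [AddCommGroup A] [Module ℝ A] [AddCommGroup C] [Module ℝ C]
  [AddCommGroup A'] [Module ℝ A'] [AddCommGroup C'] [Module ℝ C']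

instance : AddCommGroup (DetLine A C) :=
  inferInstanceAs (AddCommGroup (TopExt A ⊗[ℝ] Dual ℝ (TopExt C)))

instance : Module ℝ (DetLine A C) :=
  inferInstanceAs (Module ℝ (TopExt A ⊗[ℝ] Dual ℝ (TopExt C)))

/-- The element `x ⊗ α` of `λ(A) ⊗ λ*(C)`. -/
def DetLine.mk (x : TopExt A) (α : Dual ℝ (TopExt C)) : DetLine A C := x ⊗ₜ[ℝ] α

theorem DetLine.mk_smul_smul (a b : ℝ) (x : TopExt A) (α : Dual ℝ (TopExt C)) :
    DetLine.mk (a • x) (b • α) = (a * b) • DetLine.mk x α :=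
  TensorProduct.smul_tmul_smul a b x α

/-- The isomorphism `x ⊗ α ↦ λ(φ) x ⊗ (α ∘ λ(ψ⁻¹))` induced by isomorphisms `φ` and `ψ`. -/
def DetLine.congr (φ : A ≃ₗ[ℝ] A') (ψ : C ≃ₗ[ℝ] C') : DetLine A C ≃ₗ[ℝ] DetLine A' C' :=
  TensorProduct.congr (TopExt.congr φ) (TopExt.congr ψ).symm.dualMap

theorem finrank_detLine [FiniteDimensional ℝ A] [FiniteDimensional ℝ C] :
    finrank ℝ (DetLine A C) = 1 := by
  have : finrank ℝ (TopExt A ⊗[ℝ] Dual ℝ (TopExt C)) = 1 := by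
    rw [finrank_tensorProduct, Subspace.dual_finrank_eq, finrank_topExt, finrank_topExt]
  exact this

theorem exists_dual_eq_one {L : Type*} [AddCommGroup L] [Module ℝ L] {a : L} (ha : a ≠ 0) :
    ∃ α : Dual ℝ L, α a = 1 := by
  obtain ⟨α, hα⟩ := not_forall.1 (fun h => ha ((Module.forall_dual_apply_eq_zero_iff ℝ a).1 h))
  exact ⟨(α a)⁻¹ • α, by simp [hα]⟩

theorem tmul_ne_zero {L M : Type*} [AddCommGroup L] [Module ℝ L] [AddCommGroup M] [Module ℝ M]
    {a : L} {b : M} (ha : a ≠ 0) (hb : b ≠ 0) : a ⊗ₜ[ℝ] b ≠ 0 := by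
  obtain ⟨α, hα⟩ := exists_dual_eq_one ha
  obtain ⟨β, hβ⟩ := exists_dual_eq_one hb
  intro h
  have := congrArg (TensorProduct.lid ℝ ℝ ∘ TensorProduct.map α β) h
  simp [hα, hβ] at this

theorem DetLine.mk_ne_zero {x : TopExt A} {α : Dual ℝ (TopExt C)} (hx : x ≠ 0) (hα : α ≠ 0) :
    DetLine.mk x α ≠ 0 :=
  tmul_ne_zero hx hα

end DetLine

/-! ### Exact sequences with six terms -/

section SixTerm

variable {A₁ A₂ A₃ A₄ A₅ A₆ : Type*}
  [AddCommGroup A₁] [Module ℝ A₁] [AddCommGroup A₂] [Module ℝ A₂]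
  [AddCommGroup A₃] [Module ℝ A₃] [AddCommGroup A₄] [Module ℝ A₄]
  [AddCommGroup A₅] [Module ℝ A₅] [AddCommGroup A₆] [Module ℝ A₆]

/-- The map `A₂ / im f → A₃` induced by `g` when `A₁ → A₂ → A₃` is exact. -/
def redMap {f : A₁ →ₗ[ℝ] A₂} {g : A₂ →ₗ[ℝ] A₃} (h : Function.Exact f g) :
    (A₂ ⧸ LinearMap.range f) →ₗ[ℝ] A₃ :=
  (LinearMap.range f).liftQ g (LinearMap.exact_iff.1 h).ge

theorem range_redMap {f : A₁ →ₗ[ℝ] A₂} {g : A₂ →ₗ[ℝ] A₃} (h : Function.Exact f g) :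
    LinearMap.range (redMap h) = LinearMap.range g :=
  Submodule.range_liftQ _ _ _

theorem redMap_injective {f : A₁ →ₗ[ℝ] A₂} {g : A₂ →ₗ[ℝ] A₃} (h : Function.Exact f g) :
    Function.Injective (redMap h) := by
  rw [← LinearMap.ker_eq_bot]
  exact Submodule.ker_liftQ_eq_bot _ _ _ (LinearMap.exact_iff.1 h).le

theorem isSES_mkQ {f : A₁ →ₗ[ℝ] A₂} (hf : Function.Injective f) :
    IsSES f (LinearMap.range f).mkQ :=
  ⟨hf, LinearMap.exact_iff.2 (Submodule.ker_mkQ _), Submodule.mkQ_surjective _⟩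

theorem isSES_redMap {f : A₁ →ₗ[ℝ] A₂} {g : A₂ →ₗ[ℝ] A₃} (h : Function.Exact f g) :
    IsSES (redMap h) (LinearMap.range g).mkQ :=
  ⟨redMap_injective h,
    LinearMap.exact_iff.2 ((Submodule.ker_mkQ _).trans (range_redMap h).symm),
    Submodule.mkQ_surjective _⟩

/-- The isomorphism `A₂ / im f ≃ A₃` induced by `g` when `A₁ → A₂ → A₃ → 0` is exact. -/
def redEquiv {f : A₁ →ₗ[ℝ] A₂} {g : A₂ →ₗ[ℝ] A₃} (h : Function.Exact f g)
    (hg : Function.Surjective g) : (A₂ ⧸ LinearMap.range f) ≃ₗ[ℝ] A₃ :=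
  LinearEquiv.ofBijective (redMap h) ⟨redMap_injective h,
    LinearMap.range_eq_top.1 ((range_redMap h).trans (LinearMap.range_eq_top.2 hg))⟩

/-- Exactness of `0 → A₁ → A₂ → A₃ → A₄ → A₅ → A₆ → 0`. -/
structure IsSixTermExact (f₁ : A₁ →ₗ[ℝ] A₂) (f₂ : A₂ →ₗ[ℝ] A₃) (f₃ : A₃ →ₗ[ℝ] A₄)
    (f₄ : A₄ →ₗ[ℝ] A₅) (f₅ : A₅ →ₗ[ℝ] A₆) : Prop where
  inj : Function.Injective f₁
  exact₂ : Function.Exact f₁ f₂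
  exact₃ : Function.Exact f₂ f₃
  exact₄ : Function.Exact f₃ f₄
  exact₅ : Function.Exact f₄ f₅
  surj : Function.Surjective f₅

variable [FiniteDimensional ℝ A₁] [FiniteDimensional ℝ A₂] [FiniteDimensional ℝ A₃]
  [FiniteDimensional ℝ A₄] [FiniteDimensional ℝ A₅] [FiniteDimensional ℝ A₆]
  {f₁ : A₁ →ₗ[ℝ] A₂} {f₂ : A₂ →ₗ[ℝ] A₃} {f₃ : A₃ →ₗ[ℝ] A₄} {f₄ : A₄ →ₗ[ℝ] A₅}
  {f₅ : A₅ →ₗ[ℝ] A₆}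

/-- The isomorphism
`Ψ : (λ(A₁) ⊗ λ*(A₄)) ⊗ (λ(A₃) ⊗ λ*(A₆)) → λ(A₂) ⊗ λ*(A₅)` attached to a six-term exact sequence
is given, up to the sign `(-1)^ε`, by
`(x ⊗ (f₃ v ∧ w)^*) ⊗ ((f₂ u ∧ v) ⊗ (f₅ y)^*) ↦ (f₁ x ∧ u) ⊗ (f₄ w ∧ y)^*`
for `x ∈ λ(A₁)`, `u ∈ λ(A₂ / im f₁)`, `v ∈ λ(A₃ / im f₂)`, `w ∈ λ(A₄ / im f₃)`,
`y ∈ λ(A₅ / im f₄)`. Here `a^*` is the element of the dual line with value `1` at `a ≠ 0`;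
these dual elements are denoted `α`, `γ`, `β` below. -/
def IsSixTermIso (h : IsSixTermExact f₁ f₂ f₃ f₄ f₅) (ε : ℤ)
    (Ψ : (DetLine A₁ A₄ ⊗[ℝ] DetLine A₃ A₆) ≃ₗ[ℝ] DetLine A₂ A₅) : Prop :=
  ∀ (x : TopExt A₁) (u : TopExt (A₂ ⧸ LinearMap.range f₁)) (v : TopExt (A₃ ⧸ LinearMap.range f₂))
    (w : TopExt (A₄ ⧸ LinearMap.range f₃)) (y : TopExt (A₅ ⧸ LinearMap.range f₄))
    (α : Dual ℝ (TopExt A₄)) (γ : Dual ℝ (TopExt A₆)) (β : Dual ℝ (TopExt A₅)),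
    α ((isSES_redMap h.exact₃).wedge v w) = 1 →
    γ (TopExt.congr (redEquiv h.exact₅ h.surj) y) = 1 →
    β ((isSES_redMap h.exact₄).wedge w y) = 1 →
    Ψ (DetLine.mk x α ⊗ₜ[ℝ] DetLine.mk ((isSES_redMap h.exact₂).wedge u v) γ) =
      (-1 : ℝ) ^ ε • DetLine.mk ((isSES_mkQ h.inj).wedge x u) β

theorem exists_ne_zero_topExt (A : Type*) [AddCommGroup A] [Module ℝ A] [FiniteDimensional ℝ A] :
    ∃ a : TopExt A, a ≠ 0 :=
  have : Nontrivial (TopExt A) :=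
    nontrivial_of_finrank_pos (R := ℝ) (by rw [finrank_topExt]; exact one_pos)
  exists_ne 0

theorem eq_smul_of_dual {L : Type*} [AddCommGroup L] [Module ℝ L] (hL : finrank ℝ L = 1)
    {a : L} {α α' : Dual ℝ L} {c : ℝ} (h : α a = 1) (h' : α' (c • a) = 1) : α' = c⁻¹ • α := by
  have hc : c * α' a = 1 := by simpa using h'
  have ha : a ≠ 0 := by rintro rfl; simp at h
  ext z
  obtain ⟨d, rfl⟩ := exists_smul_line hL ha z
  simp only [map_smul, LinearMap.smul_apply, h, smul_eq_mul, mul_one]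
  rw [eq_inv_of_mul_eq_one_right hc, mul_comm]

/-- The isomorphism attached to a six-term exact sequence is well defined. -/
theorem existsUnique_sixTermIso (h : IsSixTermExact f₁ f₂ f₃ f₄ f₅) (ε : ℤ) :
    ∃! Ψ, IsSixTermIso h ε Ψ := by
  obtain ⟨x₀, hx₀⟩ := exists_ne_zero_topExt A₁
  obtain ⟨u₀, hu₀⟩ := exists_ne_zero_topExt (A₂ ⧸ LinearMap.range f₁)
  obtain ⟨v₀, hv₀⟩ := exists_ne_zero_topExt (A₃ ⧸ LinearMap.range f₂)
  obtain ⟨w₀, hw₀⟩ := exists_ne_zero_topExt (A₄ ⧸ LinearMap.range f₃)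
  obtain ⟨y₀, hy₀⟩ := exists_ne_zero_topExt (A₅ ⧸ LinearMap.range f₄)
  have hxu := (isSES_mkQ h.inj).wedge_ne_zero hx₀ hu₀
  have huv := (isSES_redMap h.exact₂).wedge_ne_zero hu₀ hv₀
  obtain ⟨α₀, hα₀⟩ := exists_dual_eq_one ((isSES_redMap h.exact₃).wedge_ne_zero hv₀ hw₀)
  obtain ⟨β₀, hβ₀⟩ := exists_dual_eq_one ((isSES_redMap h.exact₄).wedge_ne_zero hw₀ hy₀)
  obtain ⟨γ₀, hγ₀⟩ := exists_dual_eq_one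
    ((TopExt.congr (redEquiv h.exact₅ h.surj)).map_ne_zero_iff.2 hy₀)
  have hα : α₀ ≠ 0 := by rintro rfl; simp at hα₀
  have hβ : β₀ ≠ 0 := by rintro rfl; simp at hβ₀
  have hγ : γ₀ ≠ 0 := by rintro rfl; simp at hγ₀
  let m : DetLine A₁ A₄ ⊗[ℝ] DetLine A₃ A₆ :=
    DetLine.mk x₀ α₀ ⊗ₜ DetLine.mk ((isSES_redMap h.exact₂).wedge u₀ v₀) γ₀
  let n : DetLine A₂ A₅ := (-1 : ℝ) ^ ε • DetLine.mk ((isSES_mkQ h.inj).wedge x₀ u₀) β₀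
  have hm : m ≠ 0 := tmul_ne_zero (DetLine.mk_ne_zero hx₀ hα) (DetLine.mk_ne_zero huv hγ)
  have hn : n ≠ 0 :=
    smul_ne_zero (zpow_ne_zero _ (by norm_num)) (DetLine.mk_ne_zero hxu hβ)
  have hm1 : finrank ℝ (DetLine A₁ A₄ ⊗[ℝ] DetLine A₃ A₆) = 1 := by
    rw [finrank_tensorProduct, finrank_detLine, finrank_detLine]
  have hΨ : ((lineEquiv hm1 m hm).symm ≪≫ₗ lineEquiv finrank_detLine n hn) m = n := by
    have : (lineEquiv hm1 m hm).symm m = 1 := by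
      rw [LinearEquiv.symm_apply_eq, lineEquiv_apply, one_smul]
    rw [LinearEquiv.trans_apply, this, lineEquiv_apply, one_smul]
  refine ⟨(lineEquiv hm1 m hm).symm ≪≫ₗ lineEquiv finrank_detLine n hn, ?_, ?_⟩
  · generalize (lineEquiv hm1 m hm).symm ≪≫ₗ lineEquiv finrank_detLine n hn = Ψ at hΨ
    intro x u v w y α γ β h1 h2 h3
    obtain ⟨a, rfl⟩ := exists_smul_line finrank_topExt hx₀ x
    obtain ⟨b, rfl⟩ := exists_smul_line finrank_topExt hu₀ u
    obtain ⟨c, rfl⟩ := exists_smul_line finrank_topExt hv₀ v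
    obtain ⟨d, rfl⟩ := exists_smul_line finrank_topExt hw₀ w
    obtain ⟨e, rfl⟩ := exists_smul_line finrank_topExt hy₀ y
    rw [IsSES.wedge_smul_smul] at h1 h3
    rw [map_smul] at h2
    obtain rfl := eq_smul_of_dual finrank_topExt hα₀ h1
    obtain rfl := eq_smul_of_dual finrank_topExt hγ₀ h2
    obtain rfl := eq_smul_of_dual finrank_topExt hβ₀ h3
    have hc : c ≠ 0 := by rintro rfl; simp at h1
    have hd : d ≠ 0 := by rintro rfl; simp at h1
    have hL : DetLine.mk (a • x₀) ((c * d)⁻¹ • α₀) ⊗ₜ[ℝ]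
        DetLine.mk ((isSES_redMap h.exact₂).wedge (b • u₀) (c • v₀)) (e⁻¹ • γ₀) =
        (a * b * d⁻¹ * e⁻¹) • m := by
      rw [IsSES.wedge_smul_smul, DetLine.mk_smul_smul,
        DetLine.mk_smul_smul, TensorProduct.smul_tmul_smul]
      congr 1
      field_simp
    have hR : (-1 : ℝ) ^ ε • DetLine.mk ((isSES_mkQ h.inj).wedge (a • x₀) (b • u₀))
        ((d * e)⁻¹ • β₀) = (a * b * d⁻¹ * e⁻¹) • n := by
      rw [IsSES.wedge_smul_smul, DetLine.mk_smul_smul, smul_comm]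
      congr 1
      rw [mul_inv]; ring
    rw [hL, hR, map_smul, hΨ]
  · intro Ψ' hΨ'
    ext z
    obtain ⟨a, rfl⟩ := exists_smul_line hm1 hm z
    rw [map_smul, map_smul, hΨ, hΨ' _ _ _ _ _ _ _ _ hα₀ hγ₀ hβ₀]

/-- The isomorphism attached to a six-term exact sequence, with sign `(-1)^ε`: the unique map
satisfying `IsSixTermIso`. -/
def sixTermIso (h : IsSixTermExact f₁ f₂ f₃ f₄ f₅) (ε : ℤ) :
    (DetLine A₁ A₄ ⊗[ℝ] DetLine A₃ A₆) ≃ₗ[ℝ] DetLine A₂ A₅ :=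
  (existsUnique_sixTermIso h ε).choose

theorem sixTermIso_spec (h : IsSixTermExact f₁ f₂ f₃ f₄ f₅) (ε : ℤ) :
    IsSixTermIso h ε (sixTermIso h ε) :=
  (existsUnique_sixTermIso h ε).choose_spec.1

end SixTerm

/-! ### Fredholm operators and exact triples -/

section Fredholm

variable {X Y X' Y' X'' Y'' : Type*}
  [NormedAddCommGroup X] [NormedSpace ℝ X] [NormedAddCommGroup Y] [NormedSpace ℝ Y]
  [NormedAddCommGroup X'] [NormedSpace ℝ X'] [NormedAddCommGroup Y'] [NormedSpace ℝ Y']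
  [NormedAddCommGroup X''] [NormedSpace ℝ X''] [NormedAddCommGroup Y''] [NormedSpace ℝ Y'']

/-- The space `𝓕(X, Y)` of Fredholm operators, with the operator norm topology. For Banach spaces
`IsFredholm` is equivalent to closed range with finite-dimensional kernel and cokernel. -/
abbrev Fred (X Y : Type*) [NormedAddCommGroup X] [NormedSpace ℝ X]
    [NormedAddCommGroup Y] [NormedSpace ℝ Y] : Type _ :=
  {D : X →L[ℝ] Y // D.IsFredholm}

namespace Fred

/-- The kernel `κ(D)`. -/
abbrev Ker (D : Fred X Y) : Type _ := LinearMap.ker (D.1 : X →ₗ[ℝ] Y)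

/-- The cokernel `𝔠(D) = Y / im D`. -/
abbrev Coker (D : Fred X Y) : Type _ := Y ⧸ LinearMap.range (D.1 : X →ₗ[ℝ] Y)

instance (D : Fred X Y) : FiniteDimensional ℝ D.Ker := D.2.finite_ker

instance (D : Fred X Y) : FiniteDimensional ℝ D.Coker := D.2.finite_coker

/-- The index `dim κ(D) - dim 𝔠(D)`. -/
def index (D : Fred X Y) : ℤ := finrank ℝ D.Ker - finrank ℝ D.Coker

end Fred

/-- The family of determinant lines `λ(D) = λ(κ(D)) ⊗ λ*(𝔠(D))` over `𝓕(X, Y)`. -/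
def Det (X Y : Type*) [NormedAddCommGroup X] [NormedSpace ℝ X]
    [NormedAddCommGroup Y] [NormedSpace ℝ Y] (D : Fred X Y) : Type _ :=
  DetLine D.Ker D.Coker

instance (D : Fred X Y) : AddCommGroup (Det X Y D) :=
  inferInstanceAs (AddCommGroup (DetLine D.Ker D.Coker))

instance (D : Fred X Y) : Module ℝ (Det X Y D) :=
  inferInstanceAs (Module ℝ (DetLine D.Ker D.Coker))

theorem finrank_det (D : Fred X Y) : finrank ℝ (Det X Y D) = 1 :=
  finrank_detLine (A := D.Ker) (C := D.Coker)

/-- The commutative diagrams with exact rows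
`0 → X' → X → X'' → 0` and `0 → Y' → Y → Y'' → 0` and vertical maps `D'`, `D`, `D''`. -/
structure IsExactTriple (D : Fred X Y) (D' : Fred X' Y') (D'' : Fred X'' Y'')
    (iX : X' →L[ℝ] X) (jX : X →L[ℝ] X'') (iY : Y' →L[ℝ] Y) (jY : Y →L[ℝ] Y'') : Prop where
  comm_i : ∀ x, D.1 (iX x) = iY (D'.1 x)
  comm_j : ∀ x, D''.1 (jX x) = jY (D.1 x)
  iX_injective : Function.Injective iX
  exact_X : Function.Exact iX jX
  jX_surjective : Function.Surjective jX
  iY_injective : Function.Injective iY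
  exact_Y : Function.Exact iY jY
  jY_surjective : Function.Surjective jY

/-- The space `𝓣(X, Y; X', Y'; X'', Y'')` of exact triples of Fredholm operators, with the
subspace topology. -/
abbrev ExactTriple (X Y X' Y' X'' Y'' : Type*)
    [NormedAddCommGroup X] [NormedSpace ℝ X] [NormedAddCommGroup Y] [NormedSpace ℝ Y]
    [NormedAddCommGroup X'] [NormedSpace ℝ X'] [NormedAddCommGroup Y'] [NormedSpace ℝ Y']
    [NormedAddCommGroup X''] [NormedSpace ℝ X''] [NormedAddCommGroup Y''] [NormedSpace ℝ Y''] :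
    Type _ :=
  {t : Fred X Y × Fred X' Y' × Fred X'' Y'' ×
      (X' →L[ℝ] X) × (X →L[ℝ] X'') × (Y' →L[ℝ] Y) × (Y →L[ℝ] Y'') //
    IsExactTriple t.1 t.2.1 t.2.2.1 t.2.2.2.1 t.2.2.2.2.1 t.2.2.2.2.2.1 t.2.2.2.2.2.2}

/-- The map `κ(D₁) → κ(D₂)` induced by a commutative square. -/
def kerMap {D₁ : Fred X Y} {D₂ : Fred X' Y'} (φ : X →L[ℝ] X') (ψ : Y →L[ℝ] Y')
    (h : ∀ x, D₂.1 (φ x) = ψ (D₁.1 x)) : D₁.Ker →ₗ[ℝ] D₂.Ker :=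
  (φ : X →ₗ[ℝ] X').restrict fun x hx => by
    have hx' : D₁.1 x = 0 := hx
    change D₂.1 (φ x) = 0
    rw [h, hx', map_zero]

/-- The map `𝔠(D₁) → 𝔠(D₂)` induced by a commutative square. -/
def cokerMap {D₁ : Fred X Y} {D₂ : Fred X' Y'} (φ : X →L[ℝ] X') (ψ : Y →L[ℝ] Y')
    (h : ∀ x, D₂.1 (φ x) = ψ (D₁.1 x)) : D₁.Coker →ₗ[ℝ] D₂.Coker :=
  Submodule.mapQ _ _ (ψ : Y →ₗ[ℝ] Y') (by
    rintro _ ⟨x, rfl⟩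
    exact ⟨φ x, h x⟩)

namespace IsExactTriple

variable {D : Fred X Y} {D' : Fred X' Y'} {D'' : Fred X'' Y''}
  {iX : X' →L[ℝ] X} {jX : X →L[ℝ] X''} {iY : Y' →L[ℝ] Y} {jY : Y →L[ℝ] Y''}
  (t : IsExactTriple D D' D'' iX jX iY jY)

/-- The map `κ(D') → κ(D)` induced by `iX`. -/
def kerI : D'.Ker →ₗ[ℝ] D.Ker := kerMap iX iY t.comm_i

/-- The map `κ(D) → κ(D'')` induced by `jX`. -/
def kerJ : D.Ker →ₗ[ℝ] D''.Ker := kerMap jX jY t.comm_j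

/-- The map `𝔠(D') → 𝔠(D)` induced by `iY`. -/
def cokerI : D'.Coker →ₗ[ℝ] D.Coker := cokerMap iX iY t.comm_i

/-- The map `𝔠(D) → 𝔠(D'')` induced by `jY`. -/
def cokerJ : D.Coker →ₗ[ℝ] D''.Coker := cokerMap jX jY t.comm_j

/-- The connecting homomorphism `δ : κ(D'') → 𝔠(D')` of the snake lemma. -/
def delta : D''.Ker →ₗ[ℝ] D'.Coker :=
  SnakeLemma.δ' (D'.1 : X' →ₗ[ℝ] Y') (D.1 : X →ₗ[ℝ] Y) (D''.1 : X'' →ₗ[ℝ] Y'')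
    (iX : X' →ₗ[ℝ] X) (jX : X →ₗ[ℝ] X'') t.exact_X (iY : Y' →ₗ[ℝ] Y) (jY : Y →ₗ[ℝ] Y'') t.exact_Y
    (LinearMap.ext fun x => (t.comm_i x).symm) (LinearMap.ext fun x => (t.comm_j x).symm)
    (Submodule.subtype _) (LinearMap.exact_iff.2 (Submodule.range_subtype _).symm)
    (Submodule.mkQ _) (LinearMap.exact_iff.2 (Submodule.ker_mkQ _))
    t.jX_surjective t.iY_injective

/-- `δ(x'') = y' + im D'` whenever `jX x = x''` and `iY y' = D x`. -/
theorem delta_eq (x'' : D''.Ker) (x : X) (hx : jX x = x'') (y' : Y') (hy : iY y' = D.1 x) :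
    t.delta x'' = Submodule.Quotient.mk y' :=
  SnakeLemma.δ'_eq _ _ _ _ _ _ _ _ _ _ _ _ _ _ _ _ _ _ x hx y' hy

/-- The long exact sequence
`0 → κ(D') → κ(D) → κ(D'') → 𝔠(D') → 𝔠(D) → 𝔠(D'') → 0`. -/
theorem isSixTermExact : IsSixTermExact t.kerI t.kerJ t.delta t.cokerI t.cokerJ where
  inj := by
    rintro ⟨x, hx⟩ ⟨y, hy⟩ hxy
    exact Subtype.ext (t.iX_injective (congrArg Subtype.val hxy))
  exact₂ := by
    rintro ⟨x, hx⟩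
    constructor
    · intro h
      obtain ⟨x', hx'⟩ := (t.exact_X x).1 (congrArg Subtype.val h)
      refine ⟨⟨x', t.iY_injective ?_⟩, Subtype.ext hx'⟩
      change iY (D'.1 x') = iY 0
      have hx0 : D.1 x = 0 := hx
      rw [← t.comm_i, hx', hx0, map_zero]
    · rintro ⟨x', hx'⟩
      refine Subtype.ext ((t.exact_X x).2 ⟨x'.1, congrArg Subtype.val hx'⟩)
  exact₃ := SnakeLemma.exact_δ'_right _ _ _ _ _ _ _ _ _ _ _ (Submodule.subtype _)
    (LinearMap.exact_iff.2 (Submodule.range_subtype _).symm) _ _ _ _ _ _ t.kerJ rfl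
    Subtype.val_injective
  exact₄ := SnakeLemma.exact_δ'_left _ _ _ _ _ _ _ _ _ _ _ _ _ _ _ (Submodule.mkQ _)
    (LinearMap.exact_iff.2 (Submodule.ker_mkQ _)) _ _ t.cokerI rfl (Submodule.mkQ_surjective _)
  exact₅ := by
    intro c
    obtain ⟨y, rfl⟩ := Submodule.mkQ_surjective _ c
    constructor
    · intro h
      obtain ⟨x'', hx''⟩ := (Submodule.Quotient.mk_eq_zero _).1 h
      obtain ⟨x, rfl⟩ := t.jX_surjective x''
      obtain ⟨y', hy'⟩ := (t.exact_Y (y - D.1 x)).1 (by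
        rw [map_sub, ← t.comm_j, sub_eq_zero]; exact hx''.symm)
      refine ⟨Submodule.Quotient.mk y', ?_⟩
      refine (Submodule.Quotient.eq _).2 ⟨-x, ?_⟩
      change D.1 (-x) = iY y' - y
      rw [hy', map_neg]; abel
    · rintro ⟨c', hc'⟩
      obtain ⟨y', rfl⟩ := Submodule.mkQ_surjective _ c'
      rw [← hc']
      change Submodule.Quotient.mk (jY (iY y')) = 0
      rw [(t.exact_Y (iY y')).2 ⟨y', rfl⟩]
      rfl
  surj := by
    intro c
    obtain ⟨y'', rfl⟩ := Submodule.mkQ_surjective _ c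
    obtain ⟨y, rfl⟩ := t.jY_surjective y''
    exact ⟨Submodule.Quotient.mk y, rfl⟩

/-- The exponent `(ind D'') dim 𝔠(D') + dim 𝔠(D) dim (im δ)` of the sign in `Ψ`. -/
def sign : ℤ :=
  D''.index * finrank ℝ D'.Coker + finrank ℝ D.Coker * finrank ℝ (LinearMap.range t.delta)

/-- The isomorphism `Ψ : λ(D') ⊗ λ(D'') → λ(D)` of an exact triple. -/
def psi : (Det X' Y' D' ⊗[ℝ] Det X'' Y'' D'') ≃ₗ[ℝ] Det X Y D :=
  sixTermIso t.isSixTermExact t.sign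

end IsExactTriple


/-! ### The topology of `det_{X,Y}` over surjective operators -/

/-- The space `𝓕*(X, Y)` of surjective Fredholm operators. -/
abbrev FredSurj (X Y : Type*) [NormedAddCommGroup X] [NormedSpace ℝ X]
    [NormedAddCommGroup Y] [NormedSpace ℝ Y] : Type _ :=
  {D : Fred X Y // Function.Surjective D.1}

/-- The restriction of the family of determinant lines to `𝓕*(X, Y)`. -/
def DetSurj (X Y : Type*) [NormedAddCommGroup X] [NormedSpace ℝ X]
    [NormedAddCommGroup Y] [NormedSpace ℝ Y] (D : FredSurj X Y) : Type _ :=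
  Det X Y D.1

instance (D : FredSurj X Y) : AddCommGroup (DetSurj X Y D) :=
  inferInstanceAs (AddCommGroup (Det X Y D.1))

instance (D : FredSurj X Y) : Module ℝ (DetSurj X Y D) :=
  inferInstanceAs (Module ℝ (Det X Y D.1))

namespace FredSurj

theorem subsingleton_coker (D : FredSurj X Y) : Subsingleton D.1.Coker :=
  Submodule.Quotient.subsingleton_iff.2 (LinearMap.range_eq_top.2 D.2)

/-- The isomorphism between the zero cokernels of two surjective operators. -/
def cokerEquiv (D E : FredSurj X Y) : D.1.Coker ≃ₗ[ℝ] E.1.Coker :=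
  have := D.subsingleton_coker
  have := E.subsingleton_coker
  LinearEquiv.ofLinearMap 0 0 (Subsingleton.elim _ _) (Subsingleton.elim _ _)

/-- The map `Φ : κ(E) → κ(D)`, `x ↦ x - T D x`, for a right inverse `T` of `D`. -/
def phi (D : FredSurj X Y) (T : Y →L[ℝ] X) (hT : ∀ y, D.1.1 (T y) = y) (E : FredSurj X Y) :
    E.1.Ker →ₗ[ℝ] D.1.Ker :=
  LinearMap.codRestrict _
    (((ContinuousLinearMap.id ℝ X - T ∘L D.1.1 : X →L[ℝ] X) : X →ₗ[ℝ] X) ∘ₗ Submodule.subtype _)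
    fun x => by
      change D.1.1 (x.1 - T (D.1.1 x.1)) = 0
      rw [map_sub, hT, sub_self]

/-- The trivialization `(E, x ⊗ 1^*) ↦ λ(Φ)⁻¹ x ⊗ 1^*` of the determinant lines over the
neighborhood `{E | Φ : κ(E) → κ(D) is an isomorphism}` of `D` in `𝓕*(X, Y)`. -/
def chart (D : FredSurj X Y) (T : Y →L[ℝ] X) (hT : ∀ y, D.1.1 (T y) = y)
    (p : {E : FredSurj X Y // Function.Bijective (D.phi T hT E)} × Det X Y D.1) :
    TotalSpace ℝ (DetSurj X Y) :=
  ⟨p.1.1, DetLine.congr (LinearEquiv.ofBijective (D.phi T hT p.1.1) p.1.2).symm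
    (D.cokerEquiv p.1.1) p.2⟩

end FredSurj

/-- The topology of the determinant line bundle over `𝓕*(X, Y)`: the gluing (final) topology of
all the trivializations `FredSurj.chart`, where the line `λ(D)` has its usual topology. -/
instance : TopologicalSpace (TotalSpace ℝ (DetSurj X Y)) :=
  ⨆ (D : FredSurj X Y) (T : Y →L[ℝ] X) (hT : ∀ y, D.1.1 (T y) = y),
    TopologicalSpace.coinduced (D.chart T hT)
      (@instTopologicalSpaceProd _ _ inferInstance (moduleTopology ℝ (Det X Y D.1)))

/-! ### Stabilizations and the topology of `det_{X,Y}` -/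

theorem isFredholm_stab {N : ℕ} (Θ : (Fin N → ℝ) →L[ℝ] Y) (D : Fred X Y) :
    (D.1.coprod Θ).IsFredholm := by
  obtain ⟨v, hv⟩ := D.2.exists_isQuasiInverse
  have h₁ := LinearMap.FiniteRangeSetoid.equiv_iff_hasFiniteRange.1 hv.1
  have h₂ := LinearMap.FiniteRangeSetoid.equiv_iff_hasFiniteRange.1 hv.2
  refine .of_isQuasiInverse (v := ContinuousLinearMap.inl ℝ X (Fin N → ℝ) ∘L v)
    ⟨LinearMap.FiniteRangeSetoid.equiv_iff_hasFiniteRange.2 ?_,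
      LinearMap.FiniteRangeSetoid.equiv_iff_hasFiniteRange.2 ?_⟩
  · have key := ((h₁.comp_right (LinearMap.fst ℝ X (Fin N → ℝ))).comp_left
      (LinearMap.inl ℝ X (Fin N → ℝ))).add
      ((LinearMap.HasFiniteRange.of_finite_dom (f := LinearMap.inl ℝ X (Fin N → ℝ) ∘ₗ
        (v : Y →ₗ[ℝ] X) ∘ₗ (Θ : (Fin N → ℝ) →ₗ[ℝ] Y) - LinearMap.inr ℝ X (Fin N → ℝ))).comp_right
        (LinearMap.snd ℝ X (Fin N → ℝ)))
    have heq : ((ContinuousLinearMap.inl ℝ X (Fin N → ℝ) ∘L v : Y →L[ℝ] X × (Fin N → ℝ)) :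
        Y →ₗ[ℝ] X × (Fin N → ℝ)) ∘ₗ (D.1.coprod Θ : X × (Fin N → ℝ) →ₗ[ℝ] Y) - LinearMap.id =
        LinearMap.inl ℝ X (Fin N → ℝ) ∘ₗ (((v : Y →ₗ[ℝ] X) ∘ₗ (D.1 : X →ₗ[ℝ] Y) - LinearMap.id) ∘ₗ
          LinearMap.fst ℝ X (Fin N → ℝ)) + (LinearMap.inl ℝ X (Fin N → ℝ) ∘ₗ
          (v : Y →ₗ[ℝ] X) ∘ₗ (Θ : (Fin N → ℝ) →ₗ[ℝ] Y) - LinearMap.inr ℝ X (Fin N → ℝ)) ∘ₗ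
          LinearMap.snd ℝ X (Fin N → ℝ) := by
      refine LinearMap.ext fun p => Prod.ext ?_ ?_
      · simp only [LinearMap.sub_apply, LinearMap.add_apply, LinearMap.comp_apply,
          ContinuousLinearMap.coe_coe, ContinuousLinearMap.comp_apply,
          ContinuousLinearMap.coprod_apply, ContinuousLinearMap.inl_apply, LinearMap.inl_apply,
          LinearMap.inr_apply, LinearMap.fst_apply, LinearMap.snd_apply, LinearMap.id_apply,
          Prod.fst_sub, Prod.fst_add, map_add]
        abel
      · simp
    rwa [← heq] at key
  · convert h₂ using 1
    ext x; simp

/-- The stabilized operator `D_Θ : X ⊕ ℝ^N → Y`, `(x, u) ↦ D x + Θ u`. -/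
def stab {N : ℕ} (Θ : (Fin N → ℝ) →L[ℝ] Y) (D : Fred X Y) : Fred (X × (Fin N → ℝ)) Y :=
  ⟨D.1.coprod Θ, isFredholm_stab Θ D⟩

/-- The Fredholm operator `ℝ^N → 0`. -/
def zeroOp (N : ℕ) : Fred (Fin N → ℝ) (Fin 0 → ℝ) :=
  ⟨0, .of_isQuasiInverse (v := 0) ⟨by
    simp [LinearMap.IsLeftQuasiInverse, LinearMap.FiniteRangeSetoid.equiv_iff_hasFiniteRange], by
    simp [LinearMap.IsRightQuasiInverse]⟩⟩

/-- The exact triple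
`0 → X → X ⊕ ℝ^N → ℝ^N → 0` over `0 → Y → Y → 0 → 0` with vertical maps `D`, `D_Θ`, `0`. -/
theorem isExactTriple_stab {N : ℕ} (Θ : (Fin N → ℝ) →L[ℝ] Y) (D : Fred X Y) :
    IsExactTriple (stab Θ D) D (zeroOp N) (ContinuousLinearMap.inl ℝ X (Fin N → ℝ))
      (ContinuousLinearMap.snd ℝ X (Fin N → ℝ)) (ContinuousLinearMap.id ℝ Y) 0 where
  comm_i x := by simp [stab]
  comm_j x := rfl
  iX_injective x y h := congrArg Prod.fst h
  exact_X := by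
    rintro ⟨x, u⟩
    constructor
    · rintro (rfl : u = 0)
      exact ⟨x, rfl⟩
    · rintro ⟨y, hy⟩
      exact (congrArg Prod.snd hy).symm
  jX_surjective u := ⟨(0, u), rfl⟩
  iY_injective _ _ h := h
  exact_Y y := ⟨fun _ => ⟨y, rfl⟩, fun _ => rfl⟩
  jY_surjective y := ⟨0, Subsingleton.elim _ _⟩

/-- The standard volume tensor `Ω_N = e₁ ∧ … ∧ e_N` of `ℝ^N`. -/
def volTensor (N : ℕ) : TopExt (Fin N → ℝ) :=
  exteriorPower.ιMulti ℝ _ fun k => Pi.single (Fin.cast (finrank_fin_fun ℝ) k) 1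

theorem volTensor_ne_zero (N : ℕ) : volTensor N ≠ 0 := by
  intro h
  refine ιMulti_basis_ne_zero
    ((Pi.basisFun ℝ (Fin N)).reindex (finCongr (finrank_fin_fun ℝ (n := N)).symm)) ?_
  have h' := congrArg Subtype.val h
  rw [volTensor, exteriorPower.ιMulti_apply_coe] at h'
  refine Eq.trans (congrArg _ (funext fun k => ?_)) h'
  simp

/-- For `W = 0`, the element `1^*` of `λ*(W)`, where `1 ∈ λ(W) = Λ⁰ W = ℝ`. -/
def unitDual (W : Type*) [AddCommGroup W] [Module ℝ W] [Subsingleton W] : Dual ℝ (TopExt W) :=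
  (LinearEquiv.ofEq _ _ (by rw [finrank_zero_of_subsingleton]) ≪≫ₗ
    exteriorPower.zeroEquiv ℝ W : TopExt W ≃ₗ[ℝ] ℝ)

theorem unitDual_ne_zero (W : Type*) [AddCommGroup W] [Module ℝ W] [Subsingleton W] :
    unitDual W ≠ 0 := by
  obtain ⟨a, ha⟩ := exists_ne_zero_topExt W
  intro h
  exact ha ((LinearEquiv.map_eq_zero_iff _).1 (LinearMap.congr_fun h a))

theorem ker_zeroOp (N : ℕ) : LinearMap.ker ((zeroOp N).1 : (Fin N → ℝ) →ₗ[ℝ] (Fin 0 → ℝ)) = ⊤ :=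
  LinearMap.ker_zero

instance (N : ℕ) : Subsingleton (zeroOp N).Coker :=
  (Submodule.mkQ_surjective _).subsingleton

/-- The element `Ω_N ⊗ 1^*` of `λ(ℝ^N → 0)`. -/
def zeroOpGen (N : ℕ) : Det (Fin N → ℝ) (Fin 0 → ℝ) (zeroOp N) :=
  DetLine.mk (TopExt.congr (LinearEquiv.ofTop _ (ker_zeroOp N)).symm (volTensor N))
    (unitDual (zeroOp N).Coker)

theorem zeroOpGen_ne_zero (N : ℕ) : zeroOpGen N ≠ 0 :=
  DetLine.mk_ne_zero ((LinearEquiv.map_ne_zero_iff _).2 (volTensor_ne_zero N)) (unitDual_ne_zero _)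

/-- The isomorphism `λ(D) → λ(D_Θ)`, `σ ↦ Ψ (σ ⊗ (Ω_N ⊗ 1^*))`. -/
def stabIso {N : ℕ} (Θ : (Fin N → ℝ) →L[ℝ] Y) (D : Fred X Y) :
    Det X Y D ≃ₗ[ℝ] Det (X × (Fin N → ℝ)) Y (stab Θ D) :=
  (TensorProduct.rid ℝ (Det X Y D)).symm ≪≫ₗ
    TensorProduct.congr (LinearEquiv.refl ℝ _)
      (lineEquiv (finrank_det _) (zeroOpGen N) (zeroOpGen_ne_zero N)) ≪≫ₗ
    (isExactTriple_stab Θ D).psi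

theorem stabIso_apply {N : ℕ} (Θ : (Fin N → ℝ) →L[ℝ] Y) (D : Fred X Y) (σ : Det X Y D) :
    stabIso Θ D σ = (isExactTriple_stab Θ D).psi (σ ⊗ₜ[ℝ] zeroOpGen N) := by
  simp [stabIso, lineEquiv_apply]

/-- The open subset `U_Θ = {D | D_Θ is surjective}` of `𝓕(X, Y)`. -/
abbrev StabSet {N : ℕ} (X : Type*) [NormedAddCommGroup X] [NormedSpace ℝ X]
    (Θ : (Fin N → ℝ) →L[ℝ] Y) : Type _ :=
  {D : Fred X Y // Function.Surjective (stab Θ D).1}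

/-- The map `U_Θ → 𝓕*(X ⊕ ℝ^N, Y)`, `D ↦ D_Θ`. -/
def stabSurj {N : ℕ} (Θ : (Fin N → ℝ) →L[ℝ] Y) (D : StabSet X Θ) :
    FredSurj (X × (Fin N → ℝ)) Y :=
  ⟨stab Θ D.1, D.2⟩

/-- The inverse of `stabIso`, as a bundle map over `U_Θ` from the pullback by `D ↦ D_Θ` of the
determinant line bundle over `𝓕*(X ⊕ ℝ^N, Y)`. -/
def stabChart {N : ℕ} (Θ : (Fin N → ℝ) →L[ℝ] Y)
    (p : TotalSpace ℝ (stabSurj (X := X) Θ *ᵖ (DetSurj (X × (Fin N → ℝ)) Y))) :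
    TotalSpace ℝ (Det X Y) :=
  ⟨p.1.1, (stabIso Θ p.1.1).symm p.2⟩

/-- The topology of the determinant line bundle over `𝓕(X, Y)`: the gluing (final) topology of
all the bundle maps `stabChart`. -/
instance : TopologicalSpace (TotalSpace ℝ (Det X Y)) :=
  ⨆ (N : ℕ) (Θ : (Fin N → ℝ) →L[ℝ] Y), TopologicalSpace.coinduced (stabChart Θ) inferInstance

end Fredholm

/-! ### Line bundles and their tensor products -/

section LineBundle

variable {B : Type*} [TopologicalSpace B] (E E₁ E₂ : B → Type*)
  [∀ b, AddCommMonoid (E b)] [∀ b, Module ℝ (E b)] [TopologicalSpace (TotalSpace ℝ E)]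
  [∀ b, AddCommMonoid (E₁ b)] [∀ b, Module ℝ (E₁ b)] [TopologicalSpace (TotalSpace ℝ E₁)]
  [∀ b, AddCommMonoid (E₂ b)] [∀ b, Module ℝ (E₂ b)] [TopologicalSpace (TotalSpace ℝ E₂)]

/-- A real line bundle: every point of the base lies in the domain of a fiberwise linear local
trivialization with fiber `ℝ`. -/
def IsLineBundle : Prop :=
  ∀ b : B, ∃ e : Trivialization ℝ (π ℝ E), e.IsLinear ℝ ∧ b ∈ e.baseSet

/-- The tensor product of two line bundles. -/
def TensorBundle (E₁ E₂ : B → Type*) [∀ b, AddCommMonoid (E₁ b)] [∀ b, Module ℝ (E₁ b)]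
    [∀ b, AddCommMonoid (E₂ b)] [∀ b, Module ℝ (E₂ b)] (b : B) : Type _ :=
  E₁ b ⊗[ℝ] E₂ b

instance (b : B) : AddCommMonoid (TensorBundle E₁ E₂ b) :=
  inferInstanceAs (AddCommMonoid (E₁ b ⊗[ℝ] E₂ b))

instance (b : B) : Module ℝ (TensorBundle E₁ E₂ b) :=
  inferInstanceAs (Module ℝ (E₁ b ⊗[ℝ] E₂ b))

/-- The product `(b, r) ↦ r (s₁(b) ⊗ s₂(b))` of two local trivializations, where
`sᵢ(b) = eᵢ⁻¹(b, 1)`. -/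
def tensorChart {E₁ E₂ : B → Type*}
    [∀ b, AddCommMonoid (E₁ b)] [∀ b, Module ℝ (E₁ b)] [TopologicalSpace (TotalSpace ℝ E₁)]
    [∀ b, AddCommMonoid (E₂ b)] [∀ b, Module ℝ (E₂ b)] [TopologicalSpace (TotalSpace ℝ E₂)]
    (e₁ : Trivialization ℝ (π ℝ E₁)) (e₂ : Trivialization ℝ (π ℝ E₂))
    (p : ↥(e₁.baseSet ∩ e₂.baseSet) × ℝ) : TotalSpace ℝ (TensorBundle E₁ E₂) :=
  ⟨p.1, p.2 • (e₁.symm p.1 1 ⊗ₜ[ℝ] e₂.symm p.1 1 : E₁ p.1 ⊗[ℝ] E₂ p.1)⟩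

/-- The topology of a tensor product of line bundles: the gluing (final) topology of all the
products of linear local trivializations. -/
instance : TopologicalSpace (TotalSpace ℝ (TensorBundle E₁ E₂)) :=
  ⨆ (e₁ : {e : Trivialization ℝ (π ℝ E₁) // e.IsLinear ℝ})
    (e₂ : {e : Trivialization ℝ (π ℝ E₂) // e.IsLinear ℝ}),
    TopologicalSpace.coinduced (tensorChart e₁.1 e₂.1) inferInstance

end LineBundle

/-! ### The bundle map `Ψ` -/

namespace ExactTriple

variable {X Y X' Y' X'' Y'' : Type*}
  [NormedAddCommGroup X] [NormedSpace ℝ X] [NormedAddCommGroup Y] [NormedSpace ℝ Y]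
  [NormedAddCommGroup X'] [NormedSpace ℝ X'] [NormedAddCommGroup Y'] [NormedSpace ℝ Y']
  [NormedAddCommGroup X''] [NormedSpace ℝ X''] [NormedAddCommGroup Y''] [NormedSpace ℝ Y'']

/-- The projection `t ↦ D`. -/
def projC (t : ExactTriple X Y X' Y' X'' Y'') : Fred X Y := t.1.1

/-- The projection `t ↦ D'`. -/
def projL (t : ExactTriple X Y X' Y' X'' Y'') : Fred X' Y' := t.1.2.1

/-- The projection `t ↦ D''`. -/
def projR (t : ExactTriple X Y X' Y' X'' Y'') : Fred X'' Y'' := t.1.2.2.1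

/-- The isomorphism `Ψ_t : λ(D') ⊗ λ(D'') → λ(D)`. -/
def psi (t : ExactTriple X Y X' Y' X'' Y'') :
    (Det X' Y' (projL t) ⊗[ℝ] Det X'' Y'' (projR t)) ≃ₗ[ℝ] Det X Y (projC t) :=
  IsExactTriple.psi t.2

/-- The bundle map `Ψ : πL^* det_{X',Y'} ⊗ πR^* det_{X'',Y''} → πC^* det_{X,Y}` over the space
of exact triples which is `Ψ_t` on the fibers over `t`. -/
def psiMap (X Y X' Y' X'' Y'' : Type*)
    [NormedAddCommGroup X] [NormedSpace ℝ X] [NormedAddCommGroup Y] [NormedSpace ℝ Y]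
    [NormedAddCommGroup X'] [NormedSpace ℝ X'] [NormedAddCommGroup Y'] [NormedSpace ℝ Y']
    [NormedAddCommGroup X''] [NormedSpace ℝ X''] [NormedAddCommGroup Y''] [NormedSpace ℝ Y'']
    (p : TotalSpace ℝ (TensorBundle
      ((projL : ExactTriple X Y X' Y' X'' Y'' → Fred X' Y') *ᵖ (Det X' Y'))
      ((projR : ExactTriple X Y X' Y' X'' Y'' → Fred X'' Y'') *ᵖ (Det X'' Y'')))) :
    TotalSpace ℝ ((projC : ExactTriple X Y X' Y' X'' Y'' → Fred X Y) *ᵖ (Det X Y)) :=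
  ⟨p.1, psi p.1 p.2⟩

end ExactTriple

end

end DetBundle

/-! A determinant line becomes computable after two choices: a stabilization `Θ` that makes `D_Θ`
surjective, and a bounded map `P` to `ℝ^M` for which `(D_Θ, P)` is an isomorphism onto `Y × ℝ^M`.
Then `P` restricts to coordinates on the kernel of `D_Θ`, and the determinant of these coordinates,
transported by the stabilization isomorphism, is a linear coordinate `val Θ P D` on `λ(D)`.
Invertibility of `(D_Θ, P)` is an open condition and inversion is continuous, so these are the
natural local trivializations.

The algebraic heart is `IsExactTriple.val_psi`: if the stabilizations and the kernel coordinates of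
`D'`, `D`, `D''` are compatible with the exact sequences, then in the resulting coordinates `Ψ_t` is
multiplication by `(-1)^(N' ind D'')`. On families adapted to the snake sequence the determinant on
the kernel of `D_Θ` is block triangular and factors; what remains is the parity computation
`sign_identity`, which is where the exponent `ε_t` matters. The index of `D''` equals `M'' - N''`
wherever `(D''_{Θ''}, P'')` is invertible, so the sign is locally constant.

The same formula yields the transition functions, because stabilization is itself an instance of
`Ψ`. Applied to the triple `D`, `D_{Θ₁}`, `0` and combined with the explicit computation
`val_eq_det_mul`, it gives `val_change`: two coordinates differ by a nonzero constant times a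
determinant that depends continuously on the operator. Hence `sval` and then `val` are coordinates
for the glued topologies (`isCoordOn_sval`, `isCoordOn_val`), and the families of lines are line
bundles.

Finally the compatible data must vary continuously with the triple, although its exact sequences
need not split. The data at a base point are placed where they can be carried along: a lift to `Y`
of the stabilization of `D''`, and a functional on `X × ℝ^{N'}` that restricts to the kernel
coordinates of `D'`. Composition with the maps of the triple `t` then produces compatible data for
every `t`. -/

open Module Bundle Topology
open scoped TensorProduct

namespace DetBundle

noncomputable section

open ExteriorAlgebra (ιMulti)

/-! ### Top exterior powers through families of vectors, and determinants of coordinates. -/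

section ExteriorFamilies

variable {V V' V'' W : Type*}
  [AddCommGroup V] [Module ℝ V] [AddCommGroup V'] [Module ℝ V']
  [AddCommGroup V''] [Module ℝ V''] [AddCommGroup W] [Module ℝ W]

/-- The element `x₁ ∧ … ∧ xₙ` of the top exterior power. -/
def vol {n : ℕ} (x : Fin n → V) (h : n = finrank ℝ V) : TopExt V :=
  ⟨ιMulti ℝ n x, h ▸ (exteriorPower.ιMulti ℝ n x).2⟩

@[simp]
theorem coe_vol {n : ℕ} (x : Fin n → V) (h : n = finrank ℝ V) :
    (vol x h : ExteriorAlgebra ℝ V) = ιMulti ℝ n x := rfl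

theorem coe_exteriorPower_map (n : ℕ) (f : V →ₗ[ℝ] W) (x : ⋀[ℝ]^n V) :
    (exteriorPower.map n f x : ExteriorAlgebra ℝ W) = ExteriorAlgebra.map f x := by
  have : (Submodule.subtype _) ∘ₗ exteriorPower.map n f =
      (ExteriorAlgebra.map f).toLinearMap ∘ₗ (Submodule.subtype (⋀[ℝ]^n V)) := by
    apply exteriorPower.linearMap_ext
    ext v
    simp
  exact LinearMap.congr_fun this x

theorem TopExt.coe_congr (e : V ≃ₗ[ℝ] W) (x : TopExt V) :
    (TopExt.congr e x : ExteriorAlgebra ℝ W) = ExteriorAlgebra.map (e : V →ₗ[ℝ] W) x :=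
  coe_exteriorPower_map _ _ x

theorem TopExt.congr_vol (e : V ≃ₗ[ℝ] W) {n : ℕ} (x : Fin n → V) (h : n = finrank ℝ V) :
    TopExt.congr e (vol x h) = vol (e ∘ x) (h.trans e.finrank_eq) := by
  ext
  rw [TopExt.coe_congr]
  simp

theorem exists_vol_ne_zero [FiniteDimensional ℝ V] :
    ∃ x : Fin (finrank ℝ V) → V, vol x rfl ≠ 0 :=
  ⟨finBasis ℝ V, fun h => ιMulti_basis_ne_zero (finBasis ℝ V) (congrArg Subtype.val h)⟩

theorem IsSES.coe_wedge [FiniteDimensional ℝ V'] [FiniteDimensional ℝ V'']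
    {i : V' →ₗ[ℝ] V} {j : V →ₗ[ℝ] V''} (h : IsSES i j) (a : TopExt V') {n : ℕ}
    (b : Fin n → V) (hn : n = finrank ℝ V'') :
    (h.wedge a (vol (j ∘ b) hn) : ExteriorAlgebra ℝ V) =
      ExteriorAlgebra.map i a * ιMulti ℝ n b := by
  subst hn
  obtain ⟨x, hx⟩ := exists_vol_ne_zero (V := V')
  obtain ⟨c, rfl⟩ := exists_smul_line finrank_topExt hx a
  rw [LinearMap.map_smul₂]
  have := h.wedge_ιMulti x b
  simp only [Submodule.coe_smul, map_smul, coe_vol, ExteriorAlgebra.map_apply_ιMulti,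
    smul_mul_assoc]
  rw [← this]
  rfl

/-- Version of `IsSES.coe_wedge` for elements given through their images in the exterior
algebras. -/
theorem IsSES.coe_wedge' [FiniteDimensional ℝ V'] [FiniteDimensional ℝ V'']
    {i : V' →ₗ[ℝ] V} {j : V →ₗ[ℝ] V''} (h : IsSES i j) (a : TopExt V') {n : ℕ}
    (b : Fin n → V) (hn : n = finrank ℝ V'') (b' : TopExt V'')
    (hb : (b' : ExteriorAlgebra ℝ V'') = ιMulti ℝ n (j ∘ b)) :
    (h.wedge a b' : ExteriorAlgebra ℝ V) = ExteriorAlgebra.map i a * ιMulti ℝ n b := by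
  rw [← h.coe_wedge a b hn, show b' = vol (j ∘ b) hn from Subtype.ext hb]

theorem ι_mul_ιMulti_comm (z : V) {n : ℕ} (b : Fin n → V) :
    ExteriorAlgebra.ι ℝ z * ιMulti ℝ n b =
      (-1 : ℝ) ^ n • (ιMulti ℝ n b * ExteriorAlgebra.ι ℝ z) := by
  induction n with
  | zero => simp
  | succ n ih =>
    rw [ExteriorAlgebra.ιMulti_succ_apply, ← mul_assoc,
      eq_neg_of_add_eq_zero_left (ExteriorAlgebra.ι_add_mul_swap z (b 0)), neg_mul, mul_assoc, ih,
      mul_smul_comm, pow_succ, mul_neg_one, neg_smul, mul_assoc]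

/-- Graded commutativity of the exterior algebra. -/
theorem ιMulti_mul_comm {m n : ℕ} (a : Fin m → V) (b : Fin n → V) :
    ιMulti ℝ m a * ιMulti ℝ n b = (-1 : ℝ) ^ (m * n) • (ιMulti ℝ n b * ιMulti ℝ m a) := by
  induction m with
  | zero => simp
  | succ m ih =>
    rw [ExteriorAlgebra.ιMulti_succ_apply, mul_assoc, ih, mul_smul_comm, ← mul_assoc,
      ι_mul_ιMulti_comm, smul_mul_assoc, smul_smul, mul_assoc, ← pow_add, Nat.succ_mul]

theorem ιMulti_neg {n : ℕ} (b : Fin n → V) :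
    ιMulti ℝ n (-b) = (-1 : ℝ) ^ n • ιMulti ℝ n b := by
  have := (ιMulti ℝ n).map_smul_univ (fun _ => (-1 : ℝ)) b
  simpa [funext_iff, Pi.neg_def] using this

/-- The linear form on the exterior algebra that sends `x₁ ∧ … ∧ x_M` to the determinant of
`p x₁, …, p x_M`, and vanishes in degrees other than `M`. -/
def detForm {M : ℕ} (p : V →ₗ[ℝ] (Fin M → ℝ)) : ExteriorAlgebra ℝ V →ₗ[ℝ] ℝ :=
  ExteriorAlgebra.liftAlternating
    (Pi.single M ((Matrix.detRowAlternating (n := Fin M) (R := ℝ)).compLinearMap p))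

theorem detForm_ιMulti {M : ℕ} (p : V →ₗ[ℝ] (Fin M → ℝ)) (x : Fin M → V) :
    detForm p (ιMulti ℝ M x) = Matrix.det (Matrix.of fun i => p (x i)) := by
  rw [detForm, ExteriorAlgebra.liftAlternating_apply_ιMulti, Pi.single_eq_same]
  rfl

theorem detForm_ιMulti_cast {M n : ℕ} (h : M = n) (p : V →ₗ[ℝ] (Fin M → ℝ)) (x : Fin n → V) :
    detForm p (ιMulti ℝ n x) = Matrix.det (Matrix.of fun i => p (x (Fin.cast h i))) := by
  subst h
  exact detForm_ιMulti p x

theorem detForm_map {M : ℕ} (p : V →ₗ[ℝ] (Fin M → ℝ)) (f : W →ₗ[ℝ] V) (z : ExteriorAlgebra ℝ W) :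
    detForm p (ExteriorAlgebra.map f z) = detForm (p ∘ₗ f) z := by
  have : detForm p ∘ₗ (ExteriorAlgebra.map f).toLinearMap = detForm (p ∘ₗ f) := by
    apply ExteriorAlgebra.lhom_ext
    intro n
    ext v
    by_cases h : n = M
    · subst h
      simp [detForm_ιMulti]
    · simp [detForm, ExteriorAlgebra.liftAlternating_apply_ιMulti, Pi.single_eq_of_ne h]
  exact LinearMap.congr_fun this z

/-- Determinants of block triangular families. -/
theorem detForm_mul {M' M'' : ℕ} (p : V →ₗ[ℝ] (Fin (M' + M'') → ℝ)) (p' : V' →ₗ[ℝ] (Fin M' → ℝ))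
    (p'' : V'' →ₗ[ℝ] (Fin M'' → ℝ)) (i : V' →ₗ[ℝ] V) (j : V →ₗ[ℝ] V'')
    (h₁ : ∀ x k, p (i x) (Fin.castAdd M'' k) = p' x k) (h₂ : ∀ x k, p (i x) (Fin.natAdd M' k) = 0)
    (h₃ : ∀ x k, p x (Fin.natAdd M' k) = p'' (j x) k) {n' n'' : ℕ} (hn' : n' = M')
    (hn'' : n'' = M'') (x' : Fin n' → V') (x : Fin n'' → V) :
    detForm p (ιMulti ℝ n' (i ∘ x') * ιMulti ℝ n'' x) =
      detForm p' (ιMulti ℝ n' x') * detForm p'' (ιMulti ℝ n'' (j ∘ x)) := by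
  subst hn' hn''
  rw [ExteriorAlgebra.ιMulti_mul_ιMulti, detForm_ιMulti, detForm_ιMulti, detForm_ιMulti,
    -- Rows are the vectors. The vectors `i x'` have no components in the last `M''` coordinates, so
    -- the upper right block vanishes and the lower left block, supplied explicitly, is irrelevant.
    ← Matrix.det_submatrix_equiv_self finSumFinEquiv,
    ← Matrix.det_fromBlocks_zero₁₂ _
      (Matrix.of fun (a : Fin n'') (b : Fin n') => p (x a) (Fin.castAdd n'' b))]
  congr 1
  ext a b
  rcases a with a | a <;> rcases b with b | b <;> simp [h₁, h₂, h₃]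

/-- The basis dual to the coordinates `p` has determinant `1`, and every element of the line is
proportional to its wedge. -/
theorem detForm_ιMulti_ne_zero {M : ℕ} (p : V →ₗ[ℝ] (Fin M → ℝ)) (hp : Function.Bijective p)
    {z : TopExt V} (hz : z ≠ 0) : detForm p z ≠ 0 := by
  let b : Basis (Fin M) ℝ V := Basis.ofEquivFun (LinearEquiv.ofBijective p hp)
  have hM : M = finrank ℝ V := by simpa using (finrank_eq_card_basis b).symm
  have : FiniteDimensional ℝ V := b.finiteDimensional_of_finite
  have h1 : detForm p (vol b hM) = 1 := by
    rw [coe_vol, detForm_ιMulti]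
    convert Matrix.det_one (n := Fin M) (R := ℝ) using 2
    ext i j
    have : p (b i) = Pi.single i 1 := by
      change LinearEquiv.ofBijective p hp (b i) = _
      simp [b]
    simp [this, Matrix.one_apply, Pi.single_apply, eq_comm]
  obtain ⟨c, hc⟩ := exists_smul_line finrank_topExt hz (vol b hM)
  rintro h0
  rw [← hc] at h1
  simp [h0] at h1

end ExteriorFamilies

/-! ### Six-term exact sequences in terms of adapted families. -/

section SixTermFamilies

variable {A₁ A₂ A₃ A₄ A₅ A₆ : Type*}
  [AddCommGroup A₁] [Module ℝ A₁] [AddCommGroup A₂] [Module ℝ A₂]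
  [AddCommGroup A₃] [Module ℝ A₃] [AddCommGroup A₄] [Module ℝ A₄]
  [AddCommGroup A₅] [Module ℝ A₅] [AddCommGroup A₆] [Module ℝ A₆]
  [FiniteDimensional ℝ A₁] [FiniteDimensional ℝ A₂] [FiniteDimensional ℝ A₃]
  [FiniteDimensional ℝ A₄] [FiniteDimensional ℝ A₅] [FiniteDimensional ℝ A₆]
  {f₁ : A₁ →ₗ[ℝ] A₂} {f₂ : A₂ →ₗ[ℝ] A₃} {f₃ : A₃ →ₗ[ℝ] A₄} {f₄ : A₄ →ₗ[ℝ] A₅}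
  {f₅ : A₅ →ₗ[ℝ] A₆}

/-- Representing elements over the quotients by lifted families turns the wedge maps into
concatenation, so later computations never mention quotient spaces. -/
theorem wedge_redMap_vol {f₁ : A₁ →ₗ[ℝ] A₂} {f₂ : A₂ →ₗ[ℝ] A₃} (h : Function.Exact f₁ f₂)
    {n m : ℕ} (u : Fin n → A₂) (v : Fin m → A₃) (hn : n = finrank ℝ (A₂ ⧸ LinearMap.range f₁))
    (hm : m = finrank ℝ (A₃ ⧸ LinearMap.range f₂)) (hnm : n + m = finrank ℝ A₃) :
    (isSES_redMap h).wedge (vol ((LinearMap.range f₁).mkQ ∘ u) hn)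
      (vol ((LinearMap.range f₂).mkQ ∘ v) hm) = vol (Fin.append (f₂ ∘ u) v) hnm := by
  ext
  rw [IsSES.coe_wedge]
  simp only [coe_vol, ExteriorAlgebra.map_apply_ιMulti, ExteriorAlgebra.ιMulti_mul_ιMulti]
  rfl

theorem wedge_mkQ_vol {f₁ : A₁ →ₗ[ℝ] A₂} (h : Function.Injective f₁)
    {n m : ℕ} (x : Fin n → A₁) (u : Fin m → A₂) (hn : n = finrank ℝ A₁)
    (hm : m = finrank ℝ (A₂ ⧸ LinearMap.range f₁)) (hnm : n + m = finrank ℝ A₂) :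
    (isSES_mkQ h).wedge (vol x hn) (vol ((LinearMap.range f₁).mkQ ∘ u) hm) =
      vol (Fin.append (f₁ ∘ x) u) hnm := by
  ext
  rw [IsSES.coe_wedge]
  simp only [coe_vol, ExteriorAlgebra.map_apply_ιMulti, ExteriorAlgebra.ιMulti_mul_ιMulti]

/-- The isomorphism of a six-term exact sequence, in terms of families of vectors. -/
theorem sixTermIso_vol (h : IsSixTermExact f₁ f₂ f₃ f₄ f₅) (ε : ℤ) {n₁ n₂ n₃ n₄ n₅ : ℕ}
    (x : Fin n₁ → A₁) (u : Fin n₂ → A₂) (v : Fin n₃ → A₃) (w : Fin n₄ → A₄) (y : Fin n₅ → A₅)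
    (h₁ : n₁ = finrank ℝ A₁) (h₂ : n₁ + n₂ = finrank ℝ A₂) (h₃ : n₂ + n₃ = finrank ℝ A₃)
    (h₄ : n₃ + n₄ = finrank ℝ A₄) (h₅ : n₄ + n₅ = finrank ℝ A₅) (h₆ : n₅ = finrank ℝ A₆)
    {α : Dual ℝ (TopExt A₄)} (hα : α (vol (Fin.append (f₃ ∘ v) w) h₄) = 1)
    {γ : Dual ℝ (TopExt A₆)} (hγ : γ (vol (f₅ ∘ y) h₆) = 1)
    {β : Dual ℝ (TopExt A₅)} (hβ : β (vol (Fin.append (f₄ ∘ w) y) h₅) = 1) :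
    sixTermIso h ε (DetLine.mk (vol x h₁) α ⊗ₜ[ℝ] DetLine.mk (vol (Fin.append (f₂ ∘ u) v) h₃) γ) =
      (-1 : ℝ) ^ ε • DetLine.mk (vol (Fin.append (f₁ ∘ x) u) h₂) β := by
  have e₂ := (isSES_mkQ h.inj).finrank_add
  have e₃ := (isSES_redMap h.exact₂).finrank_add
  have e₄ := (isSES_redMap h.exact₃).finrank_add
  have e₅ := (isSES_redMap h.exact₄).finrank_add
  have q₂ : n₂ = finrank ℝ (A₂ ⧸ LinearMap.range f₁) := by omega
  have q₃ : n₃ = finrank ℝ (A₃ ⧸ LinearMap.range f₂) := by omega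
  have q₄ : n₄ = finrank ℝ (A₄ ⧸ LinearMap.range f₃) := by omega
  have q₅ : n₅ = finrank ℝ (A₅ ⧸ LinearMap.range f₄) := by omega
  have := sixTermIso_spec h ε (vol x h₁) (vol ((LinearMap.range f₁).mkQ ∘ u) q₂)
    (vol ((LinearMap.range f₂).mkQ ∘ v) q₃) (vol ((LinearMap.range f₃).mkQ ∘ w) q₄)
    (vol ((LinearMap.range f₄).mkQ ∘ y) q₅) α γ β
    (by rwa [wedge_redMap_vol h.exact₃ v w q₃ q₄ h₄])
    (by rw [TopExt.congr_vol]; exact hγ)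
    (by rwa [wedge_redMap_vol h.exact₄ w y q₄ q₅ h₅])
  rwa [wedge_redMap_vol h.exact₂ u v q₂ q₃ h₃, wedge_mkQ_vol h.inj x u h₁ q₂ h₂] at this

theorem exists_mkQ_vol_ne_zero (S : Submodule ℝ A₁) :
    ∃ u : Fin (finrank ℝ (A₁ ⧸ S)) → A₁, vol (S.mkQ ∘ u) rfl ≠ 0 := by
  obtain ⟨x, hx⟩ := exists_vol_ne_zero (V := A₁ ⧸ S)
  refine ⟨Function.surjInv S.mkQ_surjective ∘ x, ?_⟩
  rwa [← Function.comp_assoc, (Function.rightInverse_surjInv S.mkQ_surjective).comp_eq_id,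
    Function.id_comp]

/-- Families of vectors adapted to a six-term exact sequence exist. -/
theorem IsSixTermExact.exists_adapted (h : IsSixTermExact f₁ f₂ f₃ f₄ f₅) :
    ∃ (n₁ n₂ n₃ n₄ n₅ : ℕ) (x : Fin n₁ → A₁) (u : Fin n₂ → A₂) (v : Fin n₃ → A₃) (w : Fin n₄ → A₄)
      (y : Fin n₅ → A₅) (h₁ : n₁ = finrank ℝ A₁) (_ : n₁ + n₂ = finrank ℝ A₂)
      (h₃ : n₂ + n₃ = finrank ℝ A₃) (h₄ : n₃ + n₄ = finrank ℝ A₄) (h₅ : n₄ + n₅ = finrank ℝ A₅)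
      (h₆ : n₅ = finrank ℝ A₆), n₃ = finrank ℝ (LinearMap.range f₃) ∧ vol x h₁ ≠ 0 ∧
      vol (Fin.append (f₂ ∘ u) v) h₃ ≠ 0 ∧ vol (Fin.append (f₃ ∘ v) w) h₄ ≠ 0 ∧
      vol (Fin.append (f₄ ∘ w) y) h₅ ≠ 0 ∧ vol (f₅ ∘ y) h₆ ≠ 0 := by
  obtain ⟨x, hx⟩ := exists_vol_ne_zero (V := A₁)
  obtain ⟨u, hu⟩ := exists_mkQ_vol_ne_zero (LinearMap.range f₁)
  obtain ⟨v, hv⟩ := exists_mkQ_vol_ne_zero (LinearMap.range f₂)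
  obtain ⟨w, hw⟩ := exists_mkQ_vol_ne_zero (LinearMap.range f₃)
  obtain ⟨y, hy⟩ := exists_mkQ_vol_ne_zero (LinearMap.range f₄)
  have e₂ := (isSES_mkQ h.inj).finrank_add
  have e₃ := (isSES_redMap h.exact₂).finrank_add
  have e₄ := (isSES_redMap h.exact₃).finrank_add
  have e₅ := (isSES_redMap h.exact₄).finrank_add
  have e₆ := (redEquiv h.exact₅ h.surj).finrank_eq
  refine ⟨_, _, _, _, _, x, u, v, w, y, rfl, e₂, e₃, e₄, e₅, e₆, ?_, hx, ?_, ?_, ?_, ?_⟩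
  -- The length of `v` is the rank of `f₃`; for the snake sequence this is the dimension of the
  -- image of `δ` in the sign exponent.
  · rw [← range_redMap h.exact₃, LinearMap.finrank_range_of_inj (redMap_injective h.exact₃)]
  · rw [← wedge_redMap_vol h.exact₂ u v rfl rfl]
    exact IsSES.wedge_ne_zero _ hu hv
  · rw [← wedge_redMap_vol h.exact₃ v w rfl rfl]
    exact IsSES.wedge_ne_zero _ hv hw
  · rw [← wedge_redMap_vol h.exact₄ w y rfl rfl]
    exact IsSES.wedge_ne_zero _ hw hy
  · have := (TopExt.congr (redEquiv h.exact₅ h.surj)).map_ne_zero_iff.2 hy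
    rw [TopExt.congr_vol] at this
    exact this

end SixTermFamilies

/-- The element `1` of `λ(C)` when `C = 0`. -/
def unitTop (C : Type*) [AddCommGroup C] [Module ℝ C] : TopExt C :=
  -- The default `0` makes `sval` a linear form for every operator, without a proof of surjectivity;
  -- it vanishes when the cokernel is nonzero.
  if h : 0 = finrank ℝ C then vol (n := 0) Fin.elim0 h else 0

theorem unitTop_eq_vol {C : Type*} [AddCommGroup C] [Module ℝ C] {n : ℕ} (hn : n = 0)
    (x : Fin n → C) (h : n = finrank ℝ C) : unitTop C = vol x h := by
  subst hn
  rw [unitTop, dif_pos h]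
  congr
  exact Subsingleton.elim _ _

theorem unitTop_ne_zero {C : Type*} [AddCommGroup C] [Module ℝ C] [Subsingleton C] :
    unitTop C ≠ 0 := by
  intro h
  rw [unitTop_eq_vol rfl Fin.elim0 (finrank_zero_of_subsingleton (R := ℝ) (M := C)).symm] at h
  have := congrArg Subtype.val h
  simp at this

theorem unitDual_unitTop {C : Type*} [AddCommGroup C] [Module ℝ C] [Subsingleton C] :
    unitDual C (unitTop C) = 1 := by
  have h := (finrank_zero_of_subsingleton (R := ℝ) (M := C)).symm
  rw [unitTop_eq_vol rfl Fin.elim0 h]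
  exact exteriorPower.zeroEquiv_ιMulti (R := ℝ) (M := C) Fin.elim0

/-- The standard volume element `e₁ ∧ … ∧ e_N` in the exterior algebra of `ℝ^N`. -/
def stdVol (N : ℕ) : ExteriorAlgebra ℝ (Fin N → ℝ) := ιMulti ℝ N fun k => Pi.single k 1

/-- The element `x ⊗ α` of the determinant line `λ(D)`. -/
def Det.mk {X Y : Type*} [NormedAddCommGroup X] [NormedSpace ℝ X] [NormedAddCommGroup Y]
    [NormedSpace ℝ Y] {D : Fred X Y} (x : TopExt D.Ker) (α : Dual ℝ (TopExt D.Coker)) :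
    Det X Y D :=
  DetLine.mk x α

theorem Det.mk_smul_left {X Y : Type*} [NormedAddCommGroup X] [NormedSpace ℝ X]
    [NormedAddCommGroup Y] [NormedSpace ℝ Y] {D : Fred X Y} (c : ℝ) (x : TopExt D.Ker)
    (α : Dual ℝ (TopExt D.Coker)) : Det.mk (c • x) α = c • Det.mk x α := by
  have := DetLine.mk_smul_smul c 1 x α
  rwa [one_smul, mul_one] at this

/-! ### The stabilization isomorphism on adapted families. -/

section Stab

variable {X Y : Type*} [NormedAddCommGroup X] [NormedSpace ℝ X]
  [NormedAddCommGroup Y] [NormedSpace ℝ Y] {N : ℕ} (Θ : (Fin N → ℝ) →L[ℝ] Y) (D : Fred X Y)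

theorem stab_apply (p : X × (Fin N → ℝ)) : (stab Θ D).1 p = D.1 p.1 + Θ p.2 := rfl

/-- A vector of `ℝ^N` as an element of the kernel of `ℝ^N → 0`. -/
def zeroOpKer (u : Fin N → ℝ) : (zeroOp N).Ker := ⟨u, rfl⟩

theorem delta_stab (u : Fin N → ℝ) :
    (isExactTriple_stab Θ D).delta (zeroOpKer u) = Submodule.Quotient.mk (Θ u) :=
  (isExactTriple_stab Θ D).delta_eq _ (0, u) rfl _ (by simp [stab_apply])

theorem coe_zeroOp_vol :
    ((TopExt.congr (LinearEquiv.ofTop _ (ker_zeroOp N)).symm (volTensor N) : TopExt (zeroOp N).Ker)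
      : ExteriorAlgebra ℝ (zeroOp N).Ker) = ιMulti ℝ N fun k => zeroOpKer (Pi.single k 1) := by
  have : ∀ n (h : n = N), ιMulti ℝ n (fun k => zeroOpKer (Pi.single (Fin.cast h k) 1)) =
      ιMulti ℝ N fun k => zeroOpKer (N := N) (Pi.single k 1) := by
    rintro n rfl; rfl
  rw [TopExt.coe_congr, volTensor, exteriorPower.ιMulti_apply_coe, ExteriorAlgebra.map_apply_ιMulti]
  exact this _ (finrank_fin_fun ℝ)

theorem finrank_zeroOp_ker : finrank ℝ (zeroOp N).Ker = N := by
  rw [(LinearEquiv.ofTop _ (ker_zeroOp N)).finrank_eq, finrank_fin_fun]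

theorem finrank_coker_of_surjective {E : Fred X Y} (hE : Function.Surjective E.1) :
    finrank ℝ E.Coker = 0 :=
  have := FredSurj.subsingleton_coker ⟨E, hE⟩
  finrank_zero_of_subsingleton

variable {Θ D}

/-- `finrank` relations of a surjective stabilization. -/
theorem finrank_stab_ker (hΘ : Function.Surjective (stab Θ D).1) :
    finrank ℝ D.Ker + N = finrank ℝ (stab Θ D).Ker + finrank ℝ D.Coker := by
  obtain ⟨n₁, n₂, n₃, n₄, n₅, -, -, -, -, -, h₁, h₂, h₃, h₄, h₅, h₆, -⟩ :=
    (isExactTriple_stab Θ D).isSixTermExact.exists_adapted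
  rw [finrank_zeroOp_ker] at h₃
  rw [finrank_coker_of_surjective hΘ] at h₅
  omega

/-- The stabilization isomorphism in terms of families of vectors. -/
theorem smul_stabIso_mk_vol (hΘ : Function.Surjective (stab Θ D).1) {k l c : ℕ}
    (x : Fin k → D.Ker) (hk : k = finrank ℝ D.Ker) (a : Fin l → (stab Θ D).Ker)
    (b : Fin c → (Fin N → ℝ)) (hc : c = finrank ℝ D.Coker) (hl : l + c = N)
    (hkl : k + l = finrank ℝ (stab Θ D).Ker) {μ : ℝ}
    (hprod : ιMulti ℝ l (fun i => (a i).1.2) * ιMulti ℝ c b = μ • stdVol N)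
    {α : Dual ℝ (TopExt D.Coker)}
    (hα : α (vol (fun i => Submodule.Quotient.mk (Θ (b i))) hc) = 1)
    {β : Dual ℝ (TopExt (stab Θ D).Coker)} (hβ : β (unitTop _) = 1) :
    μ • stabIso Θ D (Det.mk (vol x hk) α) = (-1 : ℝ) ^ (N * c) •
      Det.mk (vol (Fin.append ((isExactTriple_stab Θ D).kerI ∘ x) a) hkl) β := by
  have hcok := finrank_coker_of_surjective hΘ
  have h₆ : 0 = finrank ℝ (zeroOp N).Coker := finrank_zero_of_subsingleton.symm
  have h₃ : l + c = finrank ℝ (zeroOp N).Ker := by rw [finrank_zeroOp_ker, hl]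
  have key := sixTermIso_vol (isExactTriple_stab Θ D).isSixTermExact
    (isExactTriple_stab Θ D).sign x a (fun i => zeroOpKer (b i)) (Fin.elim0 : Fin 0 → D.Coker)
    (Fin.elim0 : Fin 0 → (stab Θ D).Coker) hk hkl h₃ hc hcok.symm h₆ (α := α)
    (γ := unitDual (zeroOp N).Coker) (β := β) (by
      rw [← hα]; congr 2
      ext i
      rw [Fin.append_elim0]
      exact delta_stab Θ D (b i)) (by
      rw [← unitTop_eq_vol rfl, unitDual_unitTop]) (by rw [← unitTop_eq_vol rfl, hβ])
  -- The `ℝ^N`-components of `a` followed by `b` span the parallelepiped of volume `μ`; keeping `μ`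
  -- as a factor avoids dividing by it.
  have hvol : vol (Fin.append ((isExactTriple_stab Θ D).kerJ ∘ a) fun i => zeroOpKer (b i)) h₃ =
      μ • TopExt.congr (LinearEquiv.ofTop _ (ker_zeroOp N)).symm (volTensor N) := by
    ext
    have := congrArg (ExteriorAlgebra.map
      ((LinearEquiv.ofTop _ (ker_zeroOp N)).symm : (Fin N → ℝ) →ₗ[ℝ] (zeroOp N).Ker)) hprod
    rw [map_mul, map_smul, stdVol, ExteriorAlgebra.map_apply_ιMulti,
      ExteriorAlgebra.map_apply_ιMulti, ExteriorAlgebra.map_apply_ιMulti] at this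
    rw [coe_vol, ← ExteriorAlgebra.ιMulti_mul_ιMulti, Submodule.coe_smul, coe_zeroOp_vol]
    exact this
  -- The cokernel of `D_Θ` is zero, so only `ind(ℝ^N → 0) · dim 𝔠(D) = N c` survives in the
  -- exponent.
  have hsign : (-1 : ℝ) ^ (isExactTriple_stab Θ D).sign = (-1 : ℝ) ^ (N * c) := by
    rw [IsExactTriple.sign, hcok, Fred.index, finrank_zeroOp_ker, ← h₆, ← hc,
      ← zpow_natCast]
    congr 1
    push_cast
    ring
  rw [hsign, hvol] at key
  refine Eq.trans ?_ key
  rw [stabIso_apply, ← map_smul, ← TensorProduct.tmul_smul, zeroOpGen]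
  exact congrArg (fun z => (isExactTriple_stab Θ D).psi (Det.mk (vol x hk) α ⊗ₜ[ℝ] z))
    (Det.mk_smul_left (D := zeroOp N) μ _ _).symm

/-- Existence of adapted families for a surjective stabilization. -/
theorem exists_stab_adapted (hΘ : Function.Surjective (stab Θ D).1) {c : ℕ}
    (b : Fin c → (Fin N → ℝ)) (hc : c = finrank ℝ D.Coker)
    (hb : vol (fun i => (Submodule.Quotient.mk (Θ (b i)) : D.Coker)) hc ≠ 0) :
    ∃ (l : ℕ) (a : Fin l → (stab Θ D).Ker) (μ : ℝ), l + c = N ∧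
      finrank ℝ D.Ker + l = finrank ℝ (stab Θ D).Ker ∧ μ ≠ 0 ∧
      ιMulti ℝ l (fun i => (a i).1.2) * ιMulti ℝ c b = μ • stdVol N := by
  have h := (isExactTriple_stab Θ D).isSixTermExact
  have hsub := FredSurj.subsingleton_coker ⟨stab Θ D, hΘ⟩
  obtain ⟨u, hu⟩ := exists_mkQ_vol_ne_zero (LinearMap.range (isExactTriple_stab Θ D).kerI)
  have e₂ := (isSES_mkQ h.inj).finrank_add
  have e₃ := (isSES_redMap h.exact₂).finrank_add
  have e := finrank_stab_ker hΘ
  rw [finrank_zeroOp_ker] at e₃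
  have hc' : c = finrank ℝ ((zeroOp N).Ker ⧸ LinearMap.range (isExactTriple_stab Θ D).kerJ) := by
    omega
  have hv : vol ((LinearMap.range (isExactTriple_stab Θ D).kerJ).mkQ ∘ fun i => zeroOpKer (b i))
      hc' ≠ 0 := by
    intro h0
    apply hb
    -- The connecting map of the stabilization triple is `u ↦ [Θ u]`; a vanishing wedge of the `b i`
    -- modulo the image of `kerJ` would force the wedge of the `[Θ (b i)]` to vanish.
    have := congrArg (ExteriorAlgebra.map (redMap h.exact₃)) (congrArg Subtype.val h0)
    rw [coe_vol, ExteriorAlgebra.map_apply_ιMulti] at this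
    ext
    rw [coe_vol]
    refine (Eq.trans ?_ this).trans (by simp)
    congr 1
    ext i
    exact (delta_stab Θ D (b i)).symm
  have hne := IsSES.wedge_ne_zero (isSES_redMap h.exact₂) hu hv
  have h₃ : finrank ℝ ((stab Θ D).Ker ⧸ LinearMap.range (isExactTriple_stab Θ D).kerI) + c =
      finrank ℝ (zeroOp N).Ker := by rw [finrank_zeroOp_ker]; omega
  rw [wedge_redMap_vol h.exact₂ _ _ _ _ h₃] at hne
  obtain ⟨μ, hμ⟩ := exists_smul_line finrank_topExt
    ((LinearEquiv.map_ne_zero_iff (TopExt.congr (LinearEquiv.ofTop _ (ker_zeroOp N)).symm)).2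
      (volTensor_ne_zero N)) (vol (Fin.append ((isExactTriple_stab Θ D).kerJ ∘ u)
        fun i => zeroOpKer (b i)) h₃)
  refine ⟨_, u, μ, by omega, by omega, ?_, ?_⟩
  · rintro rfl
    rw [zero_smul] at hμ
    exact hne hμ.symm
  · have := congrArg (ExteriorAlgebra.map (Submodule.subtype _)) (congrArg Subtype.val hμ)
    rw [Submodule.coe_smul, coe_zeroOp_vol, coe_vol, ← ExteriorAlgebra.ιMulti_mul_ιMulti,
      map_smul, map_mul, ExteriorAlgebra.map_apply_ιMulti, ExteriorAlgebra.map_apply_ιMulti,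
      ExteriorAlgebra.map_apply_ιMulti] at this
    exact this.symm

end Stab

/-! ### The linear coordinates on determinant lines. -/

section Coordinates

variable {X Y : Type*} [NormedAddCommGroup X] [NormedSpace ℝ X]
  [NormedAddCommGroup Y] [NormedSpace ℝ Y] {M N : ℕ}

/-- The restriction of a linear map to the kernel of an operator. -/
def kerRestrict (P : X →L[ℝ] (Fin M → ℝ)) (E : Fred X Y) : E.Ker →ₗ[ℝ] (Fin M → ℝ) :=
  (P : X →ₗ[ℝ] (Fin M → ℝ)) ∘ₗ Submodule.subtype _

/-- The linear form `x ⊗ α ↦ det (P x) α(1)` on `λ(E)`, of interest for surjective `E`. -/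
def sval (P : X →L[ℝ] (Fin M → ℝ)) (E : Fred X Y) : Det X Y E →ₗ[ℝ] ℝ :=
  (TensorProduct.lid ℝ ℝ).toLinearMap ∘ₗ TensorProduct.map
    (detForm (kerRestrict P E) ∘ₗ Submodule.subtype (⋀[ℝ]^(finrank ℝ E.Ker) E.Ker))
    (LinearMap.applyₗ (unitTop E.Coker))

theorem sval_mk (P : X →L[ℝ] (Fin M → ℝ)) (E : Fred X Y) (x : TopExt E.Ker)
    (α : Dual ℝ (TopExt E.Coker)) :
    sval P E (Det.mk x α) =
      detForm (kerRestrict P E) (x : ExteriorAlgebra ℝ E.Ker) * α (unitTop E.Coker) := rfl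

/-- The linear form `σ ↦ sval (stabIso σ)` on `λ(D)`, of interest if `D_Θ` is surjective. -/
def val (Θ : (Fin N → ℝ) →L[ℝ] Y) (P : X × (Fin N → ℝ) →L[ℝ] (Fin M → ℝ)) (D : Fred X Y) :
    Det X Y D →ₗ[ℝ] ℝ :=
  sval P (stab Θ D) ∘ₗ (stabIso Θ D).toLinearMap

end Coordinates

/-! ### The split sequence of Euclidean spaces and its standard volumes. -/

section Euclidean

variable (N' N'' : ℕ)

/-- The inclusion `ℝ^{N'} → ℝ^{N' + N''}`. -/
def euclIncl : (Fin N' → ℝ) →ₗ[ℝ] (Fin (N' + N'') → ℝ) where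
  toFun u := Fin.append u 0
  map_add' u v := by
    ext k; refine Fin.addCases (fun k => ?_) (fun k => ?_) k <;> simp
  map_smul' c u := by
    ext k; refine Fin.addCases (fun k => ?_) (fun k => ?_) k <;> simp

/-- The projection `ℝ^{N' + N''} → ℝ^{N''}`. -/
def euclProj : (Fin (N' + N'') → ℝ) →ₗ[ℝ] (Fin N'' → ℝ) :=
  LinearMap.funLeft ℝ ℝ (Fin.natAdd N')

/-- The projection `ℝ^{N' + N''} → ℝ^{N'}`. -/
def euclFst : (Fin (N' + N'') → ℝ) →ₗ[ℝ] (Fin N' → ℝ) :=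
  LinearMap.funLeft ℝ ℝ (Fin.castAdd N'')

variable {N' N''}

@[simp]
theorem euclIncl_castAdd (u : Fin N' → ℝ) (k : Fin N') :
    euclIncl N' N'' u (Fin.castAdd N'' k) = u k := Fin.append_left _ _ _

@[simp]
theorem euclIncl_natAdd (u : Fin N' → ℝ) (k : Fin N'') :
    euclIncl N' N'' u (Fin.natAdd N' k) = 0 := Fin.append_right _ _ _

@[simp]
theorem euclProj_apply (u : Fin (N' + N'') → ℝ) (k : Fin N'') :
    euclProj N' N'' u k = u (Fin.natAdd N' k) := rfl

theorem euclFst_euclIncl (u : Fin N' → ℝ) :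
    euclFst N' N'' (euclIncl N' N'' u) = u := by
  ext k
  exact euclIncl_castAdd u k

theorem euclProj_euclIncl (u : Fin N' → ℝ) : euclProj N' N'' (euclIncl N' N'' u) = 0 := by
  ext k; simp

theorem exists_euclIncl_eq {u : Fin (N' + N'') → ℝ} (h : euclProj N' N'' u = 0) :
    ∃ u', euclIncl N' N'' u' = u := by
  refine ⟨fun k => u (Fin.castAdd N'' k), ?_⟩
  ext k
  refine Fin.addCases (fun k => ?_) (fun k => ?_) k
  · simp
  · simpa using (congrFun h k).symm

theorem isSES_eucl : IsSES (euclIncl N' N'') (euclProj N' N'') where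
  inj u v h := by
    ext k; simpa using congrFun h (Fin.castAdd N'' k)
  exact u := ⟨exists_euclIncl_eq, by rintro ⟨u, rfl⟩; exact euclProj_euclIncl u⟩
  surj u := ⟨Fin.append 0 u, by ext k; simp⟩

theorem stdVol_add :
    stdVol (N' + N'') = ExteriorAlgebra.map (euclIncl N' N'') (stdVol N') *
      ιMulti ℝ N'' fun k => Pi.single (Fin.natAdd N' k) 1 := by
  rw [stdVol, stdVol, ExteriorAlgebra.map_apply_ιMulti, ExteriorAlgebra.ιMulti_mul_ιMulti]
  congr 1
  ext k m
  refine Fin.addCases (fun k => ?_) (fun k => ?_) k <;>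
    refine Fin.addCases (fun m => ?_) (fun m => ?_) m <;>
    (simp [Pi.single_apply, Fin.ext_iff]; try omega)

/-- The standard volume of `ℝ^{N' + N''}` from those of `ℝ^{N'}` and `ℝ^{N''}`. -/
theorem map_stdVol_mul {l c : ℕ} (hl : l + c = N'') (f : Fin l → (Fin (N' + N'') → ℝ))
    (g : Fin c → (Fin (N' + N'') → ℝ)) {μ : ℝ}
    (h : ιMulti ℝ l (euclProj N' N'' ∘ f) * ιMulti ℝ c (euclProj N' N'' ∘ g) = μ • stdVol N'') :
    ExteriorAlgebra.map (euclIncl N' N'') (stdVol N') * (ιMulti ℝ l f * ιMulti ℝ c g) =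
      μ • stdVol (N' + N'') := by
  have h' : N' = finrank ℝ (Fin N' → ℝ) := (finrank_fin_fun ℝ).symm
  have h'' : N'' = finrank ℝ (Fin N'' → ℝ) := (finrank_fin_fun ℝ).symm
  -- The wedge map does not depend on how vectors of `ℝ^{N''}` are lifted: it is evaluated once with
  -- the lifts `f`, `g` and once with the standard basis vectors.
  have e₁ := (isSES_eucl (N' := N') (N'' := N'')).coe_wedge' (vol (fun k => Pi.single k 1) h')
    (Fin.append f g) (hl.trans h'') (μ • vol (fun k => Pi.single k 1) h'') (by
      rw [Submodule.coe_smul, coe_vol, ← stdVol, ← h, ExteriorAlgebra.ιMulti_mul_ιMulti]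
      congr 1
      ext k
      refine Fin.addCases (fun k => ?_) (fun k => ?_) k <;> simp)
  have e₂ := (isSES_eucl (N' := N') (N'' := N'')).coe_wedge' (vol (fun k => Pi.single k 1) h')
    (fun k => Pi.single (Fin.natAdd N' k) 1) h'' (vol (fun k => Pi.single k 1) h'') (by
      rw [coe_vol]
      congr 1
      ext k m
      simp [Pi.single_apply, Fin.ext_iff])
  rw [map_smul, Submodule.coe_smul, e₂, coe_vol, ← stdVol, ← stdVol_add] at e₁
  rw [e₁, ExteriorAlgebra.ιMulti_mul_ιMulti]

end Euclidean

/-! ### The parity computation. -/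

section Sign

/-- The `nᵢ` are the lengths of the adapted families, with `N' = l + n₃ + n₄`, `N'' = m + n₅` and
`ind D'' = n₂ + n₃ - n₅`. The left side collects the sign of `Ψ`, the stabilization sign of `D`, two
reorderings (of lengths `n₂`, `l` and `m`, `n₄`) and the `n₃` minus signs of the lifts realizing
`δ`. The right side is `(-1)^(N' ind D'')` times the stabilization signs of `D'` and `D''`. -/
theorem sign_identity (n₂ n₃ n₄ n₅ l m : ℕ) :
    (-1 : ℝ) ^ (((n₂ + n₃ : ℕ) - (n₅ : ℕ) : ℤ) * (n₃ + n₄ : ℕ) + (n₄ + n₅ : ℕ) * (n₃ : ℕ)) *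
        (-1) ^ ((l + (n₃ + n₄) + (m + n₅)) * (n₄ + n₅)) * (-1) ^ (n₂ * l) * (-1) ^ n₃ *
        (-1) ^ (m * n₄) =
      (-1) ^ (((l + (n₃ + n₄) : ℕ) : ℤ) * ((n₂ + n₃ : ℕ) - (n₅ : ℕ))) *
        (-1) ^ ((l + (n₃ + n₄)) * (n₃ + n₄)) * (-1) ^ ((m + n₅) * n₅) := by
  -- With `n₃` replaced by its square, the difference of the two exponents is identically even as a
  -- polynomial.
  have h3 : (-1 : ℝ) ^ n₃ = (-1) ^ (n₃ * n₃) := by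
    rcases Nat.even_or_odd n₃ with h | h
    · rw [h.neg_one_pow, (h.mul_left n₃).neg_one_pow]
    · rw [h.neg_one_pow, (h.mul h).neg_one_pow]
  have h0 : (-1 : ℝ) ≠ 0 := by norm_num
  rw [h3]
  simp only [← zpow_natCast, ← zpow_add₀ h0]
  rw [← sub_eq_zero, ← mul_right_inj' (zpow_ne_zero
    (-(((l + (n₃ + n₄) : ℕ) : ℤ) * ((n₂ + n₃ : ℕ) - (n₅ : ℕ)) +
      (((l + (n₃ + n₄)) * (n₃ + n₄) : ℕ) : ℤ) + (((m + n₅) * n₅ : ℕ) : ℤ))) h0), mul_sub,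
    ← zpow_add₀ h0, ← zpow_add₀ h0, mul_zero, sub_eq_zero, neg_add_cancel, zpow_zero]
  -- The witness is half the difference of the exponents.
  refine Even.neg_one_zpow ⟨-(l * n₃ : ℤ) + l * n₅ + n₃ * n₅ + n₄ * n₅ + n₄ * m, ?_⟩
  push_cast
  ring

end Sign

/-! ### Exact triples with compatible stabilizations. -/

section Psi

variable {X Y X' Y' X'' Y'' : Type*}
  [NormedAddCommGroup X] [NormedSpace ℝ X] [NormedAddCommGroup Y] [NormedSpace ℝ Y]
  [NormedAddCommGroup X'] [NormedSpace ℝ X'] [NormedAddCommGroup Y'] [NormedSpace ℝ Y']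
  [NormedAddCommGroup X''] [NormedSpace ℝ X''] [NormedAddCommGroup Y''] [NormedSpace ℝ Y'']
  {D : Fred X Y} {D' : Fred X' Y'} {D'' : Fred X'' Y''}
  {iX : X' →L[ℝ] X} {jX : X →L[ℝ] X''} {iY : Y' →L[ℝ] Y} {jY : Y →L[ℝ] Y''}
  {N' N'' : ℕ} {Θ' : (Fin N' → ℝ) →L[ℝ] Y'} {Θ'' : (Fin N'' → ℝ) →L[ℝ] Y''}
  {Θ : (Fin (N' + N'') → ℝ) →L[ℝ] Y}

theorem mem_ker_stab {N : ℕ} {Θ : (Fin N → ℝ) →L[ℝ] Y} {p : X × (Fin N → ℝ)} :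
    p ∈ LinearMap.ker ((stab Θ D).1 : X × (Fin N → ℝ) →ₗ[ℝ] Y) ↔ D.1 p.1 + Θ p.2 = 0 :=
  Iff.rfl

theorem exists_coker_eq {N : ℕ} {Θ : (Fin N → ℝ) →L[ℝ] Y}
    (hΘ : Function.Surjective (stab Θ D).1) (c : D.Coker) :
    ∃ u, (Submodule.Quotient.mk (Θ u) : D.Coker) = c := by
  obtain ⟨y, rfl⟩ := Submodule.mkQ_surjective _ c
  obtain ⟨⟨x, u⟩, rfl⟩ := hΘ y
  refine ⟨u, (Submodule.Quotient.eq _).2 ⟨-x, ?_⟩⟩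
  simp [stab_apply]

namespace IsExactTriple

variable (t : IsExactTriple D D' D'' iX jX iY jY)

/-- The map `κ(D'_{Θ'}) → κ(D_Θ)` of an exact triple with compatible stabilizations. -/
def stabKerI (t : IsExactTriple D D' D'' iX jX iY jY)
    (h₁ : ∀ u, Θ (euclIncl N' N'' u) = iY (Θ' u)) : (stab Θ' D').Ker →ₗ[ℝ] (stab Θ D).Ker :=
  ((iX : X' →ₗ[ℝ] X).prodMap (euclIncl N' N'')).restrict fun p hp => by
    rw [mem_ker_stab] at hp ⊢
    simp only [LinearMap.prodMap_apply, ContinuousLinearMap.coe_coe, t.comm_i, h₁]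
    rw [← map_add, hp, map_zero]

/-- The map `κ(D_Θ) → κ(D''_{Θ''})` of an exact triple with compatible stabilizations. -/
def stabKerJ (t : IsExactTriple D D' D'' iX jX iY jY)
    (h₂ : ∀ u, jY (Θ u) = Θ'' (euclProj N' N'' u)) : (stab Θ D).Ker →ₗ[ℝ] (stab Θ'' D'').Ker :=
  ((jX : X →ₗ[ℝ] X'').prodMap (euclProj N' N'')).restrict fun p hp => by
    rw [mem_ker_stab] at hp ⊢
    simp only [LinearMap.prodMap_apply, ContinuousLinearMap.coe_coe, t.comm_j, ← h₂]
    rw [← map_add, hp, map_zero]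

/-- The compatible stabilizations map the exact sequence of the `X × ℝ^N` to that of the `Y`, so
this is the surjectivity half of the five lemma. -/
theorem stab_surjective (t : IsExactTriple D D' D'' iX jX iY jY)
    (h₁ : ∀ u, Θ (euclIncl N' N'' u) = iY (Θ' u))
    (h₂ : ∀ u, jY (Θ u) = Θ'' (euclProj N' N'' u))
    (hΘ' : Function.Surjective (stab Θ' D').1) (hΘ'' : Function.Surjective (stab Θ'' D'').1) :
    Function.Surjective (stab Θ D).1 := by
  intro y
  obtain ⟨⟨x'', u''⟩, h⟩ := hΘ'' (jY y)
  obtain ⟨x, rfl⟩ := t.jX_surjective x''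
  obtain ⟨u, rfl⟩ := isSES_eucl.surj (V' := Fin N' → ℝ) u''
  obtain ⟨y', hy'⟩ := (t.exact_Y (y - (D.1 x + Θ u))).1 (by
    rw [map_sub, map_add, h₂, ← t.comm_j, ← h]
    exact sub_self _)
  obtain ⟨⟨x', u'⟩, h'⟩ := hΘ' y'
  refine ⟨(x + iX x', u + euclIncl N' N'' u'), ?_⟩
  rw [stab_apply] at h' ⊢
  rw [map_add, map_add, h₁, t.comm_i, add_add_add_comm, ← map_add, h', hy']
  abel

/-- By the snake lemma the obstruction lies in the cokernel of the stabilized `D'`, which is zero.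
-/
theorem stabKerJ_surjective (h₁ : ∀ u, Θ (euclIncl N' N'' u) = iY (Θ' u))
    (h₂ : ∀ u, jY (Θ u) = Θ'' (euclProj N' N'' u))
    (hΘ' : Function.Surjective (stab Θ' D').1) : Function.Surjective (t.stabKerJ h₂) := by
  rintro ⟨⟨x'', u''⟩, h⟩
  rw [mem_ker_stab] at h
  obtain ⟨x, rfl⟩ := t.jX_surjective x''
  obtain ⟨u, rfl⟩ := isSES_eucl.surj (V' := Fin N' → ℝ) u''
  obtain ⟨y', hy'⟩ := (t.exact_Y (D.1 x + Θ u)).1 (by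
    rw [map_add, h₂, ← t.comm_j]
    exact h)
  obtain ⟨⟨x', u'⟩, h'⟩ := hΘ' y'
  refine ⟨⟨(x - iX x', u - euclIncl N' N'' u'), ?_⟩, ?_⟩
  · rw [stab_apply] at h'
    rw [mem_ker_stab, map_sub, map_sub, h₁, t.comm_i, sub_add_sub_comm, ← hy', ← h', map_add]
    abel
  · refine Subtype.ext (Prod.ext ?_ ?_)
    · change jX (x - iX x') = jX x
      rw [map_sub, (t.exact_X _).2 ⟨x', rfl⟩, sub_zero]
    · change euclProj N' N'' (u - euclIncl N' N'' u') = euclProj N' N'' u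
      rw [map_sub, euclProj_euclIncl, sub_zero]

/-- A kernel element of `D_Θ` realizing the connecting homomorphism. -/
theorem exists_ker_of_delta (h₁ : ∀ u, Θ (euclIncl N' N'' u) = iY (Θ' u)) (v : D''.Ker)
    (b : Fin N' → ℝ) (hb : (Submodule.Quotient.mk (Θ' b) : D'.Coker) = t.delta v) :
    ∃ q : (stab Θ D).Ker, jX q.1.1 = v ∧ q.1.2 = -euclIncl N' N'' b := by
  obtain ⟨x, hx⟩ := t.jX_surjective v
  obtain ⟨y', hy'⟩ := (t.exact_Y (D.1 x)).1 (by
    rw [← t.comm_j, hx]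
    exact v.2)
  rw [t.delta_eq v x hx y' hy'] at hb
  obtain ⟨ξ, hξ⟩ := (Submodule.Quotient.eq _).1 hb
  -- After correction by `iX ξ`, `D` takes the value `iY (Θ' b)`, which the stabilization has to
  -- cancel; this forces the minus sign.
  refine ⟨⟨(x + iX ξ, -euclIncl N' N'' b), ?_⟩, ?_, rfl⟩
  · rw [mem_ker_stab, map_add, map_neg, h₁, t.comm_i, ← hy']
    have hξ' : D'.1 ξ = Θ' b - y' := hξ
    rw [hξ', map_sub]
    abel
  · rw [map_add, (t.exact_X _).2 ⟨ξ, rfl⟩, add_zero, hx]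

end IsExactTriple

end Psi

/-! ### The map `Ψ` in coordinates. -/

section PsiFormula

variable {X Y X' Y' X'' Y'' : Type*}
  [NormedAddCommGroup X] [NormedSpace ℝ X] [NormedAddCommGroup Y] [NormedSpace ℝ Y]
  [NormedAddCommGroup X'] [NormedSpace ℝ X'] [NormedAddCommGroup Y'] [NormedSpace ℝ Y']
  [NormedAddCommGroup X''] [NormedSpace ℝ X''] [NormedAddCommGroup Y''] [NormedSpace ℝ Y'']
  {D : Fred X Y} {D' : Fred X' Y'} {D'' : Fred X'' Y''}
  {iX : X' →L[ℝ] X} {jX : X →L[ℝ] X''} {iY : Y' →L[ℝ] Y} {jY : Y →L[ℝ] Y''}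
  {N' N'' : ℕ} {Θ' : (Fin N' → ℝ) →L[ℝ] Y'} {Θ'' : (Fin N'' → ℝ) →L[ℝ] Y''}
  {Θ : (Fin (N' + N'') → ℝ) →L[ℝ] Y}

theorem ιMulti_append {V : Type*} [AddCommGroup V] [Module ℝ V] {m n : ℕ} (a : Fin m → V)
    (b : Fin n → V) : ιMulti ℝ (m + n) (Fin.append a b) = ιMulti ℝ m a * ιMulti ℝ n b :=
  (ExteriorAlgebra.ιMulti_mul_ιMulti a b).symm

theorem comp_append {V W : Type*} (f : V → W) {m n : ℕ} (a : Fin m → V) (b : Fin n → V) :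
    f ∘ Fin.append a b = Fin.append (f ∘ a) (f ∘ b) := by
  ext1 i
  refine Fin.addCases (fun i => ?_) (fun i => ?_) i <;> simp

/-- The value of `val` in terms of families of vectors. -/
theorem smul_val_mk_vol {X Y : Type*} [NormedAddCommGroup X] [NormedSpace ℝ X]
    [NormedAddCommGroup Y] [NormedSpace ℝ Y] {N M : ℕ} {Θ : (Fin N → ℝ) →L[ℝ] Y} {D : Fred X Y}
    (P : X × (Fin N → ℝ) →L[ℝ] (Fin M → ℝ))
    (hΘ : Function.Surjective (stab Θ D).1) {k l c : ℕ}
    (x : Fin k → D.Ker) (hk : k = finrank ℝ D.Ker) (a : Fin l → (stab Θ D).Ker)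
    (b : Fin c → (Fin N → ℝ)) (hc : c = finrank ℝ D.Coker) (hl : l + c = N) {μ : ℝ}
    (hprod : ιMulti ℝ l (fun i => (a i).1.2) * ιMulti ℝ c b = μ • stdVol N)
    {α : Dual ℝ (TopExt D.Coker)}
    (hα : α (vol (fun i => Submodule.Quotient.mk (Θ (b i))) hc) = 1) :
    μ * val Θ P D (Det.mk (vol x hk) α) = (-1 : ℝ) ^ (N * c) *
      detForm (kerRestrict P (stab Θ D))
        (ιMulti ℝ k ((isExactTriple_stab Θ D).kerI ∘ x) * ιMulti ℝ l a) := by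
  have := FredSurj.subsingleton_coker ⟨stab Θ D, hΘ⟩
  obtain ⟨β, hβ⟩ := exists_dual_eq_one (unitTop_ne_zero (C := (stab Θ D).Coker))
  have hkl : k + l = finrank ℝ (stab Θ D).Ker := by
    have := finrank_stab_ker hΘ
    omega
  have h := congrArg (sval P (stab Θ D)) (smul_stabIso_mk_vol hΘ x hk a b hc hl hkl hprod hα hβ)
  rw [map_smul, map_smul, sval_mk, hβ, mul_one, coe_vol, ιMulti_append] at h
  exact h

set_option maxHeartbeats 1000000 in
/-- Compatibility of `Ψ` with stabilizations. -/
theorem IsExactTriple.val_psi (t : IsExactTriple D D' D'' iX jX iY jY)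
    (h₁ : ∀ u, Θ (euclIncl N' N'' u) = iY (Θ' u))
    (h₂ : ∀ u, jY (Θ u) = Θ'' (euclProj N' N'' u))
    (hΘ' : Function.Surjective (stab Θ' D').1) (hΘ'' : Function.Surjective (stab Θ'' D'').1)
    {M' M'' : ℕ} (hM' : finrank ℝ (stab Θ' D').Ker = M')
    (hM'' : finrank ℝ (stab Θ'' D'').Ker = M'')
    (P' : X' × (Fin N' → ℝ) →L[ℝ] (Fin M' → ℝ)) (P'' : X'' × (Fin N'' → ℝ) →L[ℝ] (Fin M'' → ℝ))
    (P : X × (Fin (N' + N'') → ℝ) →L[ℝ] (Fin (M' + M'') → ℝ))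
    (hP₁ : ∀ x u, P (iX x, euclIncl N' N'' u) = euclIncl M' M'' (P' (x, u)))
    (hP₂ : ∀ x u, euclProj M' M'' (P (x, u)) = P'' (jX x, euclProj N' N'' u))
    (σ' : Det X' Y' D') (σ'' : Det X'' Y'' D'') :
    val Θ P D (t.psi (σ' ⊗ₜ[ℝ] σ'')) =
      (-1 : ℝ) ^ ((N' : ℤ) * D''.index) * (val Θ' P' D' σ' * val Θ'' P'' D'' σ'') := by
  have hΘ := t.stab_surjective h₁ h₂ hΘ' hΘ''
  obtain ⟨n₁, n₂, n₃, n₄, n₅, x, u, v, w, y, e₁, e₂, e₃, e₄, e₅, e₆, hn₃, hx, huv, hvw, hwy, hy⟩ :=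
    t.isSixTermExact.exists_adapted
  -- Classes in the cokernels are represented by Euclidean vectors: `bv, bw` serve `D'`, the image
  -- of `bw` with `b` serves `D`, and the projection of `b` serves `D''`. The elements `q` lift `v`
  -- to the kernel of `D_Θ` with Euclidean part `-bv`.
  choose bw hbw using fun i => exists_coker_eq hΘ' (w i)
  choose bv hbv using fun i => exists_coker_eq hΘ' (t.delta (v i))
  choose b hb using fun i => exists_coker_eq hΘ (y i)
  choose q hq₁ hq₂ using fun i => t.exists_ker_of_delta h₁ (v i) (bv i) (hbv i)
  have hvw' : (fun i => (Submodule.Quotient.mk (Θ' (Fin.append bv bw i)) : D'.Coker)) =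
      Fin.append (t.delta ∘ v) w := by
    ext i
    refine Fin.addCases (fun i => ?_) (fun i => ?_) i
    · rw [Fin.append_left, Fin.append_left, hbv, Function.comp_apply]
    · rw [Fin.append_right, Fin.append_right, hbw]
  have hy' : (fun i => (Submodule.Quotient.mk (Θ'' (euclProj N' N'' (b i))) : D''.Coker)) =
      t.cokerJ ∘ y := by
    ext i
    rw [Function.comp_apply, ← hb, ← h₂]
    rfl
  have hwy' : (fun i => (Submodule.Quotient.mk
      (Θ (Fin.append (euclIncl N' N'' ∘ bw) b i)) : D.Coker)) = Fin.append (t.cokerI ∘ w) y := by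
    ext i
    refine Fin.addCases (fun i => ?_) (fun i => ?_) i
    · rw [Fin.append_left, Fin.append_left, Function.comp_apply, Function.comp_apply, ← hbw, h₁]
      rfl
    · rw [Fin.append_right, Fin.append_right, hb]
  obtain ⟨l', a', μ', hl', hk', hμ', hprod'⟩ := exists_stab_adapted hΘ' (Fin.append bv bw) e₄
    (by rwa [hvw'])
  obtain ⟨l'', a'', μ'', hl'', hk'', hμ'', hprod''⟩ := exists_stab_adapted hΘ''
    (fun i => euclProj N' N'' (b i)) e₆ (by rwa [hy'])
  -- The images of `a'`, followed by `q` and `A`, complete a basis of `κ(D)` to one of the kernel of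
  -- `D_Θ`.
  choose A hA using fun i => t.stabKerJ_surjective h₁ h₂ hΘ' (a'' i)
  obtain ⟨α, hα⟩ := exists_dual_eq_one hvw
  obtain ⟨β, hβ⟩ := exists_dual_eq_one hwy
  obtain ⟨γ, hγ⟩ := exists_dual_eq_one hy
  have key : t.psi (Det.mk (vol x e₁) α ⊗ₜ[ℝ] Det.mk (vol (Fin.append (t.kerJ ∘ u) v) e₃) γ) =
      (-1 : ℝ) ^ t.sign • Det.mk (vol (Fin.append (t.kerI ∘ x) u) e₂) β :=
    sixTermIso_vol t.isSixTermExact t.sign x u v w y e₁ e₂ e₃ e₄ e₅ e₆ hα hγ hβ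
  have hS' := smul_val_mk_vol P' hΘ' x e₁ a' (Fin.append bv bw) e₄ hl' hprod' (by rwa [hvw'])
  have hS'' := smul_val_mk_vol P'' hΘ'' (Fin.append (t.kerJ ∘ u) v) e₃ a''
    (fun i => euclProj N' N'' (b i)) e₆ hl'' hprod'' (by rwa [hy'])
  -- Moving `A` past `bw` costs `(-1)^(l'' n₄)`, and the minus signs in `q` cost `(-1)^n₃`; then the
  -- volumes `μ'` and `μ''` multiply.
  have hprod : ιMulti ℝ (l' + n₃ + l'')
      (fun i => (Fin.append (Fin.append (t.stabKerI h₁ ∘ a') q) A i).1.2) *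
      ιMulti ℝ (n₄ + n₅) (Fin.append (euclIncl N' N'' ∘ bw) b) =
      ((-1) ^ n₃ * (-1) ^ (l'' * n₄) * (μ' * μ'')) • stdVol (N' + N'') := by
    have hA' : ∀ i, euclProj N' N'' (A i).1.2 = (a'' i).1.2 := fun i =>
      congrArg (fun p : (stab Θ'' D'').Ker => p.1.2) (hA i)
    have hfam : (fun i => (Fin.append (Fin.append (t.stabKerI h₁ ∘ a') q) A i).1.2) =
        Fin.append (Fin.append (euclIncl N' N'' ∘ fun i => (a' i).1.2)
          (-(euclIncl N' N'' ∘ bv))) (fun i => (A i).1.2) := by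
      ext1 i
      refine Fin.addCases (fun i => ?_) (fun i => ?_) i
      · refine Fin.addCases (fun i => ?_) (fun i => ?_) i
        · simp only [Fin.append_left]
          rfl
        · simp only [Fin.append_left, Fin.append_right]
          exact hq₂ i
      · simp only [Fin.append_right]
    have h' := congrArg (ExteriorAlgebra.map (euclIncl N' N'')) hprod'
    rw [map_mul, map_smul, ExteriorAlgebra.map_apply_ιMulti, ExteriorAlgebra.map_apply_ιMulti,
      comp_append, ιMulti_append] at h'
    have h'' := map_stdVol_mul (N' := N') hl'' (fun i => (A i).1.2) b (μ := μ'') (by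
      rw [← hprod'']
      congr 2
      exact funext hA')
    rw [hfam]
    simp only [ιMulti_append, ιMulti_neg]
    rw [mul_smul_comm, smul_mul_assoc, smul_mul_assoc, mul_assoc (_ * _), ← mul_assoc (ιMulti ℝ l'' _),
      ιMulti_mul_comm (fun i => (A i).1.2), smul_mul_assoc, mul_smul_comm,
      ← mul_assoc (_ * _), ← mul_assoc (_ * _), mul_assoc (ιMulti ℝ l' _), h', smul_mul_assoc,
      smul_mul_assoc, mul_assoc, h'', smul_smul, smul_smul, smul_smul]
    congr 1
    ring
  have hS := smul_val_mk_vol P hΘ (Fin.append (t.kerI ∘ x) u) e₂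
    (Fin.append (Fin.append (t.stabKerI h₁ ∘ a') q) A) (Fin.append (euclIncl N' N'' ∘ bw) b) e₅
    (by omega) hprod (by rwa [hwy'])
  -- Moving `u` past `a'` costs `(-1)^(n₂ l')`. Then `x, a'` come from the kernel of the stabilized
  -- `D'`, while `u, q, A` map to the family chosen for `D''`, so the determinant is block
  -- triangular.
  have hdet : detForm (kerRestrict P (stab Θ D)) (ιMulti ℝ (n₁ + n₂)
      ((isExactTriple_stab Θ D).kerI ∘ Fin.append (t.kerI ∘ x) u) *
        ιMulti ℝ (l' + n₃ + l'') (Fin.append (Fin.append (t.stabKerI h₁ ∘ a') q) A)) =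
      (-1) ^ (n₂ * l') * (detForm (kerRestrict P' (stab Θ' D'))
        (ιMulti ℝ n₁ ((isExactTriple_stab Θ' D').kerI ∘ x) * ιMulti ℝ l' a') *
      detForm (kerRestrict P'' (stab Θ'' D''))
        (ιMulti ℝ (n₂ + n₃) ((isExactTriple_stab Θ'' D'').kerI ∘ Fin.append (t.kerJ ∘ u) v) *
          ιMulti ℝ l'' a'')) := by
    have hk₁ : (isExactTriple_stab Θ D).kerI ∘ Fin.append (t.kerI ∘ x) u =
        Fin.append (t.stabKerI h₁ ∘ (isExactTriple_stab Θ' D').kerI ∘ x)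
          ((isExactTriple_stab Θ D).kerI ∘ u) := by
      rw [comp_append]
      congr 1
      ext1 i
      refine Subtype.ext (Prod.ext rfl ?_)
      exact (map_zero (euclIncl N' N'')).symm
    have hk₂ : t.stabKerJ h₂ ∘ Fin.append (Fin.append ((isExactTriple_stab Θ D).kerI ∘ u) q) A =
        Fin.append ((isExactTriple_stab Θ'' D'').kerI ∘ Fin.append (t.kerJ ∘ u) v) a'' := by
      simp only [comp_append]
      refine congrArg₂ Fin.append (congrArg₂ Fin.append ?_ ?_) ?_
      · rfl
      · ext1 i
        refine Subtype.ext (Prod.ext (hq₁ i) ?_)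
        change euclProj N' N'' (q i).1.2 = 0
        rw [hq₂, map_neg, euclProj_euclIncl, neg_zero]
      · ext1 i
        exact hA i
    have hd := detForm_mul (kerRestrict P (stab Θ D)) (kerRestrict P' (stab Θ' D'))
      (kerRestrict P'' (stab Θ'' D'')) (t.stabKerI h₁) (t.stabKerJ h₂)
      (fun z k => (congrFun (hP₁ z.1.1 z.1.2) _).trans (euclIncl_castAdd _ k))
      (fun z k => (congrFun (hP₁ z.1.1 z.1.2) _).trans (euclIncl_natAdd _ k))
      (fun z k => congrFun (hP₂ z.1.1 z.1.2) k) (n' := n₁ + l') (n'' := n₂ + n₃ + l'')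
      (by omega) (by omega) (Fin.append ((isExactTriple_stab Θ' D').kerI ∘ x) a')
      (Fin.append (Fin.append ((isExactTriple_stab Θ D).kerI ∘ u) q) A)
    rw [hk₂, comp_append] at hd
    simp only [ιMulti_append] at hd
    rw [hk₁]
    simp only [ιMulti_append]
    rw [← hd]
    refine Eq.trans (congrArg _ ?_) ((map_smul _ _ _).trans (smul_eq_mul _ _))
    rw [mul_assoc (ιMulti ℝ n₁ _), mul_assoc (ιMulti ℝ l' _), ← mul_assoc (ιMulti ℝ n₂ _),
      ιMulti_mul_comm _ (t.stabKerI h₁ ∘ a'), smul_mul_assoc, mul_smul_comm]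
    simp only [mul_assoc]
  have hgen : val Θ P D (t.psi (Det.mk (vol x e₁) α ⊗ₜ[ℝ]
      Det.mk (vol (Fin.append (t.kerJ ∘ u) v) e₃) γ)) =
      (-1 : ℝ) ^ ((N' : ℤ) * D''.index) * (val Θ' P' D' (Det.mk (vol x e₁) α) *
        val Θ'' P'' D'' (Det.mk (vol (Fin.append (t.kerJ ∘ u) v) e₃) γ)) := by
    rw [key, map_smul, smul_eq_mul]
    rw [hdet] at hS
    have hN' : N' = l' + (n₃ + n₄) := hl'.symm
    have hN'' : N'' = l'' + n₅ := hl''.symm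
    have hsign := sign_identity n₂ n₃ n₄ n₅ l' l''
    rw [← hN', ← hN'', e₃, e₄, e₅] at hsign
    have hind : D''.index = (finrank ℝ D''.Ker - n₅ : ℤ) := by rw [Fred.index, e₆]
    have hs : t.sign = ((finrank ℝ D''.Ker : ℤ) - n₅) * finrank ℝ D'.Coker +
        finrank ℝ D.Coker * n₃ := by rw [IsExactTriple.sign, hind, hn₃]
    rw [← hs, ← hind] at hsign
    rw [e₅] at hS
    rw [e₄] at hS'
    have hsq : ∀ n : ℕ, (-1 : ℝ) ^ n * (-1) ^ n = 1 := fun n => by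
      rw [← mul_pow]; simp
    have hA1 := hsq n₃
    have hB1 := hsq (l'' * n₄)
    generalize val Θ P D _ = V at hS ⊢
    generalize val Θ' P' D' _ = V' at hS' ⊢
    generalize val Θ'' P'' D'' _ = V'' at hS'' ⊢
    generalize detForm (kerRestrict P' (stab Θ' D')) _ = F' at hS hS'
    generalize detForm (kerRestrict P'' (stab Θ'' D'')) _ = F'' at hS hS''
    generalize (-1 : ℝ) ^ n₃ = a at *
    generalize (-1 : ℝ) ^ (l'' * n₄) = b at *
    generalize (-1 : ℝ) ^ t.sign = S at *
    generalize (-1 : ℝ) ^ ((N' : ℤ) * D''.index) = T at *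
    -- The three evaluations carry the volume factors `μ'`, `μ''` and their product; cancelling
    -- these leaves `sign_identity`.
    refine mul_left_cancel₀ (mul_ne_zero hμ' hμ'') ?_
    linear_combination (S * a * b) * hS + (F' * F'') * hsign - T * μ'' * V'' * hS' -
      T * (-1) ^ (N' * finrank ℝ D'.Coker) * F' * hS'' - (S * μ' * μ'' * V) * (b * b) * hA1 -
      (S * μ' * μ'' * V) * hB1
  -- Both sides are bilinear in `σ'` and `σ''`, so one generator of each line suffices.
  have hne' : Det.mk (vol x e₁) α ≠ 0 := DetLine.mk_ne_zero hx (by rintro rfl; simp at hα)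
  have hne'' : Det.mk (vol (Fin.append (t.kerJ ∘ u) v) e₃) γ ≠ 0 :=
    DetLine.mk_ne_zero huv (by rintro rfl; simp at hγ)
  obtain ⟨r, rfl⟩ := exists_smul_line (finrank_det _) hne' σ'
  obtain ⟨s, rfl⟩ := exists_smul_line (finrank_det _) hne'' σ''
  rw [TensorProduct.smul_tmul_smul, map_smul, map_smul, hgen, map_smul, map_smul]
  simp only [smul_eq_mul]
  ring

end PsiFormula

/-! ### Kernel frames of surjective operators and change of coordinates. -/

section Frames

variable {X Y : Type*} [NormedAddCommGroup X] [NormedSpace ℝ X]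
  [NormedAddCommGroup Y] [NormedSpace ℝ Y] {M N Q : ℕ}

theorem bijective_of_ne_zero {L : Type*} [AddCommGroup L] [Module ℝ L] (hL : finrank ℝ L = 1)
    (f : L →ₗ[ℝ] ℝ) {σ : L} (h : f σ ≠ 0) : Function.Bijective f := by
  have hσ : σ ≠ 0 := by rintro rfl; simp at h
  constructor
  · rw [injective_iff_map_eq_zero]
    intro z hz
    obtain ⟨c, rfl⟩ := exists_smul_line hL hσ z
    rw [map_smul, smul_eq_mul] at hz
    rw [(mul_eq_zero.1 hz).resolve_right h, zero_smul]
  · intro r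
    exact ⟨(r / f σ) • σ, by simp [h]⟩

theorem sval_ne_zero {P : X →L[ℝ] (Fin M → ℝ)} {E : Fred X Y} (hE : Function.Surjective E.1)
    (hP : Function.Bijective (kerRestrict P E)) {σ : Det X Y E} (hσ : σ ≠ 0) :
    sval P E σ ≠ 0 := by
  have := FredSurj.subsingleton_coker ⟨E, hE⟩
  obtain ⟨x, hx⟩ := exists_ne_zero_topExt E.Ker
  obtain ⟨β, hβ⟩ := exists_dual_eq_one (unitTop_ne_zero (C := E.Coker))
  obtain ⟨c, hc⟩ := exists_smul_line (finrank_det E) hσ (Det.mk x β)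
  intro h0
  have := detForm_ιMulti_ne_zero (kerRestrict P E) hP hx
  apply this
  rw [← mul_one (detForm _ _), ← hβ, ← sval_mk, ← hc, map_smul, h0, smul_zero]

variable {E : Fred X Y} {P : X →L[ℝ] (Fin M → ℝ)}

/-- Invertibility of `(E, P)` packs two conditions into one open condition: `E` is surjective, and
`P` is a coordinate system on its kernel. -/
theorem surjective_of_prod (h : (E.1.prod P).IsInvertible) : Function.Surjective E.1 := fun y => by
  obtain ⟨x, hx⟩ := h.surjective (y, 0)
  exact ⟨x, congrArg Prod.fst hx⟩

theorem kerRestrict_bijective (h : (E.1.prod P).IsInvertible) :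
    Function.Bijective (kerRestrict P E) := by
  constructor
  · rintro ⟨x, hx⟩ ⟨y, hy⟩ hxy
    exact Subtype.ext (h.injective (Prod.ext (hx.trans hy.symm) hxy))
  · intro r
    obtain ⟨x, hx⟩ := h.surjective (0, r)
    exact ⟨⟨x, congrArg Prod.fst hx⟩, congrArg Prod.snd hx⟩

theorem finrank_ker_of_prod (h : (E.1.prod P).IsInvertible) : finrank ℝ E.Ker = M := by
  rw [(LinearEquiv.ofBijective _ (kerRestrict_bijective h)).finrank_eq, finrank_fin_fun]

/-- Bijectivity is linear algebra; boundedness of the inverse is the open mapping theorem. -/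
theorem isInvertible_prod [CompleteSpace X] [CompleteSpace Y] (hE : Function.Surjective E.1)
    (hP : Function.Bijective (kerRestrict P E)) : (E.1.prod P).IsInvertible := by
  have hb : Function.Bijective (E.1.prod P) := by
    constructor
    · rw [injective_iff_map_eq_zero]
      intro x hx
      have := hP.1 (a₁ := ⟨x, congrArg Prod.fst hx⟩) (a₂ := 0) (by
        rw [map_zero]
        exact congrArg Prod.snd hx)
      exact congrArg Subtype.val this
    · rintro ⟨y, r⟩
      obtain ⟨x, rfl⟩ := hE y
      obtain ⟨z, hz⟩ := hP.2 (r - P x)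
      refine ⟨x + z.1, Prod.ext ?_ ?_⟩
      · change E.1 (x + z.1) = E.1 x
        rw [map_add, show E.1 z.1 = 0 from z.2, add_zero]
      · change P (x + z.1) = r
        rw [map_add, show P z.1 = r - P x from hz]
        abel
  exact ⟨ContinuousLinearEquiv.ofBijective (E.1.prod P) (LinearMap.ker_eq_bot.2 hb.1)
    (LinearMap.range_eq_top.2 hb.2), ContinuousLinearEquiv.coe_ofBijective _ _ _⟩

theorem apply_inverse_prod (h : (E.1.prod P).IsInvertible) (p : Y × (Fin M → ℝ)) :
    E.1 ((E.1.prod P).inverse p) = p.1 ∧ P ((E.1.prod P).inverse p) = p.2 :=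
  ⟨congrArg Prod.fst (h.self_apply_inverse p), congrArg Prod.snd (h.self_apply_inverse p)⟩

/-- The basis of `κ(E)` dual to the coordinates `P`. -/
def dualFrame (h : (E.1.prod P).IsInvertible) (i : Fin M) : E.Ker :=
  ⟨(E.1.prod P).inverse (0, Pi.single i 1), (apply_inverse_prod h _).1⟩

/-- The generator of `λ(E)` on which the coordinate `sval P E` is `1`. -/
theorem exists_generator (h : (E.1.prod P).IsInvertible) :
    ∃ α : Dual ℝ (TopExt E.Coker), α (unitTop _) = 1 ∧
      sval P E (Det.mk (vol (dualFrame h) (finrank_ker_of_prod h).symm) α) = 1 := by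
  have := FredSurj.subsingleton_coker ⟨E, surjective_of_prod h⟩
  obtain ⟨α, hα⟩ := exists_dual_eq_one (unitTop_ne_zero (C := E.Coker))
  refine ⟨α, hα, ?_⟩
  rw [sval_mk, hα, mul_one, coe_vol, detForm_ιMulti]
  convert Matrix.det_one (n := Fin M) (R := ℝ) using 2
  ext i j
  have : kerRestrict P E (dualFrame h i) = Pi.single i 1 := (apply_inverse_prod h _).2
  simp [this, Matrix.one_apply, Pi.single_apply, eq_comm]

theorem sval_bijective (h : (E.1.prod P).IsInvertible) : Function.Bijective (sval P E) := by
  obtain ⟨α, -, hα⟩ := exists_generator h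
  exact bijective_of_ne_zero (finrank_det E) _ (by rw [hα]; exact one_ne_zero)

/-- Change of coordinates on the determinant line of a surjective operator. -/
theorem sval_eq_det_mul (h : (E.1.prod P).IsInvertible) (P' : X →L[ℝ] (Fin M → ℝ))
    (σ : Det X Y E) :
    sval P' E σ = Matrix.det (Matrix.of fun i =>
      P' ((E.1.prod P).inverse (0, Pi.single i 1))) * sval P E σ := by
  obtain ⟨α, hα, h1⟩ := exists_generator h
  have hne : Det.mk (vol (dualFrame h) (finrank_ker_of_prod h).symm) α ≠ 0 := by
    intro h0
    rw [h0, map_zero] at h1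
    exact zero_ne_one h1
  obtain ⟨c, rfl⟩ := exists_smul_line (finrank_det E) hne σ
  rw [map_smul, map_smul, h1, sval_mk, hα, coe_vol, detForm_ιMulti, smul_eq_mul, smul_eq_mul,
    mul_one, mul_one, mul_comm]
  rfl

/-- The family of vectors of `κ(E_Θ)` obtained from the inverse `G` of `(E, P)`. -/
def stabFamily (G : Y × (Fin M → ℝ) →L[ℝ] X) (Θ : (Fin N → ℝ) →L[ℝ] Y) :
    Fin (M + N) → X × (Fin N → ℝ) :=
  Fin.append (fun i => (G (0, Pi.single i 1), 0))
    fun i => (-G (Θ (Pi.single i 1), 0), Pi.single i 1)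

/-- For surjective `E` there is no cokernel, hence no sign. The kernel of `E_Θ` is spanned by the
dual frame of `E` and the vectors `(-G Θ e_i, e_i)`, whose Euclidean parts have volume `1`. The
entries of the resulting matrix depend explicitly on the inverse `G`, which gives continuity later.
-/
theorem val_eq_det_mul (h : (E.1.prod P).IsInvertible) (Θ : (Fin N → ℝ) →L[ℝ] Y)
    (hQ : Q = M + N) (P' : X × (Fin N → ℝ) →L[ℝ] (Fin Q → ℝ)) (σ : Det X Y E) :
    val Θ P' E σ = Matrix.det (Matrix.of fun i =>
      P' (stabFamily (E.1.prod P).inverse Θ (Fin.cast hQ i))) * sval P E σ := by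
  have hE := surjective_of_prod h
  have hΘ : Function.Surjective (stab Θ E).1 := fun y => by
    obtain ⟨x, rfl⟩ := hE y
    exact ⟨(x, 0), by simp [stab_apply]⟩
  have := FredSurj.subsingleton_coker ⟨E, hE⟩
  obtain ⟨α, hα, h1⟩ := exists_generator h
  have hne : Det.mk (vol (dualFrame h) (finrank_ker_of_prod h).symm) α ≠ 0 := by
    intro h0
    rw [h0, map_zero] at h1
    exact zero_ne_one h1
  let a : Fin N → (stab Θ E).Ker := fun i =>
    ⟨(-(E.1.prod P).inverse (Θ (Pi.single i 1), 0), Pi.single i 1), by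
      rw [mem_ker_stab, map_neg, (apply_inverse_prod h _).1, neg_add_cancel]⟩
  have hc : 0 = finrank ℝ E.Coker := finrank_zero_of_subsingleton.symm
  have key := smul_val_mk_vol P' hΘ (dualFrame h) (finrank_ker_of_prod h).symm a
    (Fin.elim0 : Fin 0 → (Fin N → ℝ)) hc (add_zero N) (μ := 1) (by simp [a, stdVol]) (α := α) (by
      rw [← unitTop_eq_vol rfl, hα])
  obtain ⟨c, rfl⟩ := exists_smul_line (finrank_det E) hne σ
  rw [one_mul, mul_zero, pow_zero, one_mul, ← ιMulti_append, detForm_ιMulti_cast hQ] at key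
  rw [map_smul, map_smul, h1, key, smul_eq_mul, smul_eq_mul, mul_one, mul_comm]
  congr 3
  ext i j
  refine congrFun (congrArg P' ?_) j
  generalize Fin.cast hQ i = k
  refine Fin.addCases (fun k => ?_) (fun k => ?_) k
  · rw [stabFamily, Fin.append_left, Fin.append_left]
    rfl
  · rw [stabFamily, Fin.append_right, Fin.append_right]
    rfl

end Frames

/-! ### Comparison of two stabilizations of one operator. -/

section ChangeOfStabilization

variable {X Y : Type*} [NormedAddCommGroup X] [NormedSpace ℝ X]
  [NormedAddCommGroup Y] [NormedSpace ℝ Y] {M₁ M₂ N₁ N₂ : ℕ}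

/-- The inclusion `ℝ^{N''} → ℝ^{N' + N''}`. -/
def euclInclRight (N' N'' : ℕ) : (Fin N'' → ℝ) →ₗ[ℝ] (Fin (N' + N'') → ℝ) where
  toFun u := Fin.append 0 u
  map_add' u v := by
    ext k; refine Fin.addCases (fun k => ?_) (fun k => ?_) k <;> simp
  map_smul' c u := by
    ext k; refine Fin.addCases (fun k => ?_) (fun k => ?_) k <;> simp

theorem euclProj_euclInclRight {N' N'' : ℕ} (u : Fin N'' → ℝ) :
    euclProj N' N'' (euclInclRight N' N'' u) = u := by
  ext k
  exact Fin.append_right _ _ _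

/-- Coordinates on `κ(D_Θ)` from coordinates on the outer terms of an exact triple. -/
def glueCoord {X : Type*} [NormedAddCommGroup X] [NormedSpace ℝ X] (N' N'' : ℕ)
    (P' : X →L[ℝ] (Fin N' → ℝ)) (P'' : X →L[ℝ] (Fin N'' → ℝ)) : X →L[ℝ] (Fin (N' + N'') → ℝ) :=
  LinearMap.toContinuousLinearMap (euclIncl N' N'') ∘L P' +
    LinearMap.toContinuousLinearMap (euclInclRight N' N'') ∘L P''

theorem euclProj_glueCoord {X : Type*} [NormedAddCommGroup X] [NormedSpace ℝ X] {N' N'' : ℕ}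
    (P' : X →L[ℝ] (Fin N' → ℝ)) (P'' : X →L[ℝ] (Fin N'' → ℝ)) (x : X) :
    euclProj N' N'' (glueCoord N' N'' P' P'' x) = P'' x := by
  change euclProj N' N'' (euclIncl N' N'' (P' x) + euclInclRight N' N'' (P'' x)) = P'' x
  rw [map_add, euclProj_euclIncl, euclProj_euclInclRight, zero_add]

theorem glueCoord_of_eq_zero {X : Type*} [NormedAddCommGroup X] [NormedSpace ℝ X] {N' N'' : ℕ}
    (P' : X →L[ℝ] (Fin N' → ℝ)) (P'' : X →L[ℝ] (Fin N'' → ℝ)) {x : X} (hx : P'' x = 0) :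
    glueCoord N' N'' P' P'' x = euclIncl N' N'' (P' x) := by
  change euclIncl N' N'' (P' x) + euclInclRight N' N'' (P'' x) = _
  rw [hx, map_zero, add_zero]

theorem val_ne_zero {N M : ℕ} {Θ : (Fin N → ℝ) →L[ℝ] Y} {D : Fred X Y}
    {P : X × (Fin N → ℝ) →L[ℝ] (Fin M → ℝ)} (hΘ : Function.Surjective (stab Θ D).1)
    (hP : Function.Bijective (kerRestrict P (stab Θ D))) {σ : Det X Y D} (hσ : σ ≠ 0) :
    val Θ P D σ ≠ 0 :=
  sval_ne_zero hΘ hP ((stabIso Θ D).map_ne_zero_iff.2 hσ)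

theorem val_bijective {N M : ℕ} {Θ : (Fin N → ℝ) →L[ℝ] Y} {D : Fred X Y}
    {P : X × (Fin N → ℝ) →L[ℝ] (Fin M → ℝ)} (h : ((stab Θ D).1.prod P).IsInvertible) :
    Function.Bijective (val Θ P D) :=
  (sval_bijective h).comp (stabIso Θ D).bijective

theorem surjective_stab_zeroOp (N : ℕ) :
    Function.Surjective (stab (0 : (Fin 0 → ℝ) →L[ℝ] (Fin 0 → ℝ)) (zeroOp N)).1 :=
  fun _ => ⟨0, Subsingleton.elim _ _⟩

theorem kerRestrict_fst_bijective (N : ℕ) : Function.Bijective (kerRestrict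
    (ContinuousLinearMap.fst ℝ (Fin N → ℝ) (Fin 0 → ℝ)) (stab 0 (zeroOp N))) :=
  ⟨fun _ _ h => Subtype.ext (Prod.ext h (Subsingleton.elim _ _)),
    fun u => ⟨⟨(u, 0), Subsingleton.elim _ _⟩, rfl⟩⟩

/-- The universal constant in the comparison of two stabilizations. -/
def changeConst (N₁ N₂ : ℕ) : ℝ :=
  ((-1 : ℝ) ^ ((N₂ : ℤ) * (zeroOp N₁).index) *
    val (0 : (Fin 0 → ℝ) →L[ℝ] (Fin 0 → ℝ)) (ContinuousLinearMap.fst ℝ (Fin N₁ → ℝ) (Fin 0 → ℝ))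
      (zeroOp N₁) (zeroOpGen N₁))⁻¹

/-- Only nonvanishing and independence of the operator matter; the value itself is never needed. -/
theorem changeConst_ne_zero (N₁ N₂ : ℕ) : changeConst N₁ N₂ ≠ 0 :=
  inv_ne_zero (mul_ne_zero (zpow_ne_zero _ (by norm_num))
    (val_ne_zero (surjective_stab_zeroOp N₁) (kerRestrict_fst_bijective N₁) (zeroOpGen_ne_zero N₁)))

/-- The coordinates of the twofold stabilization of an operator. -/
def twofoldCoord (N₁ : ℕ) (P₂ : X × (Fin N₂ → ℝ) →L[ℝ] (Fin M₂ → ℝ)) :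
    (X × (Fin N₁ → ℝ)) × (Fin N₂ → ℝ) →L[ℝ] (Fin (M₂ + N₁) → ℝ) :=
  glueCoord M₂ N₁ (P₂ ∘L ((ContinuousLinearMap.fst ℝ X (Fin N₁ → ℝ)).prodMap
      (ContinuousLinearMap.id ℝ (Fin N₂ → ℝ))))
    (ContinuousLinearMap.snd ℝ X (Fin N₁ → ℝ) ∘L
      ContinuousLinearMap.fst ℝ (X × (Fin N₁ → ℝ)) (Fin N₂ → ℝ))

/-- The matrix whose determinant compares two stabilizations; `G` is the inverse of the first
stabilized operator. -/
def changeMatrix (hQ : M₂ + N₁ = M₁ + N₂)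
    (G : Y × (Fin M₁ → ℝ) →L[ℝ] X × (Fin N₁ → ℝ)) (Θ₂ : (Fin N₂ → ℝ) →L[ℝ] Y)
    (P₂ : X × (Fin N₂ → ℝ) →L[ℝ] (Fin M₂ → ℝ)) : Matrix (Fin (M₂ + N₁)) (Fin (M₂ + N₁)) ℝ :=
  Matrix.of fun i => twofoldCoord N₁ P₂ (stabFamily G Θ₂ (Fin.cast hQ i))

variable {D : Fred X Y} {Θ₁ : (Fin N₁ → ℝ) →L[ℝ] Y} {Θ₂ : (Fin N₂ → ℝ) →L[ℝ] Y}
  {P₁ : X × (Fin N₁ → ℝ) →L[ℝ] (Fin M₁ → ℝ)} {P₂ : X × (Fin N₂ → ℝ) →L[ℝ] (Fin M₂ → ℝ)}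

/-- Both `M₁ - N₁` and `M₂ - N₂` are the index of `D`. -/
theorem change_dim (h₁ : ((stab Θ₁ D).1.prod P₁).IsInvertible)
    (h₂ : ((stab Θ₂ D).1.prod P₂).IsInvertible) : M₂ + N₁ = M₁ + N₂ := by
  have e₁ := finrank_stab_ker (surjective_of_prod h₁)
  have e₂ := finrank_stab_ker (surjective_of_prod h₂)
  rw [finrank_ker_of_prod h₁] at e₁
  rw [finrank_ker_of_prod h₂] at e₂
  omega

/-- Comparison of the coordinates on `λ(D)` defined by two stabilizations. -/
theorem val_change (h₁ : ((stab Θ₁ D).1.prod P₁).IsInvertible)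
    (h₂ : ((stab Θ₂ D).1.prod P₂).IsInvertible) (hQ : M₂ + N₁ = M₁ + N₂) (σ : Det X Y D) :
    val Θ₂ P₂ D σ = changeConst N₁ N₂ *
      (changeMatrix hQ ((stab Θ₁ D).1.prod P₁).inverse Θ₂ P₂).det * val Θ₁ P₁ D σ := by
  -- The line of the twofold stabilization is evaluated in two ways. Since `D_{Θ₁}` is surjective,
  -- adding `Θ₂` multiplies its coordinate by an explicit determinant.
  have e₁ := val_eq_det_mul h₁ Θ₂ hQ (twofoldCoord N₁ P₂) (stabIso Θ₁ D σ)
  have hM : finrank ℝ (stab (0 : (Fin 0 → ℝ) →L[ℝ] (Fin 0 → ℝ)) (zeroOp N₁)).Ker = N₁ := by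
    rw [(LinearEquiv.ofBijective _ (kerRestrict_fst_bijective N₁)).finrank_eq, finrank_fin_fun]
  have hincl : ∀ u, euclIncl N₂ 0 u = u := fun u => by
    ext k
    exact euclIncl_castAdd (N'' := 0) u k
  -- The second evaluation treats `stabIso Θ₁ D` as `Ψ` of its triple: the sub-operator `D` is
  -- stabilized by `Θ₂`, and the already surjective quotient `ℝ^{N₁} → 0` by nothing, so `N'' = 0`.
  have e₂ := (isExactTriple_stab Θ₁ D).val_psi (N' := N₂) (N'' := 0) (Θ' := Θ₂)
    (Θ'' := (0 : (Fin 0 → ℝ) →L[ℝ] (Fin 0 → ℝ))) (Θ := Θ₂) (fun u => by rw [hincl]; rfl)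
    (fun u => Subsingleton.elim _ _) (surjective_of_prod h₂) (surjective_stab_zeroOp N₁)
    (finrank_ker_of_prod h₂) hM P₂ (ContinuousLinearMap.fst ℝ (Fin N₁ → ℝ) (Fin 0 → ℝ))
    (twofoldCoord N₁ P₂) (fun x u => by
      rw [hincl]
      exact glueCoord_of_eq_zero _ _ rfl)
    (fun x u => euclProj_glueCoord _ _ _) σ (zeroOpGen N₁)
  rw [← stabIso_apply] at e₂
  have e₃ := e₂.symm.trans e₁
  have hc := inv_ne_zero (changeConst_ne_zero N₁ N₂)
  rw [changeConst, inv_inv] at hc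
  rw [mul_assoc, changeConst]
  rw [eq_inv_mul_iff_mul_eq₀ hc, mul_assoc, mul_comm (val 0 _ _ _)]
  exact e₃

end ChangeOfStabilization

open Set Filter

/-! ### Line bundles described by families of linear forms. -/

section Coordinate

variable {B : Type*} {E : B → Type*} [∀ b, AddCommMonoid (E b)] [∀ b, Module ℝ (E b)]

open Classical in
/-- The point of the total space over `b` with coordinate `r`, if it exists. -/
def coordSection (v : ∀ b, E b →ₗ[ℝ] ℝ) (p : B × ℝ) : TotalSpace ℝ E :=
  ⟨p.1, if h : ∃ x, v p.1 x = p.2 then h.choose else 0⟩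

theorem apply_coordSection {v : ∀ b, E b →ₗ[ℝ] ℝ} {b : B} (hb : Function.Surjective (v b)) (r : ℝ) :
    v b (coordSection v (b, r)).2 = r := by
  have h : ∃ x, v b x = r := hb r
  have h' : (coordSection v (b, r)).2 = h.choose := dif_pos h
  exact (congrArg (v b) h').trans h.choose_spec

theorem coordSection_apply {v : ∀ b, E b →ₗ[ℝ] ℝ} {b : B} (hb : Function.Injective (v b)) (x : E b) :
    coordSection v (b, v b x) = ⟨b, x⟩ := by
  have h : ∃ y, v b y = v b x := ⟨x, rfl⟩
  rw [coordSection]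
  simp only [dif_pos h]
  congr
  exact hb h.choose_spec

theorem coordSection_eq {v : ∀ b, E b →ₗ[ℝ] ℝ} {z : TotalSpace ℝ E}
    (hz : Function.Injective (v z.1)) : coordSection v (z.1, v z.1 z.2) = z :=
  coordSection_apply hz z.2

variable [TopologicalSpace B] [TopologicalSpace (TotalSpace ℝ E)]

/-- A family of linear forms on the fibers of `E` is a coordinate over an open set `U` if it
identifies the restriction of `E` to `U` with the product `U × ℝ`. -/
structure IsCoordOn (v : ∀ b, E b →ₗ[ℝ] ℝ) (U : Set B) : Prop where
  isOpen : IsOpen U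
  bijective : ∀ b ∈ U, Function.Bijective (v b)
  -- The total space carries an arbitrary topology, so continuity of the projection is not
  -- available.
  isOpen_preimage : IsOpen (π ℝ E ⁻¹' U)
  continuousOn : ContinuousOn (fun z : TotalSpace ℝ E => (z.1, v z.1 z.2)) (π ℝ E ⁻¹' U)
  continuousOn_section : ContinuousOn (coordSection v) (U ×ˢ univ)

namespace IsCoordOn

variable {v : ∀ b, E b →ₗ[ℝ] ℝ} {U : Set B}

theorem mono (h : IsCoordOn v U) {U' : Set B} (hU' : IsOpen U') (hsub : U' ⊆ U) :
    IsCoordOn v U' where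
  isOpen := hU'
  bijective b hb := h.bijective b (hsub hb)
  isOpen_preimage := by
    have := h.continuousOn.isOpen_inter_preimage h.isOpen_preimage (hU'.prod isOpen_univ)
    convert this using 1
    ext z
    simp only [mem_preimage, mem_inter_iff, mem_prod, mem_univ, and_true]
    exact ⟨fun hz => ⟨hsub hz, hz⟩, fun hz => hz.2⟩
  continuousOn := h.continuousOn.mono (preimage_mono hsub)
  continuousOn_section := h.continuousOn_section.mono (prod_mono hsub le_rfl)

/-- The new section is the old one after the homeomorphism `(b, r) ↦ (b, r / f b)` of `U × ℝ`.
Transition factors and locally constant signs enter through this lemma. -/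
theorem smul (h : IsCoordOn v U) {f : B → ℝ} (hf : ContinuousOn f U) (hf0 : ∀ b ∈ U, f b ≠ 0)
    {v' : ∀ b, E b →ₗ[ℝ] ℝ} (hv : ∀ b ∈ U, ∀ x, v' b x = f b * v b x) : IsCoordOn v' U := by
  have hbij : ∀ b ∈ U, Function.Bijective (v' b) := fun b hb => by
    have : (v' b : E b → ℝ) = (Equiv.mulLeft₀ (f b) (hf0 b hb)) ∘ v b := funext (hv b hb)
    rw [this]
    exact (Equiv.bijective _).comp (h.bijective b hb)
  refine ⟨h.isOpen, hbij, h.isOpen_preimage, ?_, ?_⟩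
  · have h1 := continuous_fst.comp_continuousOn h.continuousOn
    have h2 := continuous_snd.comp_continuousOn h.continuousOn
    have h3 : ContinuousOn (fun z : TotalSpace ℝ E => f z.1) (π ℝ E ⁻¹' U) :=
      hf.comp h1 fun z hz => hz
    exact (h1.prodMk (h3.mul h2)).congr fun z hz => Prod.ext rfl (hv z.1 hz z.2)
  · have h1 : ContinuousOn (fun p : B × ℝ => (p.1, p.2 / f p.1)) (U ×ˢ univ) :=
      continuousOn_fst.prodMk (continuousOn_snd.div (hf.comp continuousOn_fst fun p hp => hp.1)
        fun p hp => hf0 p.1 hp.1)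
    refine (h.continuousOn_section.comp h1 fun p hp => ⟨hp.1, mem_univ _⟩).congr ?_
    rintro ⟨b, r⟩ ⟨hb, -⟩
    obtain ⟨x, rfl⟩ := (hbij b hb).2 r
    rw [coordSection_apply (hbij b hb).1, Function.comp_apply]
    change _ = coordSection v (b, v' b x / f b)
    rw [hv b hb, mul_div_cancel_left₀ _ (hf0 b hb), coordSection_apply (h.bijective b hb).1]

theorem exists_trivialization (h : IsCoordOn v U) :
    ∃ e : Trivialization ℝ (π ℝ E), e.IsLinear ℝ ∧ e.baseSet = U ∧
      ∀ z, e z = (z.1, v z.1 z.2) := by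
  let e : Trivialization ℝ (π ℝ E) :=
    { toFun := fun z => (z.1, v z.1 z.2)
      invFun := coordSection v
      source := π ℝ E ⁻¹' U
      target := U ×ˢ univ
      map_source' := fun z hz => ⟨hz, mem_univ _⟩
      map_target' := fun p hp => hp.1
      left_inv' := fun z hz => coordSection_eq (h.bijective _ hz).1
      right_inv' := fun p hp => Prod.ext rfl (apply_coordSection (h.bijective _ hp.1).2 p.2)
      open_source := h.isOpen_preimage
      open_target := h.isOpen.prod isOpen_univ
      continuousOn_toFun := h.continuousOn
      continuousOn_invFun := h.continuousOn_section
      baseSet := U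
      open_baseSet := h.isOpen
      source_eq := rfl
      target_eq := rfl
      proj_toFun := fun _ _ => rfl }
  exact ⟨e, ⟨fun b _ => (v b).isLinear⟩, rfl, fun _ => rfl⟩

theorem pullback (h : IsCoordOn v U) {B' : Type*} [TopologicalSpace B'] {f : B' → B}
    (hf : Continuous f) :
    IsCoordOn (E := f *ᵖ E) (fun b' => v (f b')) (f ⁻¹' U) := by
  have hproj : Continuous (π ℝ (f *ᵖ E)) := Pullback.continuous_proj ℝ E f
  have hlift : Continuous (Pullback.lift f : TotalSpace ℝ (f *ᵖ E) → TotalSpace ℝ E) :=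
    Pullback.continuous_lift ℝ E f
  refine ⟨h.isOpen.preimage hf, fun b hb => h.bijective _ hb,
    (h.isOpen.preimage hf).preimage hproj, ?_, ?_⟩
  · have h2 : ContinuousOn (fun z : TotalSpace ℝ (f *ᵖ E) => v (f z.1) z.2)
        (π ℝ (f *ᵖ E) ⁻¹' (f ⁻¹' U)) :=
      (continuous_snd.comp_continuousOn h.continuousOn).comp hlift.continuousOn fun z hz => hz
    exact hproj.continuousOn.prodMk h2
  · rw [(inducing_pullbackTotalSpaceEmbedding ℝ E f).continuousOn_iff]
    refine continuousOn_fst.prodMk ?_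
    have h1 : ContinuousOn (fun p : B' × ℝ => (f p.1, p.2)) ((f ⁻¹' U) ×ˢ univ) :=
      ((hf.comp continuous_fst).prodMk continuous_snd).continuousOn
    refine (h.continuousOn_section.comp h1 fun p hp => ⟨hp.1, mem_univ _⟩).congr fun p hp => rfl

/-- The transition function to an arbitrary trivialization; it is needed because the tensor bundle
is glued from all linear trivializations, not only from those of the form `v`. -/
theorem continuousAt_symm (h : IsCoordOn v U) (e : Trivialization ℝ (π ℝ E)) {b : B} (hbU : b ∈ U)
    (hb : b ∈ e.baseSet) : ContinuousAt (fun b => v b (e.symm b 1)) b := by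
  have h0 : ContinuousAt (fun z : B × ℝ => (⟨z.1, e.symm z.1 z.2⟩ : TotalSpace ℝ E)) (b, 1) :=
    e.continuousOn_symm.continuousAt ((e.open_baseSet.prod isOpen_univ).mem_nhds ⟨hb, mem_univ _⟩)
  have h1 : ContinuousAt (fun b => (⟨b, e.symm b 1⟩ : TotalSpace ℝ E)) b :=
    ContinuousAt.comp (f := fun b : B => (b, (1 : ℝ))) h0 (by fun_prop)
  exact ContinuousAt.comp (f := fun b => (⟨b, e.symm b 1⟩ : TotalSpace ℝ E))
    (g := fun z : TotalSpace ℝ E => v z.1 z.2)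
    ((continuous_snd.comp_continuousOn h.continuousOn).continuousAt
      (h.isOpen_preimage.mem_nhds hbU)) h1

/-- Criterion for coordinates on a space with a final topology. -/
theorem of_final {ι : Type*} {Z : ι → Type*} [∀ i, TopologicalSpace (Z i)]
    (c : ∀ i, Z i → TotalSpace ℝ E) (hopen : ∀ S, (∀ i, IsOpen (c i ⁻¹' S)) → IsOpen S)
    (hproj : ∀ i, Continuous fun z => (c i z).1) (hU : IsOpen U)
    (hbij : ∀ b ∈ U, Function.Bijective (v b))
    (hv : ∀ i z, (c i z).1 ∈ U → ContinuousAt (fun z => v (c i z).1 (c i z).2) z)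
    (hs : ∀ b ∈ U, ∃ W : Set B, IsOpen W ∧ b ∈ W ∧ W ⊆ U ∧ ∃ g : W × ℝ → TotalSpace ℝ E,
      Continuous g ∧ ∀ p, (g p).1 = p.1 ∧ v (g p).1 (g p).2 = p.2) :
    IsCoordOn v U := by
  have hpre : IsOpen (π ℝ E ⁻¹' U) := hopen _ fun i => hU.preimage (hproj i)
  refine ⟨hU, hbij, hpre, ?_, ?_⟩
  · rw [continuousOn_open_iff hpre]
    intro t ht
    refine hopen _ fun i => ?_
    have hc : ContinuousOn (fun z => ((c i z).1, v (c i z).1 (c i z).2)) (c i ⁻¹' (π ℝ E ⁻¹' U)) :=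
      fun z hz => ((hproj i).continuousAt.prodMk (hv i z hz)).continuousWithinAt
    exact hc.isOpen_inter_preimage (hU.preimage (hproj i)) ht
  · rintro ⟨b, r⟩ ⟨hb, -⟩
    obtain ⟨W, hW, hbW, hWU, g, hg, hgs⟩ := hs b hb
    have hemb : IsOpenEmbedding (Prod.map Subtype.val id : W × ℝ → B × ℝ) :=
      hW.isOpenEmbedding_subtypeVal.prodMap IsOpenEmbedding.id
    refine ContinuousAt.continuousWithinAt ((hemb.continuousAt_iff (x := (⟨b, hbW⟩, r))).1 ?_)
    -- Injectivity of `v` on fibers leaves only one section with the prescribed coordinate.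
    have : coordSection v ∘ (Prod.map Subtype.val id : W × ℝ → B × ℝ) = g := by
      ext1 p
      obtain ⟨h1, h2⟩ := hgs p
      have h3 := coordSection_eq (v := v) (z := g p) (hbij _ (h1 ▸ hWU p.1.2)).1
      exact (congrArg (coordSection v) (Prod.ext h1.symm h2.symm)).trans h3
    rw [this]
    exact hg.continuousAt

end IsCoordOn

theorem isLineBundle_of_isCoordOn
    (h : ∀ b : B, ∃ (U : Set B) (v : ∀ b, E b →ₗ[ℝ] ℝ), b ∈ U ∧ IsCoordOn v U) :
    IsLineBundle E := fun b => by
  obtain ⟨U, v, hb, h⟩ := h b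
  obtain ⟨e, he, hU, -⟩ := h.exists_trivialization
  exact ⟨e, he, hU ▸ hb⟩

/-- In the coordinates `v` and `v'` the bundle map is the identity of `U × ℝ`. -/
theorem continuous_of_isCoordOn {E' : B → Type*} [∀ b, AddCommMonoid (E' b)]
    [∀ b, Module ℝ (E' b)] [TopologicalSpace (TotalSpace ℝ E')] (F : ∀ b, E b → E' b)
    (h : ∀ b₀ : B, ∃ (U : Set B) (v : ∀ b, E b →ₗ[ℝ] ℝ) (v' : ∀ b, E' b →ₗ[ℝ] ℝ), b₀ ∈ U ∧
      IsCoordOn v U ∧ IsCoordOn v' U ∧ ∀ b ∈ U, ∀ x, v' b (F b x) = v b x) :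
    Continuous (fun z : TotalSpace ℝ E => (⟨z.1, F z.1 z.2⟩ : TotalSpace ℝ E')) := by
  rw [continuous_iff_continuousAt]
  intro z
  obtain ⟨U, v, v', hb, hv, hv', hF⟩ := h z.1
  have h1 : ContinuousOn (fun z : TotalSpace ℝ E => coordSection v' (z.1, v z.1 z.2))
      (π ℝ E ⁻¹' U) := hv'.continuousOn_section.comp hv.continuousOn fun z hz => ⟨hz, mem_univ _⟩
  have h2 : ContinuousOn (fun z : TotalSpace ℝ E => (⟨z.1, F z.1 z.2⟩ : TotalSpace ℝ E'))
      (π ℝ E ⁻¹' U) := h1.congr fun z hz => by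
    dsimp only
    rw [← hF z.1 hz, coordSection_apply (hv'.bijective _ hz).1]
  exact h2.continuousAt (hv.isOpen_preimage.mem_nhds hb)

theorem isHomeomorph_of_isCoordOn {E' : B → Type*} [∀ b, AddCommMonoid (E' b)]
    [∀ b, Module ℝ (E' b)] [TopologicalSpace (TotalSpace ℝ E')] (F : ∀ b, E b ≃ E' b)
    (h : ∀ b₀ : B, ∃ (U : Set B) (v : ∀ b, E b →ₗ[ℝ] ℝ) (v' : ∀ b, E' b →ₗ[ℝ] ℝ), b₀ ∈ U ∧
      IsCoordOn v U ∧ IsCoordOn v' U ∧ ∀ b ∈ U, ∀ x, v' b (F b x) = v b x) :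
    IsHomeomorph (fun z : TotalSpace ℝ E => (⟨z.1, F z.1 z.2⟩ : TotalSpace ℝ E')) := by
  let H : TotalSpace ℝ E ≃ₜ TotalSpace ℝ E' :=
    { toFun := fun z => ⟨z.1, F z.1 z.2⟩
      invFun := fun z => ⟨z.1, (F z.1).symm z.2⟩
      left_inv := fun z => by simp
      right_inv := fun z => by simp
      continuous_toFun := continuous_of_isCoordOn (fun b => F b) h
      continuous_invFun := continuous_of_isCoordOn (fun b => (F b).symm) fun b₀ => by
        obtain ⟨U, v, v', hb, hv, hv', hF⟩ := h b₀
        exact ⟨U, v', v, hb, hv', hv, fun b hb x => by rw [← hF b hb, Equiv.apply_symm_apply]⟩ }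
  exact H.isHomeomorph

end Coordinate

/-! ### Coordinates on tensor products of line bundles. -/

section TensorCoordinate

variable {B : Type*} {E₁ E₂ : B → Type*} [∀ b, AddCommMonoid (E₁ b)] [∀ b, Module ℝ (E₁ b)]
  [∀ b, AddCommMonoid (E₂ b)] [∀ b, Module ℝ (E₂ b)]

/-- The tensor product of linear forms on the fibers. -/
def tensorCoord (v₁ : ∀ b, E₁ b →ₗ[ℝ] ℝ) (v₂ : ∀ b, E₂ b →ₗ[ℝ] ℝ) (b : B) :
    TensorBundle E₁ E₂ b →ₗ[ℝ] ℝ :=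
  ((TensorProduct.lid ℝ ℝ).toLinearMap ∘ₗ TensorProduct.map (v₁ b) (v₂ b) :
    E₁ b ⊗[ℝ] E₂ b →ₗ[ℝ] ℝ)

theorem tensorCoord_tmul (v₁ : ∀ b, E₁ b →ₗ[ℝ] ℝ) (v₂ : ∀ b, E₂ b →ₗ[ℝ] ℝ) (b : B) (r : ℝ)
    (x : E₁ b) (y : E₂ b) :
    tensorCoord v₁ v₂ b (r • x ⊗ₜ[ℝ] y : E₁ b ⊗[ℝ] E₂ b) = r * (v₁ b x * v₂ b y) := by
  change ((TensorProduct.lid ℝ ℝ).toLinearMap ∘ₗ TensorProduct.map (v₁ b) (v₂ b)) _ = _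
  simp

theorem tensorCoord_bijective {v₁ : ∀ b, E₁ b →ₗ[ℝ] ℝ} {v₂ : ∀ b, E₂ b →ₗ[ℝ] ℝ} {b : B}
    (h₁ : Function.Bijective (v₁ b)) (h₂ : Function.Bijective (v₂ b)) :
    Function.Bijective (tensorCoord v₁ v₂ b) :=
  (TensorProduct.congr (LinearEquiv.ofBijective _ h₁) (LinearEquiv.ofBijective _ h₂) ≪≫ₗ
    TensorProduct.lid ℝ ℝ).bijective

variable [TopologicalSpace B] [TopologicalSpace (TotalSpace ℝ E₁)]
  [TopologicalSpace (TotalSpace ℝ E₂)]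

/-- Along a product chart the coordinate is `r` times two transition functions. Along the chart
built from the trivializations of `v₁` and `v₂` themselves both functions are `1`, so that chart is
the continuous section. -/
theorem IsCoordOn.tensor {v₁ : ∀ b, E₁ b →ₗ[ℝ] ℝ} {v₂ : ∀ b, E₂ b →ₗ[ℝ] ℝ} {U : Set B}
    (h₁ : IsCoordOn v₁ U) (h₂ : IsCoordOn v₂ U) : IsCoordOn (tensorCoord v₁ v₂) U := by
  let ι := {e : Trivialization ℝ (π ℝ E₁) // e.IsLinear ℝ} ×
    {e : Trivialization ℝ (π ℝ E₂) // e.IsLinear ℝ}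
  have hc : ∀ i : ι, Continuous (tensorChart i.1.1 i.2.1) := fun i => by
    rw [continuous_iff_coinduced_le]
    exact le_iSup_of_le i.1 (le_iSup_of_le i.2 le_rfl)
  refine IsCoordOn.of_final (fun i : ι => tensorChart i.1.1 i.2.1) (fun S hS => ?_)
    (fun i => continuous_subtype_val.comp continuous_fst) h₁.isOpen
    (fun b hb => tensorCoord_bijective (h₁.bijective b hb) (h₂.bijective b hb)) ?_ ?_
  · refine isOpen_iSup_iff.2 fun e₁ => isOpen_iSup_iff.2 fun e₂ => ?_
    exact isOpen_coinduced.2 (hS (e₁, e₂))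
  · rintro ⟨⟨e₁, he₁⟩, ⟨e₂, he₂⟩⟩ z hbU
    have k₁ := h₁.continuousAt_symm e₁ hbU z.1.2.1
    have k₂ := h₂.continuousAt_symm e₂ hbU z.1.2.2
    have hp : ContinuousAt (fun z : ↥(e₁.baseSet ∩ e₂.baseSet) × ℝ => (z.1 : B))
        z := (continuous_subtype_val.comp continuous_fst).continuousAt
    have k₃ := ContinuousAt.comp (x := z) (g := fun b => v₁ b (e₁.symm b 1)) k₁ hp
    have k₄ := ContinuousAt.comp (x := z) (g := fun b => v₂ b (e₂.symm b 1)) k₂ hp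
    have h3 := continuousAt_snd.mul (k₃.mul k₄)
    exact h3.congr (Filter.Eventually.of_forall fun z => (tensorCoord_tmul _ _ _ _ _ _).symm)
  · intro b hb
    obtain ⟨e₁, he₁, hU₁, hev₁⟩ := h₁.exists_trivialization
    obtain ⟨e₂, he₂, hU₂, hev₂⟩ := h₂.exists_trivialization
    have hsym₁ : ∀ b ∈ U, v₁ b (e₁.symm b 1) = 1 := fun b hb => by
      have := e₁.apply_mk_symm (hU₁.symm ▸ hb) 1
      rw [hev₁] at this
      exact congrArg Prod.snd this
    have hsym₂ : ∀ b ∈ U, v₂ b (e₂.symm b 1) = 1 := fun b hb => by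
      have := e₂.apply_mk_symm (hU₂.symm ▸ hb) 1
      rw [hev₂] at this
      exact congrArg Prod.snd this
    have hUU : e₁.baseSet ∩ e₂.baseSet = U := by rw [hU₁, hU₂, inter_self]
    refine ⟨e₁.baseSet ∩ e₂.baseSet, hUU ▸ h₁.isOpen, hUU ▸ hb, hUU.le,
      tensorChart e₁ e₂, hc (⟨e₁, he₁⟩, ⟨e₂, he₂⟩), fun p => ⟨rfl, ?_⟩⟩
    have hp : (p.1 : B) ∈ U := hUU.le p.1.2
    refine (tensorCoord_tmul _ _ _ _ _ _).trans ?_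
    have := congrArg₂ (· * ·) (hsym₁ _ hp) (hsym₂ _ hp)
    rw [mul_one] at this
    exact (congrArg (p.2 * ·) this).trans (mul_one _)

end TensorCoordinate

/-! ### Continuity of inversion and completion to isomorphisms. -/

section ContinuityOfInverse

variable {A : Type*} [TopologicalSpace A] {X Y Z : Type*}
  [NormedAddCommGroup X] [NormedSpace ℝ X] [NormedAddCommGroup Y] [NormedSpace ℝ Y]
  [NormedAddCommGroup Z] [NormedSpace ℝ Z]

theorem continuous_clm_prod : Continuous fun p : (X →L[ℝ] Y) × (X →L[ℝ] Z) => p.1.prod p.2 := by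
  have : (fun p : (X →L[ℝ] Y) × (X →L[ℝ] Z) => p.1.prod p.2) = fun p =>
      ContinuousLinearMap.inl ℝ Y Z ∘L p.1 + ContinuousLinearMap.inr ℝ Y Z ∘L p.2 := by
    ext p x <;> simp
  rw [this]
  exact (continuous_const.clm_comp continuous_fst).add (continuous_const.clm_comp continuous_snd)

theorem continuous_clm_coprod :
    Continuous fun p : (X →L[ℝ] Z) × (Y →L[ℝ] Z) => p.1.coprod p.2 := by
  have : (fun p : (X →L[ℝ] Z) × (Y →L[ℝ] Z) => p.1.coprod p.2) = fun p =>
      p.1 ∘L ContinuousLinearMap.fst ℝ X Y + p.2 ∘L ContinuousLinearMap.snd ℝ X Y := by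
    ext p x <;> simp
  rw [this]
  exact (continuous_fst.clm_comp continuous_const).add (continuous_snd.clm_comp continuous_const)

theorem continuousAt_inverse [CompleteSpace X] {f : A → X →L[ℝ] Y} {a : A}
    (hf : ContinuousAt f a) (h : (f a).IsInvertible) : ContinuousAt (fun a => (f a).inverse) a :=
  ContinuousAt.comp (g := ContinuousLinearMap.inverse)
    (h.contDiffAt_map_inverse (n := 0)).continuousAt hf

theorem isOpen_isInvertible [CompleteSpace X] {f : A → X →L[ℝ] Y} (hf : Continuous f) :
    IsOpen {a | (f a).IsInvertible} :=
  (ContinuousLinearEquiv.isOpen (𝕜 := ℝ) (E := X) (F := Y)).preimage hf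

theorem continuous_stab {N : ℕ} {Θ : A → (Fin N → ℝ) →L[ℝ] Y} {D : A → Fred X Y}
    (hΘ : Continuous Θ) (hD : Continuous D) : Continuous fun a => stab (Θ a) (D a) :=
  (continuous_clm_coprod.comp ((continuous_subtype_val.comp hD).prodMk hΘ)).subtype_mk _

theorem continuous_stab_prod {N M : ℕ} {Θ : A → (Fin N → ℝ) →L[ℝ] Y} {D : A → Fred X Y}
    {P : A → X × (Fin N → ℝ) →L[ℝ] (Fin M → ℝ)}
    (hΘ : Continuous Θ) (hD : Continuous D) (hP : Continuous P) :
    Continuous fun a => (stab (Θ a) (D a)).1.prod (P a) :=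
  continuous_clm_prod.comp ((continuous_subtype_val.comp (continuous_stab hΘ hD)).prodMk hP)

/-- A surjective Fredholm operator can be completed to an isomorphism by a map which factors
through a given injection. -/
theorem exists_isInvertible_prod_comp [CompleteSpace X] [CompleteSpace Y] (E : Fred X Y)
    (hE : Function.Surjective E.1) {Z : Type*} [NormedAddCommGroup Z] [NormedSpace ℝ Z]
    (f : X →L[ℝ] Z) (hf : Function.Injective f) {M : ℕ} (hM : finrank ℝ E.Ker = M) :
    ∃ P : Z →L[ℝ] (Fin M → ℝ), (E.1.prod (P ∘L f)).IsInvertible := by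
  let l : E.Ker →ₗ[ℝ] Z := (f : X →ₗ[ℝ] Z) ∘ₗ Submodule.subtype _
  have hl : Function.Injective l := hf.comp Subtype.val_injective
  -- The image of the kernel in `Z` is finite-dimensional, hence complemented; a bounded projection
  -- extends the kernel coordinates to all of `Z`.
  obtain ⟨g, hg⟩ := Submodule.ClosedComplemented.of_finiteDimensional (LinearMap.range l)
  let e : E.Ker ≃ₗ[ℝ] LinearMap.range l := LinearEquiv.ofInjective l hl
  let b := finBasisOfFinrankEq ℝ E.Ker hM
  refine ⟨LinearMap.toContinuousLinearMap (e.symm ≪≫ₗ b.equivFun).toLinearMap ∘L g,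
    isInvertible_prod hE ?_⟩
  have : (kerRestrict ((LinearMap.toContinuousLinearMap
      (e.symm ≪≫ₗ b.equivFun).toLinearMap ∘L g) ∘L f) E : E.Ker → (Fin M → ℝ)) = b.equivFun := by
    ext1 x
    change b.equivFun (e.symm (g (e x : Z))) = b.equivFun x
    rw [hg, LinearEquiv.symm_apply_apply]
  rw [this]
  exact b.equivFun.bijective

/-- A surjective Fredholm operator can be completed to an isomorphism. -/
theorem exists_isInvertible_prod [CompleteSpace X] [CompleteSpace Y] (E : Fred X Y)
    (hE : Function.Surjective E.1) {M : ℕ} (hM : finrank ℝ E.Ker = M) :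
    ∃ P : X →L[ℝ] (Fin M → ℝ), (E.1.prod P).IsInvertible :=
  exists_isInvertible_prod_comp E hE (ContinuousLinearMap.id ℝ X) Function.injective_id hM

end ContinuityOfInverse

/-! ### The determinant line bundle over surjective operators. -/

section SurjectiveCoordinate

variable {X Y : Type*} [NormedAddCommGroup X] [NormedSpace ℝ X]
  [NormedAddCommGroup Y] [NormedSpace ℝ Y] {M : ℕ}

/-- The coordinates `X → ℝ^M` defined by a right inverse `T` of `D` and a basis of `κ(D)`. -/
def chartCoord (D : FredSurj X Y) (T : Y →L[ℝ] X) (hT : ∀ y, D.1.1 (T y) = y)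
    (b : Basis (Fin M) ℝ D.1.Ker) : X →L[ℝ] (Fin M → ℝ) :=
  LinearMap.toContinuousLinearMap (b.equivFun : D.1.Ker →ₗ[ℝ] (Fin M → ℝ)) ∘L
    (ContinuousLinearMap.id ℝ X - T ∘L D.1.1).codRestrict (LinearMap.ker (D.1.1 : X →ₗ[ℝ] Y))
      fun x => by
        change D.1.1 (x - T (D.1.1 x)) = 0
        rw [map_sub, hT, sub_self]

variable (D : FredSurj X Y) (T : Y →L[ℝ] X) (hT : ∀ y, D.1.1 (T y) = y)
  (b : Basis (Fin M) ℝ D.1.Ker)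

theorem kerRestrict_chartCoord (E : FredSurj X Y) :
    kerRestrict (chartCoord D T hT b) E.1 =
      (b.equivFun : D.1.Ker →ₗ[ℝ] (Fin M → ℝ)) ∘ₗ D.phi T hT E := rfl

theorem kerRestrict_chartCoord_self :
    kerRestrict (chartCoord D T hT b) D.1 = (b.equivFun : D.1.Ker →ₗ[ℝ] (Fin M → ℝ)) := by
  rw [kerRestrict_chartCoord]
  ext1 x
  refine congrArg b.equivFun (Subtype.ext ?_)
  change x.1 - T (D.1.1 x.1) = x.1
  rw [show D.1.1 x.1 = 0 from x.2, map_zero, sub_zero]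

/-- The domain of a defining trivialization is thus the invertibility locus of `(E, P)` for a
particular `P`, which links the glued topology to the coordinates `sval`. -/
theorem isInvertible_chartCoord_iff [CompleteSpace X] [CompleteSpace Y] (E : FredSurj X Y) :
    (E.1.1.prod (chartCoord D T hT b)).IsInvertible ↔ Function.Bijective (D.phi T hT E) := by
  have h : Function.Bijective (kerRestrict (chartCoord D T hT b) E.1) ↔
      Function.Bijective (D.phi T hT E) := by
    rw [kerRestrict_chartCoord]
    exact b.equivFun.comp_bijective _
  rw [← h]
  exact ⟨kerRestrict_bijective, isInvertible_prod E.2⟩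

theorem congr_unitTop {C C' : Type*} [AddCommGroup C] [Module ℝ C] [AddCommGroup C'] [Module ℝ C']
    [Subsingleton C] [Subsingleton C'] (e : C ≃ₗ[ℝ] C') :
    TopExt.congr e (unitTop C) = unitTop C' := by
  rw [unitTop_eq_vol rfl Fin.elim0 (finrank_zero_of_subsingleton (R := ℝ) (M := C)).symm,
    TopExt.congr_vol, ← unitTop_eq_vol rfl]

/-- In the coordinate `chartCoord`, the trivialization `FredSurj.chart` is constant. -/
theorem sval_chart (p : {E : FredSurj X Y // Function.Bijective (D.phi T hT E)} × Det X Y D.1) :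
    sval (chartCoord D T hT b) p.1.1.1 (D.chart T hT p).2 = sval (chartCoord D T hT b) D.1 p.2 := by
  obtain ⟨⟨E, hE⟩, σ⟩ := p
  have := D.subsingleton_coker
  have := E.subsingleton_coker
  obtain ⟨x, hx⟩ := exists_ne_zero_topExt D.1.Ker
  obtain ⟨α, hα⟩ := exists_dual_eq_one (unitTop_ne_zero (C := D.1.Coker))
  have hne : (Det.mk x α : Det X Y D.1) ≠ 0 := DetLine.mk_ne_zero hx (by rintro rfl; simp at hα)
  obtain ⟨c, rfl⟩ := exists_smul_line (finrank_det D.1) hne σ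
  have hc : (D.chart T hT (⟨E, hE⟩, c • Det.mk x α)).2 = (c • Det.mk
      (TopExt.congr (LinearEquiv.ofBijective (D.phi T hT E) hE).symm x)
      ((TopExt.congr (D.cokerEquiv E)).symm.dualMap α) : Det X Y E.1) :=
    map_smul (DetLine.congr (LinearEquiv.ofBijective (D.phi T hT E) hE).symm (D.cokerEquiv E)) c
      (DetLine.mk x α)
  have hu : (TopExt.congr (D.cokerEquiv E)).symm (unitTop E.1.Coker) = unitTop D.1.Coker := by
    rw [LinearEquiv.symm_apply_eq, congr_unitTop]
  refine (congrArg (sval (chartCoord D T hT b) E.1) hc).trans ?_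
  rw [map_smul, map_smul, sval_mk, sval_mk, hα, LinearEquiv.dualMap_apply, hu, hα, TopExt.coe_congr,
    detForm_map, kerRestrict_chartCoord_self, kerRestrict_chartCoord, LinearMap.comp_assoc]
  congr 4
  ext1 y
  exact congrArg b.equivFun ((LinearEquiv.ofBijective (D.phi T hT E) hE).apply_symm_apply y)

theorem continuous_chart : @Continuous _ _ (@instTopologicalSpaceProd _ _ inferInstance
    (moduleTopology ℝ (Det X Y D.1))) _ (D.chart T hT) := by
  rw [continuous_iff_coinduced_le]
  exact le_iSup_of_le D (le_iSup_of_le T (le_iSup_of_le hT le_rfl))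

theorem isCoordOn_sval [CompleteSpace X] [CompleteSpace Y] (P : X →L[ℝ] (Fin M → ℝ)) :
    IsCoordOn (E := DetSurj X Y) (fun E => sval P E.1) {E | (E.1.1.prod P).IsInvertible} := by
  let _ : ∀ D : Fred X Y, TopologicalSpace (Det X Y D) := fun D => moduleTopology ℝ (Det X Y D)
  have : ∀ D : Fred X Y, IsModuleTopology ℝ (Det X Y D) := fun D => ⟨rfl⟩
  have : ∀ D : Fred X Y, ContinuousSMul ℝ (Det X Y D) := fun D =>
    ModuleTopology.continuousSMul ℝ (Det X Y D)
  have hval : Continuous fun E : FredSurj X Y => E.1.1 :=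
    continuous_subtype_val.comp continuous_subtype_val
  have hprod : ∀ P' : X →L[ℝ] (Fin M → ℝ), Continuous fun E : FredSurj X Y => E.1.1.prod P' :=
    fun P' => continuous_clm_prod.comp (hval.prodMk continuous_const)
  let ι := {p : FredSurj X Y × (Y →L[ℝ] X) // ∀ y, p.1.1.1 (p.2 y) = y}
  refine IsCoordOn.of_final (ι := ι)
    (Z := fun i => {E : FredSurj X Y // Function.Bijective (i.1.1.phi i.1.2 i.2 E)} ×
      Det X Y i.1.1.1)
    (fun i => i.1.1.chart i.1.2 i.2) (fun S hS => ?_)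
    (fun i => continuous_subtype_val.comp continuous_fst) (isOpen_isInvertible (hprod P))
    (fun E hE => sval_bijective hE) ?_ ?_
  · refine isOpen_iSup_iff.2 fun D => isOpen_iSup_iff.2 fun T => isOpen_iSup_iff.2 fun hT => ?_
    exact isOpen_coinduced.2 (hS ⟨(D, T), hT⟩)
  · rintro ⟨⟨D, T⟩, hT⟩ z hz
    have hM : finrank ℝ D.1.Ker = M := by
      rw [← (LinearEquiv.ofBijective _ z.1.2).finrank_eq]
      exact finrank_ker_of_prod hz
    let b := finBasisOfFinrankEq ℝ D.1.Ker hM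
    have hinv : ∀ w : {E : FredSurj X Y // Function.Bijective (D.phi T hT E)} × Det X Y D.1,
        (w.1.1.1.1.prod (chartCoord D T hT b)).IsInvertible := fun w =>
      (isInvertible_chartCoord_iff D T hT b w.1.1).2 w.1.2
    have hfst : Continuous fun w : {E : FredSurj X Y // Function.Bijective (D.phi T hT E)} ×
        Det X Y D.1 => w.1.1 := continuous_subtype_val.comp continuous_fst
    -- Along the chart of `D` and `T`, the coordinate is a determinant continuous in the operator
    -- times a fixed linear form on `λ(D)`.
    have hcont : ContinuousAt
        (fun w : {E : FredSurj X Y // Function.Bijective (D.phi T hT E)} × Det X Y D.1 =>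
          Matrix.det (Matrix.of fun i => P ((w.1.1.1.1.prod (chartCoord D T hT b)).inverse
            (0, Pi.single i 1))) * sval (chartCoord D T hT b) D.1 w.2) z := by
      refine ContinuousAt.mul ?_ ?_
      · refine (Continuous.matrix_det continuous_id).continuousAt.comp
          (continuousAt_pi.2 fun i => ?_)
        refine P.continuous.continuousAt.comp ?_
        exact (continuousAt_inverse ((hprod _).comp hfst).continuousAt (hinv z)).clm_apply
          continuousAt_const
      · exact ((IsModuleTopology.continuous_of_linearMap
          (sval (chartCoord D T hT b) D.1)).comp continuous_snd).continuousAt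
    refine hcont.congr (Eventually.of_forall fun w => ?_)
    dsimp only
    rw [← sval_chart]
    exact (sval_eq_det_mul (hinv w) P _).symm
  · intro D hD
    -- The right inverse with values in the kernel of `P`, together with the basis dual to `P`,
    -- makes `chartCoord` equal to `P`; this single chart is then a section over the whole open set.
    let T : Y →L[ℝ] X := (D.1.1.prod P).inverse ∘L ContinuousLinearMap.inl ℝ Y (Fin M → ℝ)
    have hT : ∀ y, D.1.1 (T y) = y := fun y => (apply_inverse_prod hD (y, 0)).1
    let b : Basis (Fin M) ℝ D.1.Ker :=
      Basis.ofEquivFun (LinearEquiv.ofBijective _ (kerRestrict_bijective hD))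
    have hb : chartCoord D T hT b = P := by
      ext1 x
      have : chartCoord D T hT b x = P (x - T (D.1.1 x)) := by
        change b.equivFun _ = _
        rw [Basis.equivFun_ofEquivFun]
        rfl
      rw [this, map_sub, show P (T (D.1.1 x)) = 0 from (apply_inverse_prod hD (D.1.1 x, 0)).2,
        sub_zero]
    obtain ⟨σ, hσ⟩ := (sval_bijective hD).2 1
    have hbij : ∀ E : FredSurj X Y, (E.1.1.prod P).IsInvertible →
        Function.Bijective (D.phi T hT E) := fun E hE =>
      (isInvertible_chartCoord_iff D T hT b E).1 (hb.symm ▸ hE)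
    refine ⟨_, isOpen_isInvertible (hprod P), hD, le_rfl,
      fun p => D.chart T hT (⟨p.1.1, hbij _ p.1.2⟩, p.2 • σ), ?_, fun p => ⟨rfl, ?_⟩⟩
    · refine (continuous_chart D T hT).comp (Continuous.prodMk ?_ ?_)
      · exact (continuous_subtype_val.comp continuous_fst).subtype_mk _
      · exact continuous_snd.smul continuous_const
    · have := sval_chart D T hT b (⟨p.1.1, hbij _ p.1.2⟩, p.2 • σ)
      rw [hb, map_smul, hσ, smul_eq_mul, mul_one] at this
      exact this

end SurjectiveCoordinate

/-! ### The determinant line bundle over all Fredholm operators. -/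

section DetCoordinate

variable {A : Type*} [TopologicalSpace A] {X Y : Type*}
  [NormedAddCommGroup X] [NormedSpace ℝ X] [NormedAddCommGroup Y] [NormedSpace ℝ Y]
  {M N M₁ M₂ N₁ N₂ : ℕ}

theorem continuousAt_glueCoord {X : Type*} [NormedAddCommGroup X] [NormedSpace ℝ X]
    {P' : A → X →L[ℝ] (Fin M → ℝ)} {P'' : A → X →L[ℝ] (Fin N → ℝ)} {a : A}
    (hP' : ContinuousAt P' a) (hP'' : ContinuousAt P'' a) :
    ContinuousAt (fun a => glueCoord M N (P' a) (P'' a)) a :=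
  (continuousAt_const.clm_comp hP').add (continuousAt_const.clm_comp hP'')

theorem continuousAt_det_changeMatrix (hQ : M₂ + N₁ = M₁ + N₂)
    {G : A → Y × (Fin M₁ → ℝ) →L[ℝ] X × (Fin N₁ → ℝ)} {Θ : A → (Fin N₂ → ℝ) →L[ℝ] Y}
    {P : A → X × (Fin N₂ → ℝ) →L[ℝ] (Fin M₂ → ℝ)} {a : A} (hG : ContinuousAt G a)
    (hΘ : ContinuousAt Θ a) (hP : ContinuousAt P a) :
    ContinuousAt (fun a => (changeMatrix hQ (G a) (Θ a) (P a)).det) a := by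
  refine (Continuous.matrix_det continuous_id).continuousAt.comp (continuousAt_pi.2 fun i => ?_)
  change ContinuousAt (fun a =>
    twofoldCoord N₁ (P a) (stabFamily (G a) (Θ a) (Fin.cast hQ i))) a
  refine ContinuousAt.clm_apply
    (continuousAt_glueCoord (hP.clm_comp continuousAt_const) continuousAt_const) ?_
  generalize Fin.cast hQ i = k
  refine Fin.addCases (fun k => ?_) (fun k => ?_) k
  · simp only [stabFamily, Fin.append_left]
    exact (hG.clm_apply continuousAt_const).prodMk continuousAt_const
  · simp only [stabFamily, Fin.append_right]
    exact (hG.clm_apply ((hΘ.clm_apply continuousAt_const).prodMk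
      continuousAt_const)).neg.prodMk continuousAt_const

theorem continuous_stabSurj (Θ : (Fin N → ℝ) →L[ℝ] Y) :
    Continuous (stabSurj (X := X) Θ) :=
  (continuous_stab continuous_const continuous_subtype_val).subtype_mk _

theorem continuous_stabChart (Θ : (Fin N → ℝ) →L[ℝ] Y) : Continuous (stabChart (X := X) Θ) := by
  rw [continuous_iff_coinduced_le]
  exact le_iSup_of_le N (le_iSup_of_le Θ le_rfl)

theorem val_stabChart {P : X × (Fin N → ℝ) →L[ℝ] (Fin M → ℝ)} {Θ : (Fin N → ℝ) →L[ℝ] Y}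
    (z : TotalSpace ℝ (stabSurj (X := X) Θ *ᵖ (DetSurj (X × (Fin N → ℝ)) Y))) :
    val Θ P z.1.1 (stabChart Θ z).2 = sval P (stab Θ z.1.1) z.2 :=
  congrArg (sval P (stab Θ z.1.1)) ((stabIso Θ z.1.1).apply_symm_apply z.2)

/-- A Fredholm operator becomes surjective after a finite stabilization. -/
theorem exists_stab_surjective (D : Fred X Y) :
    ∃ Θ : (Fin (finrank ℝ D.Coker) → ℝ) →L[ℝ] Y, Function.Surjective (stab Θ D).1 := by
  let b := finBasis ℝ D.Coker
  obtain ⟨s, hs⟩ := (LinearMap.range (D.1 : X →ₗ[ℝ] Y)).mkQ.exists_rightInverse_of_surjective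
    (Submodule.range_mkQ _)
  refine ⟨LinearMap.toContinuousLinearMap (s ∘ₗ (b.equivFun.symm : _ →ₗ[ℝ] D.Coker)), fun y => ?_⟩
  let u := b.equivFun (Submodule.Quotient.mk y)
  have h : (Submodule.Quotient.mk (s (Submodule.Quotient.mk y)) : D.Coker) =
    Submodule.Quotient.mk y := LinearMap.congr_fun hs _
  obtain ⟨x, hx⟩ := (Submodule.Quotient.eq _).1 h.symm
  refine ⟨(x, u), ?_⟩
  have hu : LinearMap.toContinuousLinearMap (s ∘ₗ (b.equivFun.symm : _ →ₗ[ℝ] D.Coker)) u =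
      s (Submodule.Quotient.mk y) := by
    change s (b.equivFun.symm (b.equivFun (Submodule.Quotient.mk y))) = _
    rw [LinearEquiv.symm_apply_apply]
  rw [stab_apply]
  change D.1 x + LinearMap.toContinuousLinearMap (s ∘ₗ (b.equivFun.symm : _ →ₗ[ℝ] D.Coker)) u = y
  rw [hu]
  change D.1 x = _ at hx
  rw [hx, sub_add_cancel]

variable [CompleteSpace X] [CompleteSpace Y]

/-- The topology is glued from all stabilizations, so the coordinate must be continuous along the
chart of every other `Θ₁`; there `val_change` expresses it through `sval`. The section comes from
the chart of `Θ` itself. -/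
theorem isCoordOn_val (Θ : (Fin N → ℝ) →L[ℝ] Y) (P : X × (Fin N → ℝ) →L[ℝ] (Fin M → ℝ)) :
    IsCoordOn (E := Det X Y) (fun D => val Θ P D) {D | ((stab Θ D).1.prod P).IsInvertible} := by
  have hopen : ∀ {N M : ℕ} (Θ : (Fin N → ℝ) →L[ℝ] Y) (P : X × (Fin N → ℝ) →L[ℝ] (Fin M → ℝ)),
      IsOpen {D : Fred X Y | ((stab Θ D).1.prod P).IsInvertible} := fun Θ P =>
    isOpen_isInvertible (continuous_stab_prod continuous_const continuous_id continuous_const)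
  refine IsCoordOn.of_final (ι := Σ N : ℕ, (Fin N → ℝ) →L[ℝ] Y)
    (Z := fun i => TotalSpace ℝ (stabSurj (X := X) i.2 *ᵖ (DetSurj (X × (Fin i.1 → ℝ)) Y)))
    (fun i => stabChart i.2) (fun S hS => ?_)
    (fun i => continuous_subtype_val.comp (Pullback.continuous_proj ℝ _ _)) (hopen Θ P)
    (fun D hD => val_bijective hD) ?_ ?_
  · refine isOpen_iSup_iff.2 fun N => isOpen_iSup_iff.2 fun Θ => ?_
    exact isOpen_coinduced.2 (hS ⟨N, Θ⟩)
  · rintro ⟨N₁, Θ₁⟩ z (hz : ((stab Θ z.1.1).1.prod P).IsInvertible)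
    obtain ⟨P₁, hP₁⟩ := exists_isInvertible_prod (stab Θ₁ z.1.1) z.1.2 rfl
    have hQ := change_dim hP₁ hz
    have hproj : Continuous fun w : TotalSpace ℝ (stabSurj (X := X) Θ₁ *ᵖ
        (DetSurj (X × (Fin N₁ → ℝ)) Y)) => w.1.1 :=
      continuous_subtype_val.comp (Pullback.continuous_proj ℝ _ _)
    have hw := (isCoordOn_sval P₁).pullback (continuous_stabSurj (X := X) Θ₁)
    have h1 : ContinuousAt (fun w : TotalSpace ℝ (stabSurj (X := X) Θ₁ *ᵖ
        (DetSurj (X × (Fin N₁ → ℝ)) Y)) => sval P₁ (stab Θ₁ w.1.1) w.2) z :=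
      (continuous_snd.comp_continuousOn hw.continuousOn).continuousAt
        (hw.isOpen_preimage.mem_nhds hP₁)
    have h2 : ContinuousAt (fun w : TotalSpace ℝ (stabSurj (X := X) Θ₁ *ᵖ
        (DetSurj (X × (Fin N₁ → ℝ)) Y)) => ((stab Θ₁ w.1.1).1.prod P₁).inverse) z :=
      continuousAt_inverse
        (continuous_stab_prod continuous_const hproj continuous_const).continuousAt hP₁
    have h3 := (continuousAt_const (y := changeConst N₁ N)).mul
      (continuousAt_det_changeMatrix hQ h2 continuousAt_const continuousAt_const
        (Θ := fun _ => Θ) (P := fun _ => P)) |>.mul h1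
    refine h3.congr ?_
    filter_upwards [((hopen Θ P).preimage hproj).mem_nhds hz,
      ((hopen Θ₁ P₁).preimage hproj).mem_nhds hP₁] with w hw₁ hw₂
    exact ((val_change hw₂ hw₁ hQ _).trans (congrArg (_ * ·) (val_stabChart w))).symm
  · intro D hD
    have hw := (isCoordOn_sval P).pullback (continuous_stabSurj (X := X) Θ)
    refine ⟨_, hopen Θ P, hD, le_rfl, fun p => stabChart Θ (coordSection
      (E := stabSurj (X := X) Θ *ᵖ (DetSurj (X × (Fin N → ℝ)) Y))
      (fun D => sval P (stabSurj Θ D).1) (⟨p.1.1, surjective_of_prod p.1.2⟩, p.2)), ?_,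
      fun p => ⟨rfl, ?_⟩⟩
    · refine (continuous_stabChart Θ).comp (hw.continuousOn_section.comp_continuous
        (Continuous.prodMk ?_ continuous_snd) fun p => ⟨p.1.2, mem_univ _⟩)
      exact (continuous_subtype_val.comp continuous_fst).subtype_mk _
    · refine (val_stabChart _).trans ?_
      exact apply_coordSection (E := stabSurj (X := X) Θ *ᵖ (DetSurj (X × (Fin N → ℝ)) Y))
        (v := fun D => sval P (stabSurj Θ D).1)
        (hw.bijective ⟨p.1.1, surjective_of_prod p.1.2⟩ p.1.2).2 p.2

/-- Coordinates on a family of determinant lines, from a continuous family of stabilizations. -/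
theorem isCoordOn_val_family {D : A → Fred X Y} {Θ : A → (Fin N → ℝ) →L[ℝ] Y}
    {P : A → X × (Fin N → ℝ) →L[ℝ] (Fin M → ℝ)} (hD : Continuous D) (hΘ : Continuous Θ)
    (hP : Continuous P) {a₀ : A} (h₀ : ((stab (Θ a₀) (D a₀)).1.prod (P a₀)).IsInvertible) :
    ∃ U, a₀ ∈ U ∧ (∀ a ∈ U, ((stab (Θ a) (D a)).1.prod (P a)).IsInvertible) ∧
      IsCoordOn (E := D *ᵖ (Det X Y)) (fun a => val (Θ a) (P a) (D a)) U := by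
  -- The data frozen at `a₀` give a coordinate by pullback; passing to the varying data multiplies
  -- it by the factor of `val_change`.
  have h1 := (isCoordOn_val (Θ a₀) (P a₀)).pullback hD
  have ho : IsOpen {a | ((stab (Θ a) (D a)).1.prod (P a)).IsInvertible} :=
    isOpen_isInvertible (continuous_stab_prod hΘ hD hP)
  refine ⟨_ ∩ {a | ((stab (Θ a) (D a)).1.prod (P a)).IsInvertible}, ⟨h₀, h₀⟩, fun a ha => ha.2,
    (h1.mono (h1.isOpen.inter ho) inter_subset_left).smul
    (f := fun a => changeConst N N *
      (changeMatrix rfl ((stab (Θ a₀) (D a)).1.prod (P a₀)).inverse (Θ a) (P a)).det) ?_ ?_ ?_⟩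
  · intro a ha
    refine ContinuousAt.continuousWithinAt (continuousAt_const.mul
      (continuousAt_det_changeMatrix rfl ?_ hΘ.continuousAt hP.continuousAt))
    exact continuousAt_inverse
      (continuous_stab_prod continuous_const hD continuous_const).continuousAt ha.1
  -- The factor cannot vanish, since it relates two bijective linear forms.
  · rintro a ⟨ha₁, ha₂⟩ h0
    obtain ⟨σ, hσ⟩ := (val_bijective ha₂).2 1
    have := val_change ha₁ ha₂ rfl σ
    rw [hσ, h0, zero_mul] at this
    exact one_ne_zero this
  · rintro a ⟨ha₁, ha₂⟩ σ
    exact val_change ha₁ ha₂ rfl σ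

theorem isLineBundle_det : IsLineBundle (Det X Y) := isLineBundle_of_isCoordOn fun D => by
  obtain ⟨Θ, hΘ⟩ := exists_stab_surjective D
  obtain ⟨P, hP⟩ := exists_isInvertible_prod (stab Θ D) hΘ rfl
  exact ⟨_, _, hP, isCoordOn_val Θ P⟩

end DetCoordinate

/-! ### Invertibility and index in exact triples. -/

section ExactTripleCoordinates

variable {X Y X' Y' X'' Y'' : Type*}
  [NormedAddCommGroup X] [NormedSpace ℝ X] [NormedAddCommGroup Y] [NormedSpace ℝ Y]
  [NormedAddCommGroup X'] [NormedSpace ℝ X'] [NormedAddCommGroup Y'] [NormedSpace ℝ Y']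
  [NormedAddCommGroup X''] [NormedSpace ℝ X''] [NormedAddCommGroup Y''] [NormedSpace ℝ Y'']

/-- No splitting of `j` by a bounded map is needed: a linear lift from a finite-dimensional space is
automatically continuous. -/
theorem exists_lift (j : Y →L[ℝ] Y'') (hj : Function.Surjective j) {N : ℕ}
    (Θ'' : (Fin N → ℝ) →L[ℝ] Y'') : ∃ Θ : (Fin N → ℝ) →L[ℝ] Y, j ∘L Θ = Θ'' := by
  obtain ⟨s, hs⟩ := (j : Y →ₗ[ℝ] Y'').exists_rightInverse_of_surjective
    (LinearMap.range_eq_top.2 hj)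
  refine ⟨LinearMap.toContinuousLinearMap (s ∘ₗ (Θ'' : (Fin N → ℝ) →ₗ[ℝ] Y'')), ?_⟩
  ext1 u
  exact LinearMap.congr_fun hs (Θ'' u)

variable {D : Fred X Y} {D' : Fred X' Y'} {D'' : Fred X'' Y''}
  {iX : X' →L[ℝ] X} {jX : X →L[ℝ] X''} {iY : Y' →L[ℝ] Y} {jY : Y →L[ℝ] Y''}
  {N' N'' M' M'' : ℕ} {Θ' : (Fin N' → ℝ) →L[ℝ] Y'} {Θ'' : (Fin N'' → ℝ) →L[ℝ] Y''}
  {Θ : (Fin (N' + N'') → ℝ) →L[ℝ] Y}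

/-- Invertibility of the middle operator in an exact triple whose outer operators are
invertible. -/
theorem IsExactTriple.isInvertible_stab_prod [CompleteSpace X] [CompleteSpace Y]
    (t : IsExactTriple D D' D'' iX jX iY jY)
    (h₁ : ∀ u, Θ (euclIncl N' N'' u) = iY (Θ' u))
    (h₂ : ∀ u, jY (Θ u) = Θ'' (euclProj N' N'' u))
    {P' : X' × (Fin N' → ℝ) →L[ℝ] (Fin M' → ℝ)} {P'' : X'' × (Fin N'' → ℝ) →L[ℝ] (Fin M'' → ℝ)}
    {P : X × (Fin (N' + N'') → ℝ) →L[ℝ] (Fin (M' + M'') → ℝ)}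
    (hP₁ : ∀ x u, P (iX x, euclIncl N' N'' u) = euclIncl M' M'' (P' (x, u)))
    (hP₂ : ∀ x u, euclProj M' M'' (P (x, u)) = P'' (jX x, euclProj N' N'' u))
    (h' : ((stab Θ' D').1.prod P').IsInvertible) (h'' : ((stab Θ'' D'').1.prod P'').IsInvertible) :
    ((stab Θ D).1.prod P).IsInvertible := by
  refine isInvertible_prod
    (t.stab_surjective h₁ h₂ (surjective_of_prod h') (surjective_of_prod h'')) ⟨?_, fun r => ?_⟩
  · rw [injective_iff_map_eq_zero]
    rintro ⟨⟨x, u⟩, hxu⟩ (hP : P (x, u) = 0)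
    rw [mem_ker_stab] at hxu
    have hxu'' : D''.1 (jX x) + Θ'' (euclProj N' N'' u) = 0 := by
      rw [t.comm_j, ← h₂, ← map_add, hxu, map_zero]
    have k₁ := (kerRestrict_bijective h'').1
      (a₁ := ⟨(jX x, euclProj N' N'' u), hxu''⟩) (a₂ := 0) (by
        rw [map_zero]
        exact (hP₂ x u).symm.trans (by rw [hP, map_zero]))
    have k₂ := congrArg Subtype.val k₁
    obtain ⟨x', rfl⟩ := (t.exact_X x).1 (congrArg Prod.fst k₂)
    obtain ⟨u', rfl⟩ := exists_euclIncl_eq (congrArg Prod.snd k₂)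
    have hxu' : D'.1 x' + Θ' u' = 0 := t.iY_injective (by
      rw [map_add, ← t.comm_i, ← h₁, map_zero]
      exact hxu)
    have k₃ := (kerRestrict_bijective h').1 (a₁ := ⟨(x', u'), hxu'⟩) (a₂ := 0) (by
      rw [map_zero]
      exact isSES_eucl.inj (V'' := Fin M'' → ℝ) ((hP₁ x' u').symm.trans (by rw [hP, map_zero])))
    have k₄ := congrArg Subtype.val k₃
    refine Subtype.ext (Prod.ext ?_ ?_)
    · exact (congrArg iX (congrArg Prod.fst k₄)).trans (map_zero _)
    · exact (congrArg (euclIncl N' N'') (congrArg Prod.snd k₄)).trans (map_zero _)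
  · obtain ⟨⟨x'', u''⟩, h⟩ := h''.surjective (0, euclProj M' M'' r)
    obtain ⟨x, rfl⟩ := t.jX_surjective x''
    obtain ⟨u, rfl⟩ := isSES_eucl.surj (V' := Fin N' → ℝ) u''
    have e₁ : D''.1 (jX x) + Θ'' (euclProj N' N'' u) = 0 := congrArg Prod.fst h
    have e₂ : P'' (jX x, euclProj N' N'' u) = euclProj M' M'' r := congrArg Prod.snd h
    obtain ⟨y', hy'⟩ := (t.exact_Y (D.1 x + Θ u)).1 (by rw [map_add, h₂, ← t.comm_j, e₁])
    obtain ⟨r', hr'⟩ := exists_euclIncl_eq (u := r - P (x, u)) (by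
      rw [map_sub, hP₂, e₂, sub_self])
    obtain ⟨⟨x', u'⟩, k⟩ := h'.surjective (-y', r')
    have e₃ : D'.1 x' + Θ' u' = -y' := congrArg Prod.fst k
    have e₄ : P' (x', u') = r' := congrArg Prod.snd k
    refine ⟨⟨(x, u) + (iX x', euclIncl N' N'' u'), ?_⟩, ?_⟩
    · rw [mem_ker_stab]
      change D.1 (x + iX x') + Θ (u + euclIncl N' N'' u') = 0
      rw [map_add, map_add, h₁, t.comm_i, add_add_add_comm, ← map_add iY, e₃, map_neg, hy',
        add_neg_cancel]
    · change P ((x, u) + (iX x', euclIncl N' N'' u')) = r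
      rw [map_add, hP₁, e₄, hr', add_sub_cancel]

/-- As invertibility is an open condition, this fixes the index, and hence the sign in `val_psi`,
near a given operator. -/
theorem index_of_isInvertible {M N : ℕ} {Θ : (Fin N → ℝ) →L[ℝ] Y}
    {P : X × (Fin N → ℝ) →L[ℝ] (Fin M → ℝ)} (h : ((stab Θ D).1.prod P).IsInvertible) :
    D.index = M - N := by
  have := finrank_stab_ker (surjective_of_prod h)
  rw [finrank_ker_of_prod h] at this
  rw [Fred.index]
  omega

end ExactTripleCoordinates

/-! ### Continuity of `Ψ` over the space of exact triples. -/

namespace ExactTriple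

variable {X Y X' Y' X'' Y'' : Type*}
  [NormedAddCommGroup X] [NormedSpace ℝ X] [NormedAddCommGroup Y] [NormedSpace ℝ Y]
  [NormedAddCommGroup X'] [NormedSpace ℝ X'] [NormedAddCommGroup Y'] [NormedSpace ℝ Y']
  [NormedAddCommGroup X''] [NormedSpace ℝ X''] [NormedAddCommGroup Y''] [NormedSpace ℝ Y'']

theorem isHomeomorph_psiMap [CompleteSpace X] [CompleteSpace Y] [CompleteSpace X']
    [CompleteSpace Y'] [CompleteSpace X''] [CompleteSpace Y''] :
    IsHomeomorph (psiMap X Y X' Y' X'' Y'') := by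
  refine isHomeomorph_of_isCoordOn
    (E := TensorBundle ((projL : ExactTriple X Y X' Y' X'' Y'' → Fred X' Y') *ᵖ (Det X' Y'))
      ((projR : ExactTriple X Y X' Y' X'' Y'' → Fred X'' Y'') *ᵖ (Det X'' Y'')))
    (E' := (projC : ExactTriple X Y X' Y' X'' Y'' → Fred X Y) *ᵖ (Det X Y))
    (fun t => (psi t).toEquiv) fun t₀ => ?_
  let iX : ExactTriple X Y X' Y' X'' Y'' → (X' →L[ℝ] X) := fun t => t.1.2.2.2.1
  let jX : ExactTriple X Y X' Y' X'' Y'' → (X →L[ℝ] X'') := fun t => t.1.2.2.2.2.1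
  let iY : ExactTriple X Y X' Y' X'' Y'' → (Y' →L[ℝ] Y) := fun t => t.1.2.2.2.2.2.1
  let jY : ExactTriple X Y X' Y' X'' Y'' → (Y →L[ℝ] Y'') := fun t => t.1.2.2.2.2.2.2
  have hC : Continuous (projC : ExactTriple X Y X' Y' X'' Y'' → Fred X Y) := by
    unfold projC; fun_prop
  have hL : Continuous (projL : ExactTriple X Y X' Y' X'' Y'' → Fred X' Y') := by
    unfold projL; fun_prop
  have hR : Continuous (projR : ExactTriple X Y X' Y' X'' Y'' → Fred X'' Y'') := by
    unfold projR; fun_prop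
  have hiX : Continuous iX := by fun_prop
  have hjX : Continuous jX := by fun_prop
  have hiY : Continuous iY := by fun_prop
  have hjY : Continuous jY := by fun_prop
  have hex : ∀ t : ExactTriple X Y X' Y' X'' Y'',
      IsExactTriple (projC t) (projL t) (projR t) (iX t) (jX t) (iY t) (jY t) := fun t => t.2
  obtain ⟨N', Θ', hΘ'⟩ : ∃ (N' : ℕ) (Θ' : (Fin N' → ℝ) →L[ℝ] Y'),
    Function.Surjective (stab Θ' (projL t₀)).1 := ⟨_, exists_stab_surjective _⟩
  obtain ⟨N'', Θ₀, hΘ₀⟩ : ∃ (N'' : ℕ) (Θ₀ : (Fin N'' → ℝ) →L[ℝ] Y''),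
    Function.Surjective (stab Θ₀ (projR t₀)).1 := ⟨_, exists_stab_surjective _⟩
  -- With a fixed lift `L` to `Y`, the stabilization `jY t ∘L L` of `D''` moves with `t` and stays
  -- compatible with the one of `D`.
  obtain ⟨L, rfl⟩ := exists_lift (jY t₀) (hex t₀).jY_surjective Θ₀
  obtain ⟨M', hM'⟩ : ∃ M' : ℕ, finrank ℝ (stab Θ' (projL t₀)).Ker = M' := ⟨_, rfl⟩
  obtain ⟨M'', hM''⟩ : ∃ M'' : ℕ, finrank ℝ (stab (jY t₀ ∘L L) (projR t₀)).Ker = M'' := ⟨_, rfl⟩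
  let incl : ExactTriple X Y X' Y' X'' Y'' → (X' × (Fin N' → ℝ) →L[ℝ] X × (Fin N' → ℝ)) :=
    fun t => (iX t ∘L ContinuousLinearMap.fst ℝ X' (Fin N' → ℝ)).prod
      (ContinuousLinearMap.snd ℝ X' (Fin N' → ℝ))
  have hincl : Continuous incl :=
    continuous_clm_prod.comp ((hiX.clm_comp continuous_const).prodMk continuous_const)
  -- For the same reason `Q` lives on `X × ℝ^{N'}`: its restriction along `incl t` gives kernel
  -- coordinates for `D'` that extend to the middle term for every `t`.
  obtain ⟨Q, hQ⟩ := exists_isInvertible_prod_comp _ hΘ' (incl t₀) (fun p q hpq =>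
    Prod.ext ((hex t₀).iX_injective (congrArg Prod.fst hpq))
      (congrArg (Prod.snd : X × (Fin N' → ℝ) → _) hpq)) hM'
  obtain ⟨P'', hP''⟩ := exists_isInvertible_prod _ hΘ₀ hM''
  let P' : ExactTriple X Y X' Y' X'' Y'' → (X' × (Fin N' → ℝ) →L[ℝ] (Fin M' → ℝ)) :=
    fun t => Q ∘L incl t
  let p' := LinearMap.toContinuousLinearMap (euclFst N' N'')
  let p'' := LinearMap.toContinuousLinearMap (euclProj N' N'')
  let Θ : ExactTriple X Y X' Y' X'' Y'' → ((Fin (N' + N'') → ℝ) →L[ℝ] Y) :=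
    fun t => iY t ∘L Θ' ∘L p' + L ∘L p''
  let P : ExactTriple X Y X' Y' X'' Y'' →
      (X × (Fin (N' + N'') → ℝ) →L[ℝ] (Fin (M' + M'') → ℝ)) :=
    fun t => glueCoord M' M'' (Q ∘L (ContinuousLinearMap.id ℝ X).prodMap p')
      (P'' ∘L (jX t ∘L ContinuousLinearMap.fst ℝ X (Fin (N' + N'') → ℝ)).prod
        (p'' ∘L ContinuousLinearMap.snd ℝ X (Fin (N' + N'') → ℝ)))
  have hΘc : Continuous Θ := (hiY.clm_comp continuous_const).add continuous_const
  have hPc : Continuous P := continuous_iff_continuousAt.2 fun t =>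
    continuousAt_glueCoord continuousAt_const (continuousAt_const.clm_comp
      (continuous_clm_prod.comp
        ((hjX.clm_comp continuous_const).prodMk continuous_const)).continuousAt)
  have h₁ : ∀ t u, Θ t (euclIncl N' N'' u) = iY t (Θ' u) := fun t u => by
    change iY t (Θ' (euclFst N' N'' (euclIncl N' N'' u))) +
      L (euclProj N' N'' (euclIncl N' N'' u)) = _
    rw [euclFst_euclIncl, euclProj_euclIncl, map_zero, add_zero]
  have h₂ : ∀ t u, jY t (Θ t u) = (jY t ∘L L) (euclProj N' N'' u) := fun t u => by
    change jY t (iY t (Θ' (euclFst N' N'' u)) + L (euclProj N' N'' u)) = jY t (L _)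
    rw [map_add, ((hex t).exact_Y _).2 ⟨_, rfl⟩, zero_add]
  have hP₁ : ∀ t x u, P t (iX t x, euclIncl N' N'' u) = euclIncl M' M'' (P' t (x, u)) :=
    fun t x u => by
      refine (glueCoord_of_eq_zero _ _ ?_).trans ?_
      · change P'' (jX t (iX t x), euclProj N' N'' (euclIncl N' N'' u)) = 0
        rw [((hex t).exact_X _).2 ⟨_, rfl⟩, euclProj_euclIncl]
        exact map_zero P''
      · change euclIncl M' M'' (Q (iX t x, euclFst N' N'' (euclIncl N' N'' u))) = _
        rw [euclFst_euclIncl]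
        rfl
  have hP₂ : ∀ t x u, euclProj M' M'' (P t (x, u)) = P'' (jX t x, euclProj N' N'' u) :=
    fun t x u => euclProj_glueCoord _ _ _
  obtain ⟨U', ht', hU', hv'⟩ := isCoordOn_val_family (Θ := fun _ => Θ') (P := P') hL
    continuous_const (continuous_const.clm_comp hincl) hQ
  obtain ⟨U'', ht'', hU'', hv''⟩ := isCoordOn_val_family (Θ := fun t => jY t ∘L L)
    (P := fun _ => P'') hR (hjY.clm_comp continuous_const) continuous_const hP''
  obtain ⟨U, ht, hU, hv⟩ := isCoordOn_val_family hC hΘc hPc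
    ((hex t₀).isInvertible_stab_prod (h₁ t₀) (h₂ t₀) (hP₁ t₀) (hP₂ t₀) hQ hP'')
  have hW : IsOpen (U ∩ (U' ∩ U'')) := hv.isOpen.inter (hv'.isOpen.inter hv''.isOpen)
  -- The sign of `val_psi`, constant on `U''`; absorbing it into the tensor coordinate makes `Ψ` the
  -- identity in coordinates.
  let c : ℝ := (-1) ^ ((N' : ℤ) * (M'' - N''))
  refine ⟨U ∩ (U' ∩ U''), fun t => c • tensorCoord _ _ t, _, ⟨ht, ht', ht''⟩,
    ((hv'.mono hW fun t h => h.2.1).tensor (hv''.mono hW fun t h => h.2.2)).smul (f := fun _ => c)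
      continuousOn_const (fun _ _ => zpow_ne_zero _ (by norm_num)) fun _ _ _ => rfl,
    hv.mono hW fun t h => h.1, fun t h => ?_⟩
  have hi : (projR t).index = M'' - N'' := index_of_isInvertible (hU'' t h.2.2)
  have key : val (Θ t) (P t) (projC t) ∘ₗ (psi t).toLinearMap =
      c • ((TensorProduct.lid ℝ ℝ).toLinearMap ∘ₗ
        TensorProduct.map (val Θ' (P' t) (projL t)) (val (jY t ∘L L) P'' (projR t))) :=
    TensorProduct.ext' fun σ' σ'' => by
      refine (IsExactTriple.val_psi t.2 (h₁ t) (h₂ t) (surjective_of_prod (hU' t h.2.1))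
        (surjective_of_prod (hU'' t h.2.2)) (finrank_ker_of_prod (hU' t h.2.1))
        (finrank_ker_of_prod (hU'' t h.2.2)) (P' t) P'' (P t) (hP₁ t) (hP₂ t) σ' σ'').trans ?_
      change (-1 : ℝ) ^ ((N' : ℤ) * (projR t).index) * _ = _
      rw [hi]
      rfl
  exact fun x => LinearMap.congr_fun key x

end ExactTriple

end

end DetBundle

theorem mainTheorem8 {X Y X' Y' X'' Y'' : Type*}
    [NormedAddCommGroup X] [NormedSpace ℝ X] [CompleteSpace X]
    [NormedAddCommGroup Y] [NormedSpace ℝ Y] [CompleteSpace Y]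
    [NormedAddCommGroup X'] [NormedSpace ℝ X'] [CompleteSpace X']
    [NormedAddCommGroup Y'] [NormedSpace ℝ Y'] [CompleteSpace Y']
    [NormedAddCommGroup X''] [NormedSpace ℝ X''] [CompleteSpace X'']
    [NormedAddCommGroup Y''] [NormedSpace ℝ Y''] [CompleteSpace Y''] :
    DetBundle.IsLineBundle (DetBundle.Det X Y) ∧
    DetBundle.IsLineBundle (DetBundle.Det X' Y') ∧
    DetBundle.IsLineBundle (DetBundle.Det X'' Y'') ∧
    IsHomeomorph (DetBundle.ExactTriple.psiMap X Y X' Y' X'' Y'') :=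
  ⟨DetBundle.isLineBundle_det, DetBundle.isLineBundle_det, DetBundle.isLineBundle_det,
    DetBundle.ExactTriple.isHomeomorph_psiMap⟩
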